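/- Let $X$ be an infinite compact metric space, $\alpha : X \to X$ a minimal homeomorphism (every closed $E \subset X$ with $\alpha(E) \subset E$ is $\emptyset$ or $X$), and $\mathscr{V}$ a complex line bundle over $X$ with a Hermitian structure; no assumption is made on $\dim X$. Let $Y \subset X$ be a non-empty closed subset that meets each $\alpha$-orbit at most once, i.e. $\alpha^n(Y) \cap Y = \emptyset$ for every $n \in \mathbb{Z} \setminus \{0\}$, and suppose that for every integer $N \ge 0$ there is an open set $W_N \supset Y$ such that $\mathscr{V}|_{\alpha^n(W_N)}$ is trivial whenever $-N \le n \le N$. Let $\mathcal{E} = \Gamma(\mathscr{V}, \alpha)$ be the $\mathrm{C}^*$-correspondence over $C(X)$ consisting of the continuous sections of $\mathscr{V}$, with the pointwise right action of $C(X)$, inner product $\langle \xi, \eta\rangle(x) = \langle \xi(x), \eta(x)\rangle$ and left action $\varphi(f)\xi = \xi\,(f \circ \alpha)$. Let $\mathcal{E}_Y := C_0(X \setminus Y)\,\mathcal{E}$ be the closed span of $\{\varphi(f)\xi \mid f \in C(X),\ f|_Y = 0,\ \xi \in \mathcal{E}\}$, a $\mathrm{C}^*$-correspondence over $C(X)$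 with the restricted structure. For a $\mathrm{C}^*$-correspondence $\mathcal{F}$ let $\mathcal{O}(\mathcal{F})$ denote its Cuntz--Pimsner algebra, the $\mathrm{C}^*$-algebra generated by the universal (Katsura-)covariant representation of $\mathcal{F}$. Then the inclusion $\mathcal{E}_Y \subset \mathcal{E}$ (together with the identity of $C(X)$) induces an injective unital $^*$-homomorphism $\mathcal{O}(\mathcal{E}_Y) \to \mathcal{O}(\mathcal{E})$, and its image $B$ is a centrally large subalgebra of $A := \mathcal{O}(\mathcal{E})$. That is, $A$ is an infinite-dimensional simple unital $\mathrm{C}^*$-algebra, $B \subset A$ is a unital $\mathrm{C}^*$-subalgebra, and for every $m \in \mathbb{Z}_{>0}$, $a_1, \dots, a_m \in A$, $\epsilon > 0$, $x \in A_+$ with $\|x\| = 1$ and $y \in B_+ \setminus \{0\}$ there are $c_1, \dots, c_m \in A$ and $g \in B$ such that 1. $0 \le g \le 1$; 2. $\|c_j - a_j\| < \epsilon$ for all $j$; 3. $(1 - g)c_j \in B$ for all $j$; 4. $g \precsim_B y$ and $g \precsim_A x$, where for a $\mathrm{C}^*$-algebra $D$ and $a,b \in D_+$ one writes $a \precsim_D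 b$ if there are $r_n \in D$ with $\|r_n b r_n^* - a\| \to 0$; 5. $\|(1-g)x(1-g)\| > 1 - \epsilon$; 6. $\|g a_j - a_j g\| < \epsilon$ for all $j$. -/

import Mathlib

open scoped ComplexOrder InnerProductSpace ENNReal Topology
set_option linter.unusedSectionVars false

universe u v w

namespace HilbertModule

variable (A : Type u) [CommCStarAlgebra A] [PartialOrder A] [StarOrderedRing A]
variable {E : Type v} [NormedAddCommGroup E] [NormedSpace ℂ E]
  [Module A E] [IsScalarTower ℂ A E] [CStarModule A E]

theorem norm_smul_le_mul (a : A) (ξ : E) : ‖a • ξ‖ ≤ ‖a‖ * ‖ξ‖ := by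
  have h : ‖a • ξ‖ ^ 2 ≤ (‖a‖ * ‖ξ‖) ^ 2 := by
    rw [CStarModule.norm_sq_eq A, mul_pow, CStarModule.norm_sq_eq A (x := ξ)]
    rw [CStarModule.inner_op_smul_right, CStarModule.inner_op_smul_left]
    calc ‖a * (inner A ξ ξ * star a)‖ ≤ ‖a‖ * (‖inner A ξ ξ‖ * ‖star a‖) :=
          (norm_mul_le _ _).trans (by gcongr; exact norm_mul_le _ _)
      _ = _ := by rw [norm_star]; ring
  exact (pow_le_pow_iff_left₀ (norm_nonneg _) (by positivity) two_ne_zero).mp h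

variable (E) in
theorem continuousConstSMul : ContinuousConstSMul A E where
  continuous_const_smul a := by
    refine ((LipschitzWith.of_dist_le_mul (K := ‖a‖₊) fun ξ η => ?_)).continuous
    rw [dist_eq_norm, dist_eq_norm, ← smul_sub]
    exact norm_smul_le_mul A a (ξ - η)

/-- The rank one operator `θ_{ξ,η} ζ = ξ ⟪η, ζ⟫`. -/
noncomputable def rankOne (ξ η : E) : E →L[ℂ] E :=
  LinearMap.mkContinuous
    { toFun := fun ζ => inner A η ζ • ξ
      map_add' := fun ζ ζ' => by rw [CStarModule.inner_add_right, add_smul]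
      map_smul' := fun z ζ => by
        rw [CStarModule.inner_smul_right_complex, smul_assoc, RingHom.id_apply] }
    (‖η‖ * ‖ξ‖) fun ζ => by
      calc ‖inner A η ζ • ξ‖ ≤ ‖inner A η ζ‖ * ‖ξ‖ := norm_smul_le_mul A _ _
        _ ≤ (‖η‖ * ‖ζ‖) * ‖ξ‖ := by gcongr; exact CStarModule.norm_inner_le E
        _ = _ := by ring

variable (E) in
/-- The compact operators `𝒦(E)`: the closed linear span of the rank one operators. -/
noncomputable def compactOperators : Submodule ℂ (E →L[ℂ] E) :=
  (Submodule.span ℂ {T | ∃ ξ η : E, T = rankOne A ξ η}).topologicalClosure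

theorem rankOne_mem (ξ η : E) : rankOne A ξ η ∈ compactOperators A E :=
  Submodule.le_topologicalClosure _ (Submodule.subset_span ⟨ξ, η, rfl⟩)

/-- A closed submodule of a Hilbert module is a Hilbert module with the restricted inner product. -/
noncomputable instance submoduleCStarModule (p : Submodule A E) : CStarModule A p where
  inner ξ η := inner A (ξ : E) (η : E)
  inner_add_right := CStarModule.inner_add_right
  inner_self_nonneg := CStarModule.inner_self_nonneg
  inner_self := by
    intro x
    exact CStarModule.inner_self.trans (by simp)
  inner_op_smul_right := CStarModule.inner_op_smul_right
  inner_smul_right_complex := CStarModule.inner_smul_right_complex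
  star_inner _ _ := CStarModule.star_inner _ _
  norm_eq_sqrt_norm_inner_self x := CStarModule.norm_eq_sqrt_norm_inner_self (x : E)

end HilbertModule

open HilbertModule

/-- The structure map of a unital `C⋆`-correspondence over the commutative unital `C⋆`-algebra `A`
whose underlying right Hilbert `A`-module is `E`: a unital `⋆`-homomorphism `φ` from `A` into the
adjointable operators on `E`. As `A` is commutative, the right action is written `a • ξ`. -/
structure CStarCorrespondence (A : Type u) [CommCStarAlgebra A] [PartialOrder A]
    [StarOrderedRing A] (E : Type v) [NormedAddCommGroup E] [NormedSpace ℂ E] [CompleteSpace E]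
    [Module A E] [IsScalarTower ℂ A E] [CStarModule A E] where
  φ : A →ₐ[ℂ] (E →L[ℂ] E)
  inner_φ_left : ∀ (a : A) (ξ η : E), inner A (φ a ξ) η = inner A ξ (φ (star a) η)

namespace CStarCorrespondence

variable {A : Type u} [CommCStarAlgebra A] [PartialOrder A] [StarOrderedRing A]
variable {E : Type v} [NormedAddCommGroup E] [NormedSpace ℂ E] [CompleteSpace E]
  [Module A E] [IsScalarTower ℂ A E] [CStarModule A E]
variable (Φ : CStarCorrespondence A E)

theorem φ_smul (a b : A) (ξ : E) : Φ.φ a (b • ξ) = b • Φ.φ a ξ := by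
  have h : ∀ η : E, inner A η (Φ.φ a (b • ξ) - b • Φ.φ a ξ) = 0 := by
    intro η
    have h1 : ∀ ζ : E, inner A η (Φ.φ a ζ) = inner A (Φ.φ (star a) η) ζ := fun ζ => by
      rw [Φ.inner_φ_left, star_star]
    rw [CStarModule.inner_sub_right, CStarModule.inner_op_smul_right, h1, h1,
      CStarModule.inner_op_smul_right, sub_self]
  exact sub_eq_zero.mp (CStarModule.inner_self.mp (h _))

/-- Katsura's ideal `J_E = φ⁻¹(𝒦(E)) ∩ (ker φ)^⊥`. -/
def katsuraIdeal : Set A :=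
  {a | Φ.φ a ∈ compactOperators A E ∧ ∀ b : A, Φ.φ b = 0 → a * b = 0}

/-- A representation `(π, τ) = (pi, tau)` of the correspondence on the `C⋆`-algebra `B`. -/
structure Representation (B : Type w) [NonUnitalCStarAlgebra B] where
  pi : A →⋆ₙₐ[ℂ] B
  tau : E →ₗ[ℂ] B
  pi_inner : ∀ ξ η : E, pi (inner A ξ η) = star (tau ξ) * tau η
  pi_mul_tau : ∀ (a : A) (ξ : E), pi a * tau ξ = tau (Φ.φ a ξ)

variable {Φ} in
/-- Covariance: `π(a) = ψ_τ(φ(a))` for `a ∈ J_E`, where `ψ_τ : 𝒦(E) → B` is the continuous linear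
map determined by `ψ_τ(θ_{ξ,η}) = τ(ξ) τ(η)⋆` (it is automatically a `⋆`-homomorphism). -/
def Representation.IsCovariant {B : Type w} [NonUnitalCStarAlgebra B]
    (ρ : Φ.Representation B) : Prop :=
  ∃ ψ : compactOperators A E →L[ℂ] B,
    (∀ ξ η : E, ψ ⟨rankOne A ξ η, rankOne_mem A ξ η⟩ = ρ.tau ξ * star (ρ.tau η)) ∧
    ∀ (a : A) (ha : a ∈ Φ.katsuraIdeal), ρ.pi a = ψ ⟨Φ.φ a, ha.1⟩

/-- All covariant representations on `C⋆`-algebras of a universe that contains (up to isomorphism)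
every `C⋆`-algebra generated by a covariant representation. -/
structure CovariantRepresentation where
  B : Type (max u v)
  [cstar : NonUnitalCStarAlgebra B]
  ρ : Φ.Representation B
  covariant : ρ.IsCovariant

attribute [instance] CovariantRepresentation.cstar

/-- The `ℓ^∞`-product of the target algebras of all covariant representations. -/
abbrev Product : Type (max u v + 1) :=
  lp (fun i : Φ.CovariantRepresentation => i.B) ∞

variable {Φ} in
theorem Representation.norm_tau_le {B : Type w} [NonUnitalCStarAlgebra B]
    (ρ : Φ.Representation B) (ξ : E) : ‖ρ.tau ξ‖ ≤ ‖ξ‖ := by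
  have h : ‖ρ.tau ξ‖ ^ 2 ≤ ‖ξ‖ ^ 2 := by
    rw [CStarModule.norm_sq_eq A (x := ξ), sq, ← CStarRing.norm_star_mul_self, ← ρ.pi_inner]
    exact NonUnitalStarAlgHom.norm_apply_le ρ.pi _
  exact (pow_le_pow_iff_left₀ (norm_nonneg _) (norm_nonneg _) two_ne_zero).mp h

variable {Φ} in
theorem Representation.tau_mul_pi {B : Type w} [NonUnitalCStarAlgebra B]
    (ρ : Φ.Representation B) (ξ : E) (a : A) : ρ.tau ξ * ρ.pi a = ρ.tau (a • ξ) := by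
  rw [← sub_eq_zero, ← CStarRing.star_mul_self_eq_zero_iff]
  have h1 : star (ρ.tau ξ * ρ.pi a) * (ρ.tau ξ * ρ.pi a) = ρ.pi (star a * inner A ξ ξ * a) := by
    rw [map_mul, map_mul, ρ.pi_inner, star_mul, map_star]
    simp only [mul_assoc]
  have h2 : star (ρ.tau ξ * ρ.pi a) * ρ.tau (a • ξ) = ρ.pi (star a * (a * inner A ξ ξ)) := by
    rw [← CStarModule.inner_op_smul_right, map_mul, ρ.pi_inner, star_mul, map_star, mul_assoc]
  have h3 : star (ρ.tau (a • ξ)) * (ρ.tau ξ * ρ.pi a) = ρ.pi (inner A ξ ξ * star a * a) := by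
    rw [← CStarModule.inner_op_smul_left, map_mul, ρ.pi_inner, mul_assoc]
  have h4 : star (ρ.tau (a • ξ)) * ρ.tau (a • ξ) = ρ.pi (a * (inner A ξ ξ * star a)) := by
    rw [← ρ.pi_inner, CStarModule.inner_op_smul_right, CStarModule.inner_op_smul_left]
  rw [star_sub, sub_mul, mul_sub, mul_sub, h1, h2, h3, h4, ← map_sub, ← map_sub, ← map_sub]
  convert map_zero ρ.pi using 2
  ring

/-- The direct sum of all covariant representations, on `A`. -/
noncomputable def piProd : A →⋆ₙₐ[ℂ] Φ.Product where
  toFun a := ⟨fun i => i.ρ.pi a, memℓp_infty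
    ⟨‖a‖, by rintro _ ⟨i, rfl⟩; exact NonUnitalStarAlgHom.norm_apply_le i.ρ.pi a⟩⟩
  map_smul' z a := by ext i; exact map_smul i.ρ.pi z a
  map_zero' := by ext i; exact map_zero i.ρ.pi
  map_add' a b := by ext i; exact map_add i.ρ.pi a b
  map_mul' a b := by ext i; exact map_mul i.ρ.pi a b
  map_star' a := by ext i; exact map_star i.ρ.pi a

/-- The direct sum of all covariant representations, on `E`. -/
noncomputable def tauProd : E →ₗ[ℂ] Φ.Product where
  toFun ξ := ⟨fun i => i.ρ.tau ξ, memℓp_infty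
    ⟨‖ξ‖, by rintro _ ⟨i, rfl⟩; exact i.ρ.norm_tau_le ξ⟩⟩
  map_add' ξ η := by ext i; exact map_add i.ρ.tau ξ η
  map_smul' z ξ := by ext i; exact map_smul i.ρ.tau z ξ

/-- The `C⋆`-algebra generated by the direct sum of all covariant representations. -/
noncomputable def generated : NonUnitalStarSubalgebra ℂ Φ.Product :=
  (NonUnitalStarAlgebra.adjoin ℂ
    (Set.range Φ.piProd ∪ Set.range Φ.tauProd)).topologicalClosure

/-- The Cuntz--Pimsner algebra `𝒪(E)`: the `C⋆`-algebra generated by the universal covariant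
representation. -/
def CuntzPimsner : Type (max u v + 1) := Φ.generated

namespace CuntzPimsner

@[reducible] noncomputable def nonUnitalCStarAlgebra : NonUnitalCStarAlgebra Φ.CuntzPimsner :=
  NonUnitalStarSubalgebra.nonUnitalCStarAlgebra Φ.generated
    (h_closed := NonUnitalStarSubalgebra.isClosed_topologicalClosure _)

theorem pi_mem (a : A) : Φ.piProd a ∈ Φ.generated :=
  NonUnitalStarSubalgebra.le_topologicalClosure _
    (NonUnitalStarAlgebra.subset_adjoin ℂ _ (Or.inl ⟨a, rfl⟩))

theorem tau_mem (ξ : E) : Φ.tauProd ξ ∈ Φ.generated :=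
  NonUnitalStarSubalgebra.le_topologicalClosure _
    (NonUnitalStarAlgebra.subset_adjoin ℂ _ (Or.inr ⟨ξ, rfl⟩))

theorem tauProd_mul_piProd (ξ : E) (a : A) :
    Φ.tauProd ξ * Φ.piProd a = Φ.tauProd (a • ξ) := by
  ext i
  exact i.ρ.tau_mul_pi ξ a

theorem unit_mul (x : Φ.Product) (hx : x ∈ Φ.generated) :
    Φ.piProd 1 * x = x ∧ x * Φ.piProd 1 = x := by
  have hclosed : IsClosed {x : Φ.Product | Φ.piProd 1 * x = x ∧ x * Φ.piProd 1 = x} :=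
    (isClosed_eq (continuous_const.mul continuous_id) continuous_id).inter
      (isClosed_eq (continuous_id.mul continuous_const) continuous_id)
  have hstar : star (Φ.piProd 1) = Φ.piProd 1 := by rw [← map_star, star_one]
  refine closure_minimal (fun y hy => ?_) hclosed hx
  refine NonUnitalStarAlgebra.adjoin_induction (R := ℂ)
    (p := fun y _ => Φ.piProd 1 * y = y ∧ y * Φ.piProd 1 = y) ?_ ?_ ?_ ?_ ?_ ?_ hy
  · rintro _ (⟨a, rfl⟩ | ⟨ξ, rfl⟩)
    · rw [← map_mul, ← map_mul, one_mul, mul_one]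
      exact ⟨rfl, rfl⟩
    · refine ⟨?_, ?_⟩
      · ext i
        have h := i.ρ.pi_mul_tau 1 ξ
        rw [map_one Φ.φ] at h
        exact h
      · rw [tauProd_mul_piProd, one_smul]
  · intro a b _ _ ha hb
    rw [mul_add, add_mul, ha.1, hb.1, ha.2, hb.2]
    exact ⟨rfl, rfl⟩
  · rw [mul_zero, zero_mul]
    exact ⟨rfl, rfl⟩
  · intro a b _ _ ha hb
    rw [← mul_assoc, ha.1, mul_assoc, hb.2]
    exact ⟨rfl, rfl⟩
  · intro z a _ ha
    rw [mul_smul_comm, smul_mul_assoc, ha.1, ha.2]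
    exact ⟨rfl, rfl⟩
  · intro a _ ha
    have h1 := congrArg star ha.1
    have h2 := congrArg star ha.2
    rw [star_mul, hstar] at h1 h2
    exact ⟨h2, h1⟩

noncomputable instance : CStarAlgebra Φ.CuntzPimsner :=
  letI := nonUnitalCStarAlgebra Φ
  letI : Ring Φ.CuntzPimsner :=
    { (inferInstance : NonUnitalRing Φ.CuntzPimsner) with
      one := ⟨Φ.piProd 1, pi_mem Φ 1⟩
      one_mul := fun x => Subtype.ext (unit_mul Φ x.1 x.2).1
      mul_one := fun x => Subtype.ext (unit_mul Φ x.1 x.2).2 }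
  letI : Algebra ℂ Φ.CuntzPimsner := Algebra.ofModule smul_mul_assoc mul_smul_comm
  { nonUnitalCStarAlgebra Φ, (inferInstance : Ring Φ.CuntzPimsner),
    (inferInstance : Algebra ℂ Φ.CuntzPimsner) with
    norm_smul_le := fun z x => norm_smul_le z x }

/-- The universal covariant representation on `A`. -/
noncomputable def pi : A →⋆ₐ[ℂ] Φ.CuntzPimsner where
  toFun a := ⟨Φ.piProd a, pi_mem Φ a⟩
  map_one' := rfl
  map_mul' a b := Subtype.ext (map_mul Φ.piProd a b)
  map_zero' := Subtype.ext (map_zero Φ.piProd)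
  map_add' a b := Subtype.ext (map_add Φ.piProd a b)
  commutes' z := Subtype.ext <| by
    rw [Algebra.algebraMap_eq_smul_one]
    exact map_smul Φ.piProd z 1
  map_star' a := Subtype.ext (map_star Φ.piProd a)

/-- The universal covariant representation on `E`. -/
noncomputable def tau : E →ₗ[ℂ] Φ.CuntzPimsner where
  toFun ξ := ⟨Φ.tauProd ξ, tau_mem Φ ξ⟩
  map_add' ξ η := Subtype.ext (map_add Φ.tauProd ξ η)
  map_smul' z ξ := Subtype.ext (map_smul Φ.tauProd z ξ)

end CuntzPimsner

/-- The closed submodule `I E`, the closed span of `{φ(f) ξ | f ∈ I, ξ ∈ E}`. -/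
noncomputable def idealSubmodule (I : Ideal A) : Submodule A E :=
  haveI := HilbertModule.continuousConstSMul A E
  (Submodule.span A {ζ | ∃ f ∈ I, ∃ ξ : E, ζ = Φ.φ f ξ}).topologicalClosure

theorem isClosed_idealSubmodule (I : Ideal A) : IsClosed (Φ.idealSubmodule I : Set E) :=
  isClosed_closure

instance (I : Ideal A) : CompleteSpace (Φ.idealSubmodule I) :=
  (Φ.isClosed_idealSubmodule I).completeSpace_coe

theorem φ_mem_idealSubmodule (I : Ideal A) (a : A) {ζ : E} (hζ : ζ ∈ Φ.idealSubmodule I) :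
    Φ.φ a ζ ∈ Φ.idealSubmodule I := by
  have h : Set.MapsTo (Φ.φ a) (Submodule.span A {ζ | ∃ f ∈ I, ∃ ξ : E, ζ = Φ.φ f ξ})
      (Submodule.span A {ζ | ∃ f ∈ I, ∃ ξ : E, ζ = Φ.φ f ξ}) := by
    intro ζ hζ
    refine Submodule.span_induction ?_ ?_ ?_ ?_ hζ
    · rintro _ ⟨f, hf, ξ, rfl⟩
      refine Submodule.subset_span ⟨a * f, I.mul_mem_left a hf, ξ, ?_⟩
      rw [map_mul]
      rfl
    · rw [map_zero]
      exact Submodule.zero_mem _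
    · intro x y _ _ hx hy
      rw [map_add]
      exact Submodule.add_mem _ hx hy
    · intro b x _ hx
      rw [φ_smul]
      exact Submodule.smul_mem _ b hx
  exact h.closure (Φ.φ a).continuous hζ

/-- The correspondence `I E`, with the structure map restricted from `E`. -/
noncomputable def restrictIdeal (I : Ideal A) :
    CStarCorrespondence A (Φ.idealSubmodule I) where
  φ :=
    { toFun := fun a =>
        ((Φ.φ a).comp ((Φ.idealSubmodule I).restrictScalars ℂ).subtypeL).codRestrict
          ((Φ.idealSubmodule I).restrictScalars ℂ) fun ζ => Φ.φ_mem_idealSubmodule I a ζ.2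
      map_one' := ContinuousLinearMap.ext fun ζ => Subtype.ext <|
        congrArg (fun T : E →L[ℂ] E => T ζ) (map_one Φ.φ)
      map_mul' := fun a b => ContinuousLinearMap.ext fun ζ => Subtype.ext <|
        congrArg (fun T : E →L[ℂ] E => T ζ) (map_mul Φ.φ a b)
      map_zero' := ContinuousLinearMap.ext fun ζ => Subtype.ext <|
        congrArg (fun T : E →L[ℂ] E => T ζ) (map_zero Φ.φ)
      map_add' := fun a b => ContinuousLinearMap.ext fun ζ => Subtype.ext <|
        congrArg (fun T : E →L[ℂ] E => T ζ) (map_add Φ.φ a b)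
      commutes' := fun z => ContinuousLinearMap.ext fun ζ => Subtype.ext <|
        congrArg (fun T : E →L[ℂ] E => T ζ) (Φ.φ.commutes z) }
  inner_φ_left a ξ η := Φ.inner_φ_left a (ξ : E) (η : E)

end CStarCorrespondence

section LineBundles

variable {X : Type u} [TopologicalSpace X] (V : X → Type v)
  [∀ x, NormedAddCommGroup (V x)] [∀ x, InnerProductSpace ℂ (V x)]
  [TopologicalSpace (Bundle.TotalSpace ℂ V)] [FiberBundle ℂ V]

/-- The inner products on the fibres of `V` form a Hermitian structure: they are jointly continuous
on the fibre product `V ×_X V`. -/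
class IsHermitianBundle : Prop where
  continuous_inner : Continuous fun p : Bundle.TotalSpace (ℂ × ℂ) (fun x => V x × V x) =>
    @inner ℂ (V p.1) InnerProductSpace.toInner p.2.1 p.2.2

/-- The line bundle `V` is trivial over the open set `U`. -/
def IsTrivialOver [VectorBundle ℂ ℂ V] (U : Set X) : Prop :=
  ∃ e : Bundle.Trivialization ℂ (Bundle.TotalSpace.proj : Bundle.TotalSpace ℂ V → X),
    e.IsLinear ℂ ∧ e.baseSet = U

variable [VectorBundle ℂ ℂ V]

/-- The continuous sections of `V`, as a subspace of all sections. -/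
def continuousSections : Submodule ℂ (∀ x, V x) where
  carrier := {ξ | Continuous fun x => Bundle.TotalSpace.mk' ℂ x (ξ x)}
  zero_mem' := Bundle.Trivialization.continuous_zeroSection (F := ℂ) (E := V) ℂ
  add_mem' := by
    intro ξ η hξ hη
    refine continuous_iff_continuousAt.2 fun x => ?_
    have h1 := (FiberBundle.continuousAt_section ℂ x).1 hξ.continuousAt
    have h2 := (FiberBundle.continuousAt_section ℂ x).1 hη.continuousAt
    refine (FiberBundle.continuousAt_section ℂ x).2 ((h1.add h2).congr_of_eventuallyEq ?_)
    filter_upwards [(trivializationAt ℂ V x).open_baseSet.mem_nhds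
      (FiberBundle.mem_baseSet_trivializationAt ℂ V x)] with y hy
    exact ((trivializationAt ℂ V x).linear ℂ hy).map_add (ξ y) (η y)
  smul_mem' := by
    intro z ξ hξ
    refine continuous_iff_continuousAt.2 fun x => ?_
    have h1 := (FiberBundle.continuousAt_section ℂ x).1 hξ.continuousAt
    refine (FiberBundle.continuousAt_section ℂ x).2 ((h1.const_smul z).congr_of_eventuallyEq ?_)
    filter_upwards [(trivializationAt ℂ V x).open_baseSet.mem_nhds
      (FiberBundle.mem_baseSet_trivializationAt ℂ V x)] with y hy
    exact ((trivializationAt ℂ V x).linear ℂ hy).map_smul z (ξ y)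

/-- The space `Γ(V)` of continuous sections. -/
def Sections : Type (max u v) := continuousSections V

namespace Sections

instance : AddCommGroup (Sections V) := inferInstanceAs (AddCommGroup (continuousSections V))

instance : Module ℂ (Sections V) := inferInstanceAs (Module ℂ (continuousSections V))

instance : CoeFun (Sections V) (fun _ => ∀ x, V x) := ⟨fun ξ => ξ.1⟩

variable {V}

@[ext] theorem ext {ξ η : Sections V} (h : ∀ x, ξ x = η x) : ξ = η := Subtype.ext (funext h)

theorem continuous (ξ : Sections V) : Continuous fun x => Bundle.TotalSpace.mk' ℂ x (ξ x) := ξ.2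

theorem add_apply (ξ η : Sections V) (x : X) : (ξ + η) x = ξ x + η x := rfl

theorem sub_apply (ξ η : Sections V) (x : X) : (ξ - η) x = ξ x - η x := rfl

theorem complex_smul_apply (z : ℂ) (ξ : Sections V) (x : X) : (z • ξ) x = z • ξ x := rfl

theorem zero_apply (x : X) : (0 : Sections V) x = 0 := rfl

/-- The pointwise (right) action of functions on sections. -/
noncomputable instance : SMul C(X, ℂ) (Sections V) where
  smul f ξ := ⟨fun x => f x • ξ x, by
    refine continuous_iff_continuousAt.2 fun x => ?_
    have h1 := (FiberBundle.continuousAt_section ℂ x).1 ξ.continuous.continuousAt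
    refine (FiberBundle.continuousAt_section ℂ x).2
      ((f.continuous.continuousAt.smul h1).congr_of_eventuallyEq ?_)
    filter_upwards [(trivializationAt ℂ V x).open_baseSet.mem_nhds
      (FiberBundle.mem_baseSet_trivializationAt ℂ V x)] with y hy
    exact ((trivializationAt ℂ V x).linear ℂ hy).map_smul (f y) (ξ y)⟩

theorem smul_apply (f : C(X, ℂ)) (ξ : Sections V) (x : X) : (f • ξ) x = f x • ξ x := rfl

noncomputable instance : Module C(X, ℂ) (Sections V) where
  one_smul ξ := ext fun x => one_smul ℂ (ξ x)
  mul_smul f g ξ := ext fun x => mul_smul (f x) (g x) (ξ x)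
  smul_zero f := ext fun x => smul_zero (f x)
  smul_add f ξ η := ext fun x => smul_add (f x) (ξ x) (η x)
  add_smul f g ξ := ext fun x => add_smul (f x) (g x) (ξ x)
  zero_smul ξ := ext fun x => zero_smul ℂ (ξ x)

instance : IsScalarTower ℂ C(X, ℂ) (Sections V) where
  smul_assoc z f ξ := ext fun x => smul_assoc z (f x) (ξ x)

variable [IsHermitianBundle V]

/-- The `C(X)`-valued inner product of sections, `⟪ξ, η⟫(x) = ⟪ξ(x), η(x)⟫`. -/
noncomputable instance : Inner C(X, ℂ) (Sections V) where
  inner ξ η := ⟨fun x => @inner ℂ (V x) InnerProductSpace.toInner (ξ x) (η x), by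
    have h : Continuous fun x : X =>
        (⟨x, (ξ x, η x)⟩ : Bundle.TotalSpace (ℂ × ℂ) (fun x => V x × V x)) :=
      (FiberBundle.Prod.isInducing_diag ℂ V ℂ V).continuous_iff.2
        (ξ.continuous.prodMk η.continuous)
    exact (IsHermitianBundle.continuous_inner (V := V)).comp h⟩

theorem inner_apply (ξ η : Sections V) (x : X) :
    (inner C(X, ℂ) ξ η) x = @inner ℂ (V x) InnerProductSpace.toInner (ξ x) (η x) := rfl

variable [CompactSpace X]

noncomputable instance : Norm (Sections V) where
  norm ξ := √‖inner C(X, ℂ) ξ ξ‖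

noncomputable instance : CStarModule C(X, ℂ) (Sections V) where
  inner_add_right {ξ η ζ} := ContinuousMap.ext fun x => inner_add_right (ξ x) (η x) (ζ x)
  inner_self_nonneg {ξ} := fun x => by
    have h : @inner ℂ (V x) InnerProductSpace.toInner (ξ x) (ξ x) = ((‖ξ x‖ ^ 2 : ℝ) : ℂ) := by
      rw [inner_self_eq_norm_sq_to_K]
      norm_cast
    change (0 : ℂ) ≤ inner ℂ (ξ x) (ξ x)
    rw [h]
    exact_mod_cast sq_nonneg ‖ξ x‖
  inner_self {ξ} := by
    constructor
    · intro h
      exact ext fun x => inner_self_eq_zero.mp (DFunLike.congr_fun h x)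
    · rintro rfl
      exact ContinuousMap.ext fun x => inner_zero_left (0 : V x)
  inner_op_smul_right {f ξ η} := ContinuousMap.ext fun x => inner_smul_right (ξ x) (η x) (f x)
  inner_smul_right_complex {z ξ η} := ContinuousMap.ext fun x => inner_smul_right (ξ x) (η x) z
  star_inner ξ η := ContinuousMap.ext fun x => inner_conj_symm (η x) (ξ x)
  norm_eq_sqrt_norm_inner_self ξ := rfl

noncomputable instance : NormedAddCommGroup (Sections V) :=
  CStarModule.normedAddCommGroup C(X, ℂ)

noncomputable instance : NormedSpace ℂ (Sections V) :=
  .ofCore (CStarModule.normedSpaceCore C(X, ℂ))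

theorem norm_apply_le (ξ : Sections V) (x : X) : ‖ξ x‖ ≤ ‖ξ‖ := by
  have h : ‖ξ x‖ ^ 2 ≤ ‖ξ‖ ^ 2 := by
    rw [CStarModule.norm_sq_eq C(X, ℂ) (x := ξ)]
    refine le_trans (le_of_eq ?_) (ContinuousMap.norm_coe_le_norm _ x)
    rw [inner_apply, inner_self_eq_norm_sq_to_K]
    simp
  exact (pow_le_pow_iff_left₀ (norm_nonneg _) (norm_nonneg _) two_ne_zero).mp h

theorem norm_le_of_forall {ξ : Sections V} {C : ℝ} (hC : 0 ≤ C) (h : ∀ x, ‖ξ x‖ ≤ C) :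
    ‖ξ‖ ≤ C := by
  have h2 : ‖ξ‖ ^ 2 ≤ C ^ 2 := by
    rw [CStarModule.norm_sq_eq C(X, ℂ) (x := ξ)]
    refine (ContinuousMap.norm_le _ (by positivity)).2 fun x => ?_
    rw [inner_apply, inner_self_eq_norm_sq_to_K]
    simpa using pow_le_pow_left₀ (norm_nonneg _) (h x) 2
  exact (pow_le_pow_iff_left₀ (norm_nonneg _) hC two_ne_zero).mp h2

/-- A pointwise limit of continuous sections that is uniform for the fibre norms is continuous. -/
theorem continuous_of_uniform {ξ : ∀ x, V x}
    (h : ∀ ε > 0, ∃ η : Sections V, ∀ x, ‖ξ x - η x‖ ≤ ε) :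
    Continuous fun x => Bundle.TotalSpace.mk' ℂ x (ξ x) := by
  refine continuous_iff_continuousAt.2 fun x₀ => ?_
  set e := trivializationAt ℂ V x₀ with he
  have hx₀ : x₀ ∈ e.baseSet := FiberBundle.mem_baseSet_trivializationAt ℂ V x₀
  have hnhds : e.baseSet ∈ 𝓝 x₀ := e.open_baseSet.mem_nhds hx₀
  have hs : ContinuousAt (fun x => Bundle.TotalSpace.mk' ℂ x (e.symm x (1 : ℂ))) x₀ := by
    have h1 : ContinuousAt (fun x => e.toOpenPartialHomeomorph.symm (x, (1 : ℂ))) x₀ :=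
      ContinuousAt.comp (f := fun x : X => (x, (1 : ℂ)))
        (e.toOpenPartialHomeomorph.symm.continuousAt
          (by simpa [e.mem_target] using hx₀))
        (by fun_prop)
    refine h1.congr_of_eventuallyEq ?_
    filter_upwards [hnhds] with y hy
    exact e.mk_symm hy 1
  have hn : ContinuousAt (fun x => @inner ℂ (V x) InnerProductSpace.toInner
      (e.symm x (1 : ℂ)) (e.symm x (1 : ℂ))) x₀ := by
    have h1 : ContinuousAt (fun x : X => (⟨x, (e.symm x (1 : ℂ), e.symm x (1 : ℂ))⟩ :
        Bundle.TotalSpace (ℂ × ℂ) (fun x => V x × V x))) x₀ :=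
      (FiberBundle.Prod.isInducing_diag ℂ V ℂ V).continuousAt_iff.2 (hs.prodMk hs)
    exact ContinuousAt.comp (IsHermitianBundle.continuous_inner (V := V)).continuousAt h1
  have hs0 : e.symm x₀ (1 : ℂ) ≠ 0 := by
    intro h0
    have h1 := e.apply_mk_symm hx₀ (1 : ℂ)
    rw [h0] at h1
    have h2 := (e.linear ℂ hx₀).map_zero
    rw [h1] at h2
    exact one_ne_zero h2
  obtain ⟨δ, hδ, hev⟩ : ∃ δ > 0, ∀ᶠ x in 𝓝 x₀, δ ≤ ‖e.symm x (1 : ℂ)‖ := by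
    refine ⟨‖e.symm x₀ (1 : ℂ)‖ / 2, by positivity, ?_⟩
    have h1 : ContinuousAt (fun x => ‖e.symm x (1 : ℂ)‖) x₀ := by
      have h2 := (hn.norm).sqrt
      refine h2.congr_of_eventuallyEq (Filter.Eventually.of_forall fun x => ?_)
      change _ = √‖@inner ℂ (V x) InnerProductSpace.toInner (e.symm x (1 : ℂ)) (e.symm x (1 : ℂ))‖
      rw [inner_self_eq_norm_sq_to_K]
      simp
    have h3 : ‖e.symm x₀ (1 : ℂ)‖ / 2 < ‖e.symm x₀ (1 : ℂ)‖ :=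
      half_lt_self (norm_pos_iff.2 hs0)
    exact (h1.eventually (lt_mem_nhds h3)).mono fun x hx => le_of_lt hx
  refine (FiberBundle.continuousAt_section ℂ x₀).2 ?_
  refine continuousAt_of_locally_uniform_approx_of_continuousAt fun u hu => ?_
  obtain ⟨ε, hε, hεu⟩ := Metric.mem_uniformity_dist.1 hu
  obtain ⟨η, hη⟩ := h (ε / 2 * δ) (by positivity)
  refine ⟨{x | δ ≤ ‖e.symm x (1 : ℂ)‖} ∩ e.baseSet, Filter.inter_mem hev hnhds,
    fun x => (e ⟨x, η x⟩).2,
    (FiberBundle.continuousAt_section ℂ x₀).1 η.continuous.continuousAt, ?_⟩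
  rintro y ⟨hy1, hy2⟩
  apply hεu
  have hlin := e.linear ℂ hy2
  rw [dist_eq_norm, ← hlin.map_sub]
  have hv : ∀ v : V y, v = (e ⟨y, v⟩).2 • e.symm y (1 : ℂ) := by
    intro v
    have h1 := (e.symmₗ ℂ y).map_smul (e ⟨y, v⟩).2 (1 : ℂ)
    rw [e.symmₗ_apply hy2, e.symmₗ_apply hy2] at h1
    rw [← h1, smul_eq_mul, mul_one, e.symm_apply_apply_mk hy2]
  have h1 := hη y
  rw [hv (ξ y - η y), norm_smul] at h1
  have h2 : ‖(e ⟨y, ξ y - η y⟩).2‖ * δ ≤ ε / 2 * δ := by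
    refine le_trans ?_ h1
    exact mul_le_mul_of_nonneg_left hy1 (norm_nonneg _)
  have h3 := le_of_mul_le_mul_right h2 hδ
  linarith

instance : CompleteSpace (Sections V) := by
  refine Metric.complete_of_cauchySeq_tendsto fun s hs => ?_
  have hfin : ∀ x, CompleteSpace (V x) := fun x => by
    have h : FiniteDimensional ℂ (V x) :=
      ((trivializationAt ℂ V x).continuousLinearEquivAt ℂ x
        (FiberBundle.mem_baseSet_trivializationAt ℂ V x)).toLinearEquiv.symm.finiteDimensional
    exact FiniteDimensional.complete ℂ (V x)
  have hpt : ∀ x, CauchySeq fun n => s n x := fun x => by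
    refine Metric.cauchySeq_iff.2 fun ε hε => ?_
    obtain ⟨N, hN⟩ := Metric.cauchySeq_iff.1 hs ε hε
    refine ⟨N, fun m hm n hn => lt_of_le_of_lt ?_ (hN m hm n hn)⟩
    rw [dist_eq_norm, dist_eq_norm]
    exact norm_apply_le (s m - s n) x
  choose ξ hξ using fun x => cauchySeq_tendsto_of_complete (hpt x)
  have hunif : ∀ ε > 0, ∃ N, ∀ n ≥ N, ∀ x, ‖ξ x - s n x‖ ≤ ε := by
    intro ε hε
    obtain ⟨N, hN⟩ := Metric.cauchySeq_iff.1 hs ε hε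
    refine ⟨N, fun n hn x => ?_⟩
    refine le_of_tendsto ((hξ x).sub_const (s n x)).norm ?_
    filter_upwards [Filter.eventually_ge_atTop N] with m hm
    have h := hN m hm n hn
    rw [dist_eq_norm] at h
    exact (norm_apply_le (s m - s n) x).trans h.le
  have hcont : Continuous fun x => Bundle.TotalSpace.mk' ℂ x (ξ x) := by
    refine continuous_of_uniform fun ε hε => ?_
    obtain ⟨N, hN⟩ := hunif ε hε
    exact ⟨s N, hN N le_rfl⟩
  obtain ⟨ζ, hζ⟩ : ∃ ζ : Sections V, ∀ x, ζ x = ξ x := ⟨⟨ξ, hcont⟩, fun _ => rfl⟩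
  refine ⟨ζ, ?_⟩
  refine Metric.tendsto_atTop.2 fun ε hε => ?_
  obtain ⟨N, hN⟩ := hunif (ε / 2) (by positivity)
  refine ⟨N, fun n hn => ?_⟩
  rw [dist_comm, dist_eq_norm]
  refine lt_of_le_of_lt (norm_le_of_forall (by positivity) fun x => ?_) (half_lt_self hε)
  rw [sub_apply, hζ]
  exact hN n hn x

/-- The correspondence `Γ(V, α)` over `C(X)`: the Hilbert module `Γ(V)` with the structure map
`φ(f) ξ = ξ (f ∘ α)`. -/
noncomputable def correspondence (V : X → Type v) [∀ x, NormedAddCommGroup (V x)]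
    [∀ x, InnerProductSpace ℂ (V x)] [TopologicalSpace (Bundle.TotalSpace ℂ V)] [FiberBundle ℂ V]
    [VectorBundle ℂ ℂ V] [IsHermitianBundle V] (α : X ≃ₜ X) :
    CStarCorrespondence C(X, ℂ) (Sections V) where
  φ :=
    { toFun := fun f =>
        LinearMap.mkContinuous
          { toFun := fun ξ => (f.comp (α : C(X, X))) • ξ
            map_add' := fun ξ η => smul_add _ ξ η
            map_smul' := fun z ξ => ext fun x => smul_comm _ z (ξ x) }
          ‖f.comp (α : C(X, X))‖ fun ξ => norm_smul_le_mul C(X, ℂ) _ ξ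
      map_one' := by ext ξ x; exact one_smul ℂ (ξ x)
      map_mul' := fun f g => by ext ξ x; exact mul_smul (f (α x)) (g (α x)) (ξ x)
      map_zero' := by ext ξ x; exact zero_smul ℂ (ξ x)
      map_add' := fun f g => by ext ξ x; exact add_smul (f (α x)) (g (α x)) (ξ x)
      commutes' := fun z => by ext ξ x; rfl }
  inner_φ_left f ξ η := ContinuousMap.ext fun x => by
    change inner ℂ (f (α x) • ξ x) (η x) = inner ℂ (ξ x) (star (f (α x)) • η x)
    rw [inner_smul_left, inner_smul_right]
    rfl

end Sections

end LineBundles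

/-- The orbit-breaking correspondence `C₀(X ∖ Y) Γ(V, α)`; the ideal `C₀(X ∖ Y)` consists of the
continuous functions on `X` that vanish on `Y`. -/
noncomputable def orbitBreaking {X : Type u} [TopologicalSpace X] [CompactSpace X] (V : X → Type v)
    [∀ x, NormedAddCommGroup (V x)] [∀ x, InnerProductSpace ℂ (V x)]
    [TopologicalSpace (Bundle.TotalSpace ℂ V)] [FiberBundle ℂ V] [VectorBundle ℂ ℂ V]
    [IsHermitianBundle V] (α : X ≃ₜ X) (Y : Set X) :
    CStarCorrespondence C(X, ℂ)
      ((Sections.correspondence V α).idealSubmodule (ContinuousMap.idealOfSet ℂ Yᶜ)) :=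
  (Sections.correspondence V α).restrictIdeal (ContinuousMap.idealOfSet ℂ Yᶜ)

section LargeSubalgebras

variable {A : Type u} [CStarAlgebra A]

/-- `a` is a positive element of the `C⋆`-subalgebra `B`. -/
def IsPositiveIn (B : StarSubalgebra ℂ A) (a : A) : Prop :=
  ∃ b ∈ B, a = star b * b

/-- Cuntz subequivalence `a ≾_B b` of positive elements of the `C⋆`-subalgebra `B`. -/
def CuntzSubequivalentIn (B : StarSubalgebra ℂ A) (a b : A) : Prop :=
  ∃ r : ℕ → A, (∀ n, r n ∈ B) ∧
    Filter.Tendsto (fun n => ‖r n * b * star (r n) - a‖) Filter.atTop (𝓝 0)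

variable (A) in
/-- Simplicity of a `C⋆`-algebra: it is nonzero and has no nontrivial closed two-sided ideals. -/
def IsSimpleCStarAlgebra : Prop :=
  Nontrivial A ∧ ∀ I : TwoSidedIdeal A, IsClosed (I : Set A) → I = ⊥ ∨ I = ⊤

/-- `A` is an infinite dimensional simple unital `C⋆`-algebra and `B` is a unital
`C⋆`-subalgebra that is centrally large in `A`. -/
structure IsCentrallyLarge (B : StarSubalgebra ℂ A) : Prop where
  isClosed : IsClosed (B : Set A)
  infinite_dimensional : ¬ FiniteDimensional ℂ A
  simple : IsSimpleCStarAlgebra A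
  exists_cutdown : ∀ (m : ℕ), 0 < m → ∀ (a : Fin m → A) (ε : ℝ), 0 < ε →
    ∀ x : A, IsPositiveIn ⊤ x → ‖x‖ = 1 → ∀ y : A, IsPositiveIn B y → y ≠ 0 →
    ∃ (c : Fin m → A) (g : A), g ∈ B ∧
      (IsPositiveIn B g ∧ IsPositiveIn B (1 - g)) ∧
      (∀ j, ‖c j - a j‖ < ε) ∧
      (∀ j, (1 - g) * c j ∈ B) ∧
      (CuntzSubequivalentIn B g y ∧ CuntzSubequivalentIn ⊤ g x) ∧
      1 - ε < ‖(1 - g) * x * (1 - g)‖ ∧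
      (∀ j, ‖g * a j - a j * g‖ < ε)

end LargeSubalgebras

/-- The homeomorphism `α` is minimal. -/
def IsMinimalHomeomorph {X : Type u} [TopologicalSpace X] (α : X ≃ₜ X) : Prop :=
  ∀ E : Set X, IsClosed E → α '' E ⊆ E → E = ∅ ∨ E = Set.univ

/-- The set `Y` meets each `α`-orbit at most once. -/
def MeetsOrbitsAtMostOnce {X : Type u} [TopologicalSpace X] (α : X ≃ₜ X) (Y : Set X) : Prop :=
  ∀ n : ℤ, n ≠ 0 → (α ^ n : X ≃ₜ X) '' Y ∩ Y = ∅

/-!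
Write `A` for the Cuntz--Pimsner algebra of `Γ(V, α)` and `B` for the image of that of the
orbit-breaking correspondence.

As `V` has rank one, both algebras are generated by a copy of `C(X)` and a Hilbert *bimodule* over
it, on which functions act from the left through `f ↦ f ∘ α`, and both carry a gauge action of the
circle; this is all that is used about them (`IsCircleGraded`). Representations of `Γ(V, α)` on
`ℓ²` of an orbit show that `C(X)` embeds. Averaging over the gauge action is a faithful expectation
onto `C(X)`. Covariant representations of `Γ(V, α)` restrict to covariant ones of the orbit-breaking
correspondence, which gives the homomorphism between the two algebras; it is gauge equivariant and
injective on `C(X)`, so faithfulness of the expectation makes it injective.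

Since `α` acts freely, compressing by a bump function with small support replaces a positive element
by its expectation up to a small error. So every nonzero positive element, of `A` or of `B`,
dominates in the Cuntz sense a nonzero function `p ^ 2`
(`IsCircleGraded.exists_function_subequivalent`). With minimality this makes `A` simple.

The element `g` is a function: a bump at `Y`, summed over its translates by `α ^ n` with weights
that are `1` for `|n| ≤ N` and then decrease to `0` with slope `1 / (q + 1)`.
* Words in the generators are moved into `B` by functions that vanish on enough translates of `Y`
  (`IsCircleGraded.exists_forall_pi_mul_mem`). These words span a dense subspace of `A`, so the
  `c j` may be taken there, and `N` is chosen accordingly.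
* As the weights vary slowly, `g` is almost `α`-invariant, hence asymptotically central for `q → ∞`
  (`IsCircleGraded.isAsymptoticallyCentral`).
* In a simple `C⋆`-algebra an asymptotically central sequence of self-adjoint elements of norm one
  cannot shrink `x` (`IsSimpleCStarAlgebra.eventually_lt_norm_compress`); this applies to `1 - g`.
* For Cuntz comparison of `g` with a function `p ^ 2`, triviality of `V` near translates of `Y`
  provides elements of `B` that act as unitaries from `α ^ m '' K` to `α ^ (m + 1) '' K`, where
  `K` is a small neighbourhood of `Y` and `m ≠ -1`. Products of them move the translates with `n ≥ 0`
  forward and those with `n < 0` backward, to pairwise disjoint places, and by minimality each orbit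
  meets the support of `p` there. One element `z` of `B` therefore gives `z⋆ p ^ 2 z = g`
  (`HasLocalUnitaries.exists_conjugate`).
-/

/-! ### Positive elements and asymptotically central sequences -/

section CStarLemmas

variable {D : Type u} [CStarAlgebra D]

/-- Below a positive element `b`, squares are Cuntz subequivalent to `b`: conjugate `b` by
`p (b + δ) ^ (-1/2)` and let `δ` tend to `0`. -/
theorem exists_tendsto_conjugate_of_mul_self_le [PartialOrder D] [StarOrderedRing D] {p b : D}
    (hp : IsSelfAdjoint p) (hpb : p * p ≤ b) :
    ∃ r : ℕ → D, Filter.Tendsto (fun n => ‖r n * b * star (r n) - p * p‖) Filter.atTop (𝓝 0) := by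
  have hb : 0 ≤ b := le_trans (by simpa [hp.star_eq] using star_mul_self_nonneg p) hpb
  have key : ∀ n : ℕ, ∃ r : D, ‖r * b * star r - p * p‖ ≤ 1 / ((n : ℝ) + 1) := by
    intro n
    set δ : ℝ := 1 / ((n : ℝ) + 1) with hδ
    have hδ0 : 0 < δ := by positivity
    have hδsp : IsStrictlyPositive (algebraMap ℝ D δ) := by grind
    set c : D := b + algebraMap ℝ D δ with hc
    have hcpos : IsStrictlyPositive c :=
      IsStrictlyPositive.nonneg_add hb hδsp
    set m : D := c ^ (-(1 / 2) : ℝ) with hm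
    have hmsa : IsSelfAdjoint m := IsSelfAdjoint.of_nonneg CFC.rpow_nonneg
    have hmcm : m * c * m = 1 := CFC.conjugate_rpow_neg_one_half c hcpos
    have h1 : m * b * m = 1 - δ • (m * m) := by
      have : m * c * m = m * b * m + δ • (m * m) := by
        rw [hc, mul_add, add_mul, Algebra.algebraMap_eq_smul_one]
        simp
      rw [← hmcm, this]; abel
    refine ⟨p * m, ?_⟩
    have h2 : p * m * b * star (p * m) - p * p = -(δ • ((p * m) * star (p * m))) := by
      rw [star_mul, hp.star_eq, hmsa.star_eq]
      have : p * m * b * (m * p) = p * (m * b * m) * p := by simp only [mul_assoc]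
      rw [this, h1, mul_sub, sub_mul, mul_one]
      simp [mul_assoc]
    rw [h2, norm_neg, norm_smul, CStarRing.norm_self_mul_star, ← CStarRing.norm_star_mul_self]
    have h3 : star (p * m) * (p * m) ≤ 1 := by
      rw [star_mul, hp.star_eq, hmsa.star_eq]
      calc m * p * (p * m) = m * (p * p) * m := by simp only [mul_assoc]
        _ ≤ m * c * m := by
            have : p * p ≤ c := hpb.trans (le_add_of_nonneg_right (by
              exact hδsp.nonneg))
            simpa [hmsa.star_eq] using star_left_conjugate_le_conjugate this m
        _ = 1 := hmcm
    have h4 : ‖star (p * m) * (p * m)‖ ≤ 1 :=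
      (CStarAlgebra.norm_le_one_iff_of_nonneg _ (star_mul_self_nonneg _)).2 h3
    rw [Real.norm_of_nonneg hδ0.le]
    nlinarith
  choose r hr using key
  exact ⟨r, squeeze_zero (fun _ => norm_nonneg _) hr tendsto_one_div_add_atTop_nhds_zero_nat⟩

/-- The family `e` asymptotically commutes with every element of `D` along the filter `l`. -/
def IsAsymptoticallyCentral {ι : Type*} (l : Filter ι) (e : ι → D) : Prop :=
  ∀ a, Filter.Tendsto (fun j => ‖e j * a - a * e j‖) l (𝓝 0)

namespace IsAsymptoticallyCentral

variable {ι : Type*} {l : Filter ι} {e w : ι → D}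

theorem mono {l' : Filter ι} (he : IsAsymptoticallyCentral l e) (h : l' ≤ l) :
    IsAsymptoticallyCentral l' e := fun a => (he a).mono_left h

theorem mul (he : IsAsymptoticallyCentral l e) (hw : IsAsymptoticallyCentral l w)
    (he1 : ∀ j, ‖e j‖ ≤ 1) (hw1 : ∀ j, ‖w j‖ ≤ 1) :
    IsAsymptoticallyCentral l fun j => e j * w j := by
  intro a
  refine squeeze_zero (fun _ => norm_nonneg _) (fun j => ?_)
    ((add_zero (0 : ℝ)) ▸ (he a).add (hw a))
  calc ‖e j * w j * a - a * (e j * w j)‖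
      = ‖(e j * a - a * e j) * w j + e j * (w j * a - a * w j)‖ := by congr 1; noncomm_ring
    _ ≤ ‖e j * a - a * e j‖ * ‖w j‖ + ‖e j‖ * ‖w j * a - a * w j‖ :=
        (norm_add_le _ _).trans (add_le_add (norm_mul_le _ _) (norm_mul_le _ _))
    _ ≤ ‖e j * a - a * e j‖ * 1 + 1 * ‖w j * a - a * w j‖ := by
        gcongr
        · exact hw1 j
        · exact he1 j
    _ = _ := by ring

theorem pow [Nontrivial D] (he : IsAsymptoticallyCentral l e) (he1 : ∀ j, ‖e j‖ ≤ 1) (k : ℕ) :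
    IsAsymptoticallyCentral l fun j => e j ^ k := by
  induction k with
  | zero => intro a; simpa using tendsto_const_nhds
  | succ k ih =>
    simp only [pow_succ]
    exact ih.mul he (fun j => (norm_pow_le _ _).trans (pow_le_one₀ (norm_nonneg _) (he1 j))) he1

/-- The powers of the compressions `e j * x * e j` are approximately `(e j) ^ (2 * k) * x ^ k`. -/
theorem tendsto_pow_mul_pow_sub [Nontrivial D] (he : IsAsymptoticallyCentral l e)
    (he1 : ∀ j, ‖e j‖ ≤ 1) {x : D} (hx : ‖x‖ ≤ 1) (k : ℕ) :
    Filter.Tendsto (fun j => ‖(e j * e j) ^ k * x ^ k - (e j * x * e j) ^ k‖) l (𝓝 0) := by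
  induction k with
  | zero => simpa using tendsto_const_nhds
  | succ k ih =>
    have hw := he.mul he he1 he1
    have hw1 : ∀ j, ‖e j * e j‖ ≤ 1 := fun j =>
      (norm_mul_le _ _).trans (mul_le_one₀ (he1 j) (norm_nonneg _) (he1 j))
    have hwk : ∀ j, ‖(e j * e j) ^ k‖ ≤ 1 := fun j =>
      (norm_pow_le _ _).trans (pow_le_one₀ (norm_nonneg _) (hw1 j))
    have hxk : ‖x ^ k‖ ≤ 1 := (norm_pow_le _ _).trans (pow_le_one₀ (norm_nonneg _) hx)
    have hu1 : ∀ j, ‖e j * x * e j‖ ≤ 1 := fun j =>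
      (norm_mul_le _ _).trans (mul_le_one₀ ((norm_mul_le _ _).trans
        (mul_le_one₀ (he1 j) (norm_nonneg _) hx)) (norm_nonneg _) (he1 j))
    have hlim := ((hw (x ^ k)).add (he x)).add ih
    rw [add_zero, add_zero] at hlim
    refine squeeze_zero (fun _ => norm_nonneg _) (fun j => ?_) hlim
    have h1 : (e j * e j) ^ (k + 1) * x ^ (k + 1) - (e j * x * e j) ^ (k + 1) =
        (e j * e j) ^ k * (e j * e j * x ^ k - x ^ k * (e j * e j)) * x +
        (e j * e j) ^ k * x ^ k * (e j * (e j * x - x * e j)) +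
        ((e j * e j) ^ k * x ^ k - (e j * x * e j) ^ k) * (e j * x * e j) := by
      rw [pow_succ, pow_succ x, pow_succ (e j * x * e j)]
      generalize (e j * e j) ^ k = p
      generalize (e j * x * e j) ^ k = q
      generalize x ^ k = r
      noncomm_ring
    rw [h1]
    refine (norm_add_le _ _).trans (add_le_add ((norm_add_le _ _).trans (add_le_add ?_ ?_)) ?_)
    · refine (norm_mul_le _ _).trans ((mul_le_of_le_one_right (norm_nonneg _) hx).trans ?_)
      exact (norm_mul_le _ _).trans (mul_le_of_le_one_left (norm_nonneg _) (hwk j))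
    · refine (norm_mul_le _ _).trans (((mul_le_of_le_one_left (norm_nonneg _)
        ((norm_mul_le _ _).trans (mul_le_one₀ (hwk j) (norm_nonneg _) hxk)))).trans ?_)
      exact (norm_mul_le _ _).trans (mul_le_of_le_one_left (norm_nonneg _) (he1 j))
    · exact (norm_mul_le _ _).trans (mul_le_of_le_one_right (norm_nonneg _) (hu1 j))

end IsAsymptoticallyCentral

theorem one_le_norm_pow_of_isSelfAdjoint {e : D} (he : IsSelfAdjoint e) (he1 : ‖e‖ = 1) (k : ℕ) :
    1 ≤ ‖e ^ k‖ := by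
  have h1 : ‖e ^ 2 ^ k‖ = 1 := by
    have := he.nnnorm_pow_two_pow k
    have h2 : ‖e ^ 2 ^ k‖ = ‖e‖ ^ 2 ^ k := congrArg NNReal.toReal this
    rw [h2, he1, one_pow]
  have hk : k + (2 ^ k - k) = 2 ^ k := Nat.add_sub_of_le (Nat.lt_two_pow_self).le
  have : Nontrivial D := ⟨e, 0, fun h => by simp [h] at he1⟩
  calc (1 : ℝ) = ‖e ^ k * e ^ (2 ^ k - k)‖ := by rw [← pow_add, hk, h1]
    _ ≤ ‖e ^ k‖ * ‖e ^ (2 ^ k - k)‖ := norm_mul_le _ _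
    _ ≤ ‖e ^ k‖ * 1 := by
        gcongr
        exact (norm_pow_le _ _).trans (pow_le_one₀ (norm_nonneg _) he1.le)
    _ = _ := mul_one _

/-- The elements that the powers of an asymptotically central sequence of contractions annihilate
asymptotically, as a two-sided ideal. -/
def IsAsymptoticallyCentral.annihilated {ι : Type*} {l : Filter ι} {w : ι → D} [Nontrivial D]
    (hw : IsAsymptoticallyCentral l w) (hw1 : ∀ j, ‖w j‖ ≤ 1) : TwoSidedIdeal D :=
  have hmono : ∀ (a : D) (j : ι) (k m : ℕ), ‖w j ^ (k + m) * a‖ ≤ ‖w j ^ k * a‖ := by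
    intro a j k m
    rw [add_comm, pow_add, mul_assoc]
    exact (norm_mul_le _ _).trans (mul_le_of_le_one_left (norm_nonneg _)
      ((norm_pow_le _ _).trans (pow_le_one₀ (norm_nonneg _) (hw1 j))))
  .mk' {a | ∀ ε > 0, ∃ k : ℕ, ∀ᶠ j in l, ‖w j ^ k * a‖ < ε}
    (fun ε hε => ⟨0, by simp [hε]⟩)
    (by
      intro a b ha hb ε hε
      obtain ⟨k, hk⟩ := ha (ε / 2) (by positivity)
      obtain ⟨m, hm⟩ := hb (ε / 2) (by positivity)
      refine ⟨k + m, ?_⟩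
      filter_upwards [hk, hm] with j h1 h2
      have h3 := hmono a j k m
      have h4 := hmono b j m k
      rw [add_comm m k] at h4
      rw [mul_add]
      exact (norm_add_le _ _).trans_lt (by linarith))
    (by
      intro a ha ε hε
      obtain ⟨k, hk⟩ := ha ε hε
      exact ⟨k, by simpa using hk⟩)
    (by
      intro x a ha ε hε
      obtain ⟨k, hk⟩ := ha (ε / 2 / (‖x‖ + 1)) (by positivity)
      have h1 := ((hw.pow hw1 k) x).mul_const ‖a‖
      rw [zero_mul] at h1
      refine ⟨k, ?_⟩
      filter_upwards [hk, h1.eventually (gt_mem_nhds (half_pos hε))] with j h2 h3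
      have h4 : w j ^ k * (x * a) = (w j ^ k * x - x * w j ^ k) * a + x * (w j ^ k * a) := by
        noncomm_ring
      have h5 : ‖x‖ * ‖w j ^ k * a‖ ≤ ε / 2 := by
        rw [lt_div_iff₀ (by positivity)] at h2
        nlinarith [norm_nonneg (w j ^ k * a)]
      rw [h4]
      refine (norm_add_le _ _).trans_lt ?_
      linarith [norm_mul_le (w j ^ k * x - x * w j ^ k) a, norm_mul_le x (w j ^ k * a)])
    (by
      intro a x ha ε hε
      obtain ⟨k, hk⟩ := ha (ε / (‖x‖ + 1)) (by positivity)
      refine ⟨k, ?_⟩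
      filter_upwards [hk] with j h2
      rw [lt_div_iff₀ (by positivity)] at h2
      rw [← mul_assoc]
      refine (norm_mul_le _ _).trans_lt (lt_of_le_of_lt ?_ h2)
      gcongr
      linarith)

theorem IsAsymptoticallyCentral.mem_annihilated {ι : Type*} {l : Filter ι} {w : ι → D}
    [Nontrivial D] (hw : IsAsymptoticallyCentral l w) (hw1 : ∀ j, ‖w j‖ ≤ 1) {a : D} :
    a ∈ hw.annihilated hw1 ↔ ∀ ε > 0, ∃ k : ℕ, ∀ᶠ j in l, ‖w j ^ k * a‖ < ε := by
  simp only [annihilated]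
  rw [TwoSidedIdeal.mem_mk']
  rfl

/-- In a simple `C⋆`-algebra an asymptotically central sequence `e` of self-adjoint elements of
norm one does not asymptotically decrease the norm of a positive element. If `‖e x e‖ ≤ r < 1`,
then the powers of `e²` would annihilate a spectral part `F x ≠ 0` of `x`, and hence annihilate
the unit, which `‖e ^ k‖ = 1` forbids. -/
theorem IsSimpleCStarAlgebra.eventually_lt_norm_compress [PartialOrder D] [StarOrderedRing D]
    (hD : IsSimpleCStarAlgebra D) {ι : Type*} {l : Filter ι} {e : ι → D}
    (he : IsAsymptoticallyCentral l e) (hsa : ∀ j, IsSelfAdjoint (e j)) (he1 : ∀ j, ‖e j‖ = 1)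
    {x : D} (hx : 0 ≤ x) (hx1 : ‖x‖ = 1) {ε : ℝ} (hε : 0 < ε) :
    ∀ᶠ j in l, 1 - ε < ‖e j * x * e j‖ := by
  by_contra hcon
  have := hD.1
  -- Restrict to the indices at which the inequality fails.
  set l' : Filter ι := l ⊓ Filter.principal {j | ¬ 1 - ε < ‖e j * x * e j‖} with hl'
  have : l'.NeBot := Filter.frequently_iff_neBot.1 (Filter.not_eventually.1 hcon)
  have hbad : ∀ᶠ j in l', ‖e j * x * e j‖ ≤ 1 - ε :=
    Filter.Eventually.filter_mono inf_le_right
      (Filter.eventually_principal.2 fun j hj => not_lt.1 hj)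
  set r := 1 - ε with hr
  have hr0 : 0 ≤ r := by
    obtain ⟨j, hj⟩ := hbad.exists
    exact (norm_nonneg _).trans hj
  set s := (1 + r) / 2 with hs
  have hs0 : 0 < s := by positivity
  have hs1 : s < 1 := by rw [hs]; linarith
  have hrs : r < s := by rw [hs]; linarith
  replace he := he.mono (inf_le_left : l' ≤ l)
  have he1' : ∀ j, ‖e j‖ ≤ 1 := fun j => (he1 j).le
  have hw := he.mul he he1' he1'
  have hw1 : ∀ j, ‖e j * e j‖ ≤ 1 := fun j =>
    (norm_mul_le _ _).trans (mul_le_one₀ (he1' j) (norm_nonneg _) (he1' j))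
  set I := hw.annihilated hw1 with hI
  have hmem : ∀ a, a ∈ I ↔ ∀ ε > 0, ∃ k : ℕ, ∀ᶠ j in l', ‖(e j * e j) ^ k * a‖ < ε := fun a =>
    hw.mem_annihilated hw1
  have hclosed : IsClosed (I : Set D) := by
    refine isClosed_of_closure_subset fun a ha => (hmem a).2 fun δ hδ => ?_
    obtain ⟨b, hb, hab⟩ := Metric.mem_closure_iff.1 ha (δ / 2) (by positivity)
    obtain ⟨k, hk⟩ := (hmem b).1 hb (δ / 2) (by positivity)
    refine ⟨k, ?_⟩
    filter_upwards [hk] with j hj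
    have h1 : (e j * e j) ^ k * a = (e j * e j) ^ k * (a - b) + (e j * e j) ^ k * b := by
      noncomm_ring
    rw [dist_eq_norm] at hab
    have h2 : ‖(e j * e j) ^ k * (a - b)‖ ≤ ‖a - b‖ :=
      (norm_mul_le _ _).trans (mul_le_of_le_one_left (norm_nonneg _)
        ((norm_pow_le _ _).trans (pow_le_one₀ (norm_nonneg _) (hw1 j))))
    rw [h1]
    exact (norm_add_le _ _).trans_lt (by linarith)
  -- `F x` is the part of `x` above `s`, which is nonzero as `s < 1 = ‖x‖`; it is annihilated as
  -- `F x = x ^ k * G x` with `‖G x‖ ≤ s ^ (-k)`, while `‖e ^ (2 * k) * x ^ k‖` is about `r ^ k`.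
  set F : ℝ → ℝ := fun t => max 0 (t - s) with hF
  have hxsa : IsSelfAdjoint x := .of_nonneg hx
  have hFc : Continuous F := by fun_prop
  have hspec : ∀ t ∈ spectrum ℝ x, 0 ≤ t ∧ t ≤ 1 := fun t ht =>
    ⟨spectrum_nonneg_of_nonneg hx ht, by
      have := spectrum.norm_le_norm_of_mem ht
      rw [hx1] at this
      exact (le_abs_self t).trans this⟩
  have hF0 : cfc F x ≠ 0 := by
    intro h0
    have h1 := norm_apply_le_norm_cfc F x (hx1 ▸ CStarAlgebra.norm_mem_spectrum_of_nonneg hx)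
      hFc.continuousOn hxsa
    rw [h0, norm_zero] at h1
    have h2 : F 1 = 1 - s := max_eq_right (by linarith)
    rw [h2, Real.norm_of_nonneg (by linarith)] at h1
    linarith
  have hFmem : cfc F x ∈ I := by
    refine (hmem _).2 fun δ hδ => ?_
    obtain ⟨k, hk⟩ := exists_pow_lt_of_lt_one (half_pos hδ) ((div_lt_one hs0).2 hrs)
    set G : ℝ → ℝ := fun t => F t / max t s ^ k with hG
    have hms : ∀ t : ℝ, 0 < max t s := fun t => lt_max_of_lt_right hs0
    have hGc : Continuous G := hFc.div (by fun_prop) fun t => (pow_pos (hms t) k).ne'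
    have hFG : cfc F x = x ^ k * cfc G x := by
      have h1 : F = fun t => t ^ k * G t := by
        funext t
        rcases le_total t s with h | h
        · have : F t = 0 := max_eq_left (by linarith)
          simp [hG, this]
        · have := (pow_pos (hms t) k).ne'
          simp only [hG, max_eq_left h] at this ⊢
          field_simp
      rw [h1, cfc_mul _ _ x (by fun_prop) hGc.continuousOn, cfc_pow_id x k hxsa]
    have hGn : ‖cfc G x‖ ≤ 1 / s ^ k := by
      refine norm_cfc_le (by positivity) fun t ht => ?_
      obtain ⟨h0, h1⟩ := hspec t ht
      have hF1 : |F t| ≤ 1 := by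
        rw [abs_of_nonneg (le_max_left _ _)]
        exact max_le zero_le_one (by linarith)
      rw [Real.norm_eq_abs, abs_div, abs_of_pos (pow_pos (hms t) k)]
      gcongr
      exact le_max_right _ _
    have hlim := he.tendsto_pow_mul_pow_sub he1' hx1.le k
    refine ⟨k, ?_⟩
    filter_upwards [hbad, hlim.eventually (gt_mem_nhds (show 0 < δ / 2 * s ^ k by positivity))]
      with j h1 h2
    rw [hFG, ← mul_assoc]
    have h3 : ‖(e j * e j) ^ k * x ^ k‖ < δ / 2 * s ^ k + r ^ k := by
      have h4 : ‖(e j * x * e j) ^ k‖ ≤ r ^ k :=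
        (norm_pow_le _ _).trans (pow_le_pow_left₀ (norm_nonneg _) h1 k)
      have h5 := norm_sub_norm_le ((e j * e j) ^ k * x ^ k) ((e j * x * e j) ^ k)
      linarith
    have hsk : 0 < s ^ k := by positivity
    calc ‖(e j * e j) ^ k * x ^ k * cfc G x‖
        ≤ ‖(e j * e j) ^ k * x ^ k‖ * (1 / s ^ k) :=
          (norm_mul_le _ _).trans (by gcongr)
      _ < (δ / 2 * s ^ k + r ^ k) * (1 / s ^ k) := by gcongr
      _ = δ / 2 + (r / s) ^ k := by
          rw [div_pow r s k, mul_one_div, add_div, mul_div_cancel_right₀ _ hsk.ne']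
      _ < δ := by linarith
  have htop : I = ⊤ := (hD.2 I hclosed).resolve_left fun h => hF0 (by
    rw [h] at hFmem
    exact (TwoSidedIdeal.mem_bot D).1 hFmem)
  obtain ⟨k, hk⟩ := (hmem 1).1 (htop ▸ trivial) 1 one_pos
  obtain ⟨j, hj⟩ := hk.exists
  rw [mul_one, ← sq, ← pow_mul] at hj
  exact absurd hj (not_lt.2 (one_le_norm_pow_of_isSelfAdjoint (hsa j) (he1 j) _))

end CStarLemmas

/-! ### Minimal homeomorphisms -/

section Dynamics

variable {X : Type u} [TopologicalSpace X]

theorem Homeomorph.zpow_add_apply (α : X ≃ₜ X) (m n : ℤ) (x : X) :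
    (α ^ (m + n)) x = (α ^ m) ((α ^ n) x) := by
  rw [zpow_add]; rfl

theorem Homeomorph.zpow_zero_apply (α : X ≃ₜ X) (x : X) : (α ^ (0 : ℤ)) x = x := rfl

theorem Homeomorph.zpow_one_apply (α : X ≃ₜ X) (x : X) : (α ^ (1 : ℤ)) x = α x := by
  rw [zpow_one]

theorem Homeomorph.zpow_neg_apply_zpow (α : X ≃ₜ X) (n : ℤ) (x : X) :
    (α ^ (-n)) ((α ^ n) x) = x := by
  rw [← α.zpow_add_apply, neg_add_cancel, α.zpow_zero_apply]

theorem Homeomorph.zpow_apply_zpow_neg (α : X ≃ₜ X) (n : ℤ) (x : X) :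
    (α ^ n) ((α ^ (-n)) x) = x := by
  rw [← α.zpow_add_apply, add_neg_cancel, α.zpow_zero_apply]

/-- The automorphism `f ↦ f ∘ α ^ n` of `C(X)`. -/
noncomputable def pullback (α : X ≃ₜ X) (n : ℤ) : C(X, ℂ) →⋆ₐ[ℂ] C(X, ℂ) :=
  ContinuousMap.compStarAlgHom' ℂ ℂ ((α ^ n : X ≃ₜ X) : C(X, X))

@[simp] theorem pullback_apply (α : X ≃ₜ X) (n : ℤ) (f : C(X, ℂ)) (x : X) :
    pullback α n f x = f ((α ^ n) x) := rfl

@[simp] theorem pullback_zero (α : X ≃ₜ X) (f : C(X, ℂ)) : pullback α 0 f = f := rfl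

theorem pullback_pullback (α : X ≃ₜ X) (m n : ℤ) (f : C(X, ℂ)) :
    pullback α m (pullback α n f) = pullback α (n + m) f := by
  ext x
  simp [α.zpow_add_apply]

@[simp] theorem pullback_pullback_neg (α : X ≃ₜ X) (n : ℤ) (f : C(X, ℂ)) :
    pullback α n (pullback α (-n) f) = f := by
  rw [pullback_pullback, neg_add_cancel, pullback_zero]

namespace IsMinimalHomeomorph

variable {α : X ≃ₜ X}

theorem exists_pow_mem (hα : IsMinimalHomeomorph α) {U : Set X} (hU : IsOpen U)
    (hne : U.Nonempty) (x : X) : ∃ n : ℕ, 1 ≤ n ∧ (α ^ (n : ℤ)) x ∈ U := by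
  set E : Set X := {x | ∀ n : ℕ, 1 ≤ n → (α ^ (n : ℤ)) x ∉ U} with hE
  have hEc : IsClosed E := by
    have : E = ⋂ n : ℕ, ⋂ _ : 1 ≤ n, (α ^ (n : ℤ) : X ≃ₜ X) ⁻¹' Uᶜ := by
      ext x; simp [hE]
    rw [this]
    exact isClosed_iInter fun n => isClosed_iInter fun _ =>
      hU.isClosed_compl.preimage (α ^ (n : ℤ) : X ≃ₜ X).continuous
  have hEα : α '' E ⊆ E := by
    rintro _ ⟨y, hy, rfl⟩ n hn
    have := hy (n + 1) (by omega)
    rwa [Nat.cast_add, Nat.cast_one, α.zpow_add_apply, α.zpow_one_apply] at this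
  rcases hα E hEc hEα with h | h
  · have hx : x ∉ E := by rw [h]; exact Set.notMem_empty x
    simpa [hE] using hx
  · obtain ⟨u, hu⟩ := hne
    have h1 : (α ^ (-1 : ℤ)) u ∈ E := h ▸ Set.mem_univ _
    have h2 := h1 1 le_rfl
    rw [Nat.cast_one, α.zpow_apply_zpow_neg] at h2
    exact absurd hu h2

/-- Every orbit visits a nonempty open set within a uniformly bounded time. -/
theorem exists_uniform_pow_mem [CompactSpace X] (hα : IsMinimalHomeomorph α) {U : Set X}
    (hU : IsOpen U) (hne : U.Nonempty) :
    ∃ L : ℕ, ∀ x, ∃ n ∈ Finset.Icc 1 L, (α ^ (n : ℤ)) x ∈ U := by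
  obtain ⟨t, ht⟩ := isCompact_univ.elim_finite_subcover
    (fun n : {n : ℕ // 1 ≤ n} => (α ^ (n.1 : ℤ) : X ≃ₜ X) ⁻¹' U)
    (fun n => hU.preimage (α ^ (n.1 : ℤ) : X ≃ₜ X).continuous) (fun x _ => by
      obtain ⟨n, hn, hx⟩ := hα.exists_pow_mem hU hne x
      exact Set.mem_iUnion.2 ⟨⟨n, hn⟩, hx⟩)
  refine ⟨t.sup fun n => n.1, fun x => ?_⟩
  obtain ⟨n, hn, hx⟩ := Set.mem_iUnion₂.1 (ht (Set.mem_univ x))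
  exact ⟨n.1, Finset.mem_Icc.2 ⟨n.2, Finset.le_sup (f := fun n => n.1) hn⟩, hx⟩

theorem zpow_apply_ne [T2Space X] [Infinite X] (hα : IsMinimalHomeomorph α) {n : ℤ} (hn : n ≠ 0)
    (x : X) : (α ^ n) x ≠ x := by
  wlog hpos : 0 < n generalizing n
  · intro h
    refine this (n := -n) (by omega) (by omega) ?_
    nth_rw 1 [← h]
    exact α.zpow_neg_apply_zpow n x
  intro h
  set E : Set X := (fun i : ℕ => (α ^ (i : ℤ)) x) '' Set.Iio n.toNat with hE
  have hfin : E.Finite := (Set.finite_Iio _).image _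
  have hEα : α '' E ⊆ E := by
    rintro _ ⟨_, ⟨i, hi, rfl⟩, rfl⟩
    have h1 : α ((α ^ (i : ℤ)) x) = (α ^ ((i + 1 : ℕ) : ℤ)) x := by
      rw [Nat.cast_add, Nat.cast_one, add_comm, α.zpow_add_apply, α.zpow_one_apply]
    simp only [h1]
    by_cases hlt : i + 1 < n.toNat
    · exact ⟨i + 1, hlt, rfl⟩
    · have h2 : ((i + 1 : ℕ) : ℤ) = n := by
        have : i < n.toNat := hi
        omega
      exact ⟨0, by simpa using hpos, by rw [h2, h]; rfl⟩
  rcases hα E hfin.isClosed hEα with h1 | h1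
  · have : x ∈ E := ⟨0, by simpa using hpos, rfl⟩
    rw [h1] at this
    exact this
  · exact Set.infinite_univ (h1 ▸ hfin)

end IsMinimalHomeomorph

namespace MeetsOrbitsAtMostOnce

variable {α : X ≃ₜ X} {Y : Set X}

theorem zpow_notMem (hY : MeetsOrbitsAtMostOnce α Y) {n : ℤ} (hn : n ≠ 0) {y : X} (hy : y ∈ Y) :
    (α ^ n) y ∉ Y := fun h =>
  (Set.ext_iff.1 (hY n hn) ((α ^ n) y)).1 ⟨⟨y, hy, rfl⟩, h⟩

theorem dense_compl (hY : MeetsOrbitsAtMostOnce α Y) (hα : IsMinimalHomeomorph α) :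
    Dense Yᶜ := by
  rw [← interior_eq_empty_iff_dense_compl]
  by_contra hne
  obtain ⟨x, hx⟩ := Set.nonempty_iff_ne_empty.2 hne
  obtain ⟨n, hn, h⟩ := hα.exists_pow_mem isOpen_interior ⟨x, hx⟩ x
  exact hY.zpow_notMem (by omega) (interior_subset hx) (interior_subset h)

/-- A compact set that meets each orbit at most once has a neighbourhood disjoint from its
translates up to any given time. -/
theorem exists_isOpen [CompactSpace X] [T2Space X] (hY : MeetsOrbitsAtMostOnce α Y)
    (hYc : IsClosed Y) (D : ℕ) : ∃ W : Set X, IsOpen W ∧ Y ⊆ W ∧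
      ∀ n : ℤ, n ≠ 0 → |n| ≤ D → ∀ x ∈ W, (α ^ n) x ∉ W := by
  have key : ∀ n : ℤ, ∃ W : Set X, IsOpen W ∧ Y ⊆ W ∧ (n ≠ 0 → ∀ x ∈ W, (α ^ n) x ∉ W) := by
    intro n
    by_cases hn : n = 0
    · exact ⟨Set.univ, isOpen_univ, Set.subset_univ _, fun h => absurd hn h⟩
    have hdisj : Disjoint Y ((α ^ n : X ≃ₜ X) ⁻¹' Y) :=
      Set.disjoint_left.2 fun y hy h => hY.zpow_notMem hn hy h
    obtain ⟨U, U', hU, hU', hYU, hYU', hd⟩ := SeparatedNhds.of_isCompact_isCompact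
      hYc.isCompact (hYc.preimage (α ^ n : X ≃ₜ X).continuous).isCompact hdisj
    refine ⟨U ∩ (α ^ (-n) : X ≃ₜ X) ⁻¹' U',
      hU.inter (hU'.preimage (α ^ (-n) : X ≃ₜ X).continuous), fun y hy => ⟨hYU hy, hYU' ?_⟩, ?_⟩
    · change (α ^ n) ((α ^ (-n)) y) ∈ Y
      rwa [α.zpow_apply_zpow_neg]
    · rintro _ x ⟨hx, -⟩ ⟨-, h⟩
      change (α ^ (-n)) ((α ^ n) x) ∈ U' at h
      rw [α.zpow_neg_apply_zpow] at h
      exact Set.disjoint_left.1 hd hx h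
  choose W hW hYW hd using key
  refine ⟨⋂ n ∈ Finset.Icc (-(D : ℤ)) D, W n, isOpen_biInter_finset fun n _ => hW n,
    Set.subset_iInter₂ fun n _ => hYW n, fun n hn hnD x hx h => ?_⟩
  have hmem : n ∈ Finset.Icc (-(D : ℤ)) D := Finset.mem_Icc.2 (abs_le.1 hnD)
  exact hd n hn x (Set.mem_iInter₂.1 hx n hmem) (Set.mem_iInter₂.1 h n hmem)

end MeetsOrbitsAtMostOnce

end Dynamics

/-! ### Circle-graded algebras over `C(X)` and their expectations -/

section CircleGraded

open MeasureTheory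

variable {X : Type u} [TopologicalSpace X] [CompactSpace X] {α : X ≃ₜ X}
variable {D : Type v} [CStarAlgebra D] {F : Type w} [AddCommGroup F] [Module ℂ F]

/-- `D` is generated by a copy `π` of `C(X)` and a Hilbert bimodule `τ` over it on which `C(X)`
acts from the left through `f ↦ f ∘ α`, and `D` carries a gauge action `γ` of the circle. -/
structure IsCircleGraded (α : X ≃ₜ X) (π : C(X, ℂ) →⋆ₐ[ℂ] D) (τ : F →ₗ[ℂ] D)
    (γ : Circle → D →⋆ₐ[ℂ] D) : Prop where
  pi_injective : Function.Injective π
  pi_mul_tau : ∀ f ξ, π f * τ ξ = τ ξ * π (pullback α 1 f)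
  tau_mul_pi_mem : ∀ f ξ, τ ξ * π f ∈ LinearMap.range τ
  star_tau_mul_tau_mem : ∀ ξ η, star (τ ξ) * τ η ∈ Set.range π
  tau_mul_star_tau_mem : ∀ ξ η, τ ξ * star (τ η) ∈ Set.range π
  gauge_one : ∀ a, γ 1 a = a
  gauge_pi : ∀ z f, γ z (π f) = π f
  gauge_tau : ∀ z ξ, γ z (τ ξ) = (z : ℂ) • τ ξ
  dense : Dense (StarAlgebra.adjoin ℂ (Set.range π ∪ Set.range τ) : Set D)

/-- The elements of degree `n`: the gauge action multiplies them by `z ^ n` and functions commute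
past them up to `α ^ n`. -/
def homogeneous (α : X ≃ₜ X) (π : C(X, ℂ) →⋆ₐ[ℂ] D) (γ : Circle → D →⋆ₐ[ℂ] D) (n : ℤ) :
    Submodule ℂ D where
  carrier := {a | (∀ z, γ z a = ((z ^ n : Circle) : ℂ) • a) ∧
    ∀ f, π f * a = a * π (pullback α n f)}
  add_mem' ha hb := ⟨fun z => by rw [map_add, ha.1, hb.1, smul_add],
    fun f => by rw [mul_add, add_mul, ha.2, hb.2]⟩
  zero_mem' := ⟨fun z => by simp, fun f => by simp⟩
  smul_mem' c a ha := ⟨fun z => by rw [map_smul, ha.1, smul_comm],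
    fun f => by rw [mul_smul_comm, smul_mul_assoc, ha.2]⟩

/-- The span of the products `τ ξ₁ ⋯ τ ξₙ π f`. -/
noncomputable def words (π : C(X, ℂ) →⋆ₐ[ℂ] D) (τ : F →ₗ[ℂ] D) : ℕ → Submodule ℂ D
  | 0 => LinearMap.range (π : C(X, ℂ) →ₗ[ℂ] D)
  | n + 1 => LinearMap.range τ * words π τ n

/-- The span of all words and their adjoints. -/
noncomputable def wordSpan (π : C(X, ℂ) →⋆ₐ[ℂ] D) (τ : F →ₗ[ℂ] D) : Submodule ℂ D :=
  Submodule.span ℂ {a | ∃ n, a ∈ words π τ n ∨ star a ∈ words π τ n}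

section Homogeneous

variable {π : C(X, ℂ) →⋆ₐ[ℂ] D} {γ : Circle → D →⋆ₐ[ℂ] D} {a b : D} {m n : ℤ}

theorem mul_mem_homogeneous (ha : a ∈ homogeneous α π γ m) (hb : b ∈ homogeneous α π γ n) :
    a * b ∈ homogeneous α π γ (m + n) := by
  refine ⟨fun z => ?_, fun f => ?_⟩
  · rw [map_mul, ha.1, hb.1, zpow_add, Circle.coe_mul, smul_mul_smul_comm]
  · rw [← mul_assoc, ha.2, mul_assoc, hb.2, ← mul_assoc, pullback_pullback]

theorem star_mem_homogeneous (ha : a ∈ homogeneous α π γ n) :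
    star a ∈ homogeneous α π γ (-n) := by
  refine ⟨fun z => ?_, fun f => ?_⟩
  · rw [map_star, ha.1, star_smul, zpow_neg, Circle.coe_inv_eq_conj]
    rfl
  · have h := congrArg star (ha.2 (pullback α (-n) (star f)))
    rw [pullback_pullback_neg, star_mul, star_mul, ← map_star, ← map_star, star_star,
      ← map_star, star_star] at h
    exact h.symm

end Homogeneous

namespace IsCircleGraded

variable {π : C(X, ℂ) →⋆ₐ[ℂ] D} {τ : F →ₗ[ℂ] D} {γ : Circle → D →⋆ₐ[ℂ] D}

section Words

theorem pi_mem_words (f : C(X, ℂ)) : π f ∈ words π τ 0 := ⟨f, rfl⟩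

theorem tau_mul_mem_words {n : ℕ} {a : D} (ha : a ∈ words π τ n) (ξ : F) :
    τ ξ * a ∈ words π τ (n + 1) := Submodule.mul_mem_mul ⟨ξ, rfl⟩ ha

theorem tau_mem_words (ξ : F) : τ ξ ∈ words π τ 1 := by
  have h := tau_mul_mem_words (τ := τ) (pi_mem_words (π := π) (τ := τ) 1) ξ
  rwa [map_one, mul_one] at h

/-- Induction over the generators of the span of words of positive length. -/
theorem words_succ_induction {n : ℕ} {p : D → Prop} (hadd : ∀ a b, p a → p b → p (a + b))
    (hmul : ∀ ξ, ∀ a ∈ words π τ n, p (τ ξ * a)) {a : D} (ha : a ∈ words π τ (n + 1)) : p a := by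
  refine Submodule.mul_induction_on ha ?_ hadd
  rintro _ ⟨ξ, rfl⟩ a ha
  exact hmul ξ a ha

variable (h : IsCircleGraded α π τ γ)
include h

theorem pi_mul_tau_mem (f : C(X, ℂ)) (ξ : F) : π f * τ ξ ∈ LinearMap.range τ := by
  rw [h.pi_mul_tau]
  exact h.tau_mul_pi_mem _ _

theorem pi_mul_mem_words {n : ℕ} {a : D} (ha : a ∈ words π τ n) (f : C(X, ℂ)) :
    π f * a ∈ words π τ n := by
  cases n with
  | zero =>
    obtain ⟨g, rfl⟩ := ha
    exact ⟨f * g, map_mul π f g⟩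
  | succ n =>
    refine words_succ_induction (p := fun a => π f * a ∈ words π τ (n + 1)) ?_ ?_ ha
    · intro a b ha hb
      rw [mul_add]
      exact add_mem ha hb
    · intro ξ a ha
      obtain ⟨η, hη⟩ := h.pi_mul_tau_mem f ξ
      rw [← mul_assoc, ← hη]
      exact tau_mul_mem_words ha η

theorem mul_pi_mem_words {n : ℕ} {a : D} (ha : a ∈ words π τ n) (f : C(X, ℂ)) :
    a * π f ∈ words π τ n := by
  induction n generalizing a with
  | zero =>
    obtain ⟨g, rfl⟩ := ha
    exact ⟨g * f, map_mul π g f⟩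
  | succ n ih =>
    refine words_succ_induction (p := fun a => a * π f ∈ words π τ (n + 1)) ?_ ?_ ha
    · intro a b ha hb
      rw [add_mul]
      exact add_mem ha hb
    · intro ξ a ha
      rw [mul_assoc]
      exact tau_mul_mem_words (ih ha) ξ

theorem star_tau_mul_mem_words {n : ℕ} {a : D} (ha : a ∈ words π τ (n + 1)) (ξ : F) :
    star (τ ξ) * a ∈ words π τ n := by
  refine words_succ_induction (p := fun a => star (τ ξ) * a ∈ words π τ n) ?_ ?_ ha
  · intro a b ha hb
    rw [mul_add]
    exact add_mem ha hb
  · intro η a ha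
    obtain ⟨f, hf⟩ := h.star_tau_mul_tau_mem ξ η
    rw [← mul_assoc, ← hf]
    exact h.pi_mul_mem_words ha f

theorem mul_tau_mem_words {n : ℕ} {a : D} (ha : a ∈ words π τ n) (ξ : F) :
    a * τ ξ ∈ words π τ (n + 1) := by
  induction n generalizing a with
  | zero =>
    obtain ⟨g, rfl⟩ := ha
    exact h.pi_mul_mem_words (tau_mem_words ξ) g
  | succ n ih =>
    refine words_succ_induction (p := fun a => a * τ ξ ∈ words π τ (n + 2)) ?_ ?_ ha
    · intro a b ha hb
      rw [add_mul]
      exact add_mem ha hb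
    · intro η a ha
      rw [mul_assoc]
      exact tau_mul_mem_words (ih ha) η

theorem mul_star_tau_mem_words {n : ℕ} {a : D} (ha : a ∈ words π τ (n + 1)) (ξ : F) :
    a * star (τ ξ) ∈ words π τ n := by
  induction n generalizing a with
  | zero =>
    refine words_succ_induction (p := fun a => a * star (τ ξ) ∈ words π τ 0) ?_ ?_ ha
    · intro a b ha hb
      rw [add_mul]
      exact add_mem ha hb
    · rintro η _ ⟨f, rfl⟩
      obtain ⟨ζ, hζ⟩ := h.tau_mul_pi_mem f η
      obtain ⟨g, hg⟩ := h.tau_mul_star_tau_mem ζ ξ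
      exact ⟨g, by rw [hζ] at hg; exact hg⟩
  | succ n ih =>
    refine words_succ_induction (p := fun a => a * star (τ ξ) ∈ words π τ (n + 1)) ?_ ?_ ha
    · intro a b ha hb
      rw [add_mul]
      exact add_mem ha hb
    · intro η a ha
      rw [mul_assoc]
      exact tau_mul_mem_words (ih ha) η

/-- The span of words and adjoints of words is invariant under left multiplication by the
generators and their adjoints, because products of the form `(τ ξ)⋆ τ η` and `τ ξ (τ η)⋆` are
functions. -/
theorem mul_mem_wordSpan_of_generator {x : D}
    (hx : x ∈ Set.range π ∪ Set.range τ ∨ star x ∈ Set.range π ∪ Set.range τ) {a : D}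
    (ha : a ∈ wordSpan π τ) : x * a ∈ wordSpan π τ := by
  induction ha using Submodule.span_induction with
  | zero => simp
  | add a b _ _ ha hb => rw [mul_add]; exact add_mem ha hb
  | smul c a _ ha => rw [mul_smul_comm]; exact Submodule.smul_mem _ c ha
  | mem a ha =>
    refine Submodule.subset_span ?_
    have hpi : ∀ f, ∃ n, π f * a ∈ words π τ n ∨ star (π f * a) ∈ words π τ n := by
      intro f
      obtain ⟨n, ha | ha⟩ := ha
      · exact ⟨n, Or.inl (h.pi_mul_mem_words ha f)⟩
      · refine ⟨n, Or.inr ?_⟩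
        rw [star_mul, ← map_star]
        exact h.mul_pi_mem_words ha _
    rcases hx with (⟨f, rfl⟩ | ⟨ξ, rfl⟩) | (⟨f, hf⟩ | ⟨ξ, hξ⟩)
    · exact hpi f
    · obtain ⟨n, ha | ha⟩ := ha
      · exact ⟨n + 1, Or.inl (tau_mul_mem_words ha ξ)⟩
      · cases n with
        | zero =>
          obtain ⟨f, hf⟩ := ha
          refine ⟨1, Or.inl ?_⟩
          have h1 : a = π (star f) := by
            rw [map_star]; exact (star_eq_iff_star_eq.1 hf.symm).symm
          rw [h1]
          exact h.mul_pi_mem_words (tau_mem_words ξ) _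
        | succ n =>
          refine ⟨n, Or.inr ?_⟩
          rw [star_mul]
          exact h.mul_star_tau_mem_words ha ξ
    · have h1 : x = π (star f) := by rw [map_star, hf, star_star]
      rw [h1]
      exact hpi _
    · have h1 : x = star (τ ξ) := by rw [hξ, star_star]
      rw [h1]
      obtain ⟨n, ha | ha⟩ := ha
      · cases n with
        | zero =>
          obtain ⟨f, rfl⟩ := ha
          refine ⟨1, Or.inr ?_⟩
          change star (star (τ ξ) * π f) ∈ _
          rw [star_mul, star_star, ← map_star]
          exact h.pi_mul_mem_words (tau_mem_words ξ) _
        | succ n => exact ⟨n, Or.inl (h.star_tau_mul_mem_words ha ξ)⟩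
      · refine ⟨n + 1, Or.inr ?_⟩
        rw [star_mul, star_star]
        exact h.mul_tau_mem_words ha ξ

theorem adjoin_le_wordSpan {x : D}
    (hx : x ∈ StarAlgebra.adjoin ℂ (Set.range π ∪ Set.range τ)) : x ∈ wordSpan π τ := by
  have key : ∀ a ∈ wordSpan π τ, x * a ∈ wordSpan π τ ∧ star x * a ∈ wordSpan π τ := by
    induction hx using StarAlgebra.adjoin_induction with
    | mem x hx => exact fun a ha => ⟨h.mul_mem_wordSpan_of_generator (Or.inl hx) ha,
        h.mul_mem_wordSpan_of_generator (Or.inr (by rwa [star_star])) ha⟩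
    | algebraMap c =>
      intro a ha
      rw [← algebraMap_star_comm, ← Algebra.smul_def, ← Algebra.smul_def]
      exact ⟨Submodule.smul_mem _ _ ha, Submodule.smul_mem _ _ ha⟩
    | add x y _ _ hx hy =>
      intro a ha
      rw [star_add, add_mul, add_mul]
      exact ⟨add_mem (hx a ha).1 (hy a ha).1, add_mem (hx a ha).2 (hy a ha).2⟩
    | mul x y _ _ hx hy =>
      intro a ha
      rw [star_mul, mul_assoc, mul_assoc]
      exact ⟨(hx _ (hy a ha).1).1, (hy _ (hx a ha).2).2⟩
    | star x _ hx =>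
      intro a ha
      rw [star_star]
      exact (hx a ha).symm
  have h1 := (key 1 (Submodule.subset_span ⟨0, Or.inl ⟨1, map_one π⟩⟩)).1
  rwa [mul_one] at h1

theorem dense_wordSpan : Dense (wordSpan π τ : Set D) :=
  h.dense.mono fun _ hx => h.adjoin_le_wordSpan hx

theorem pi_mem_homogeneous (f : C(X, ℂ)) : π f ∈ homogeneous α π γ 0 :=
  ⟨fun z => by rw [h.gauge_pi, zpow_zero, Circle.coe_one, one_smul], fun g => by
    rw [pullback_zero, ← map_mul, ← map_mul, mul_comm]⟩

theorem tau_mem_homogeneous (ξ : F) : τ ξ ∈ homogeneous α π γ 1 :=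
  ⟨fun z => by rw [h.gauge_tau, zpow_one], fun g => h.pi_mul_tau g ξ⟩

theorem words_le_homogeneous (n : ℕ) : words π τ n ≤ homogeneous α π γ n := by
  induction n with
  | zero =>
    rintro _ ⟨f, rfl⟩
    exact h.pi_mem_homogeneous f
  | succ n ih =>
    intro a ha
    refine words_succ_induction (p := fun a => a ∈ homogeneous α π γ _) ?_ ?_ ha
    · exact fun a b ha hb => add_mem ha hb
    · intro ξ a ha
      have := mul_mem_homogeneous (h.tau_mem_homogeneous ξ) (ih ha)
      rwa [add_comm, ← Nat.cast_succ] at this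

end Words

section Expectation

/-- The average over the gauge action. -/
noncomputable def expectation (γ : Circle → D →⋆ₐ[ℂ] D) (a : D) : D :=
  ∫ t : UnitAddCircle, γ t.toCircle a ∂AddCircle.haarAddCircle

variable (h : IsCircleGraded α π τ γ)
include h

theorem continuous_gauge (a : D) : Continuous fun z => γ z a := by
  have hspan : ∀ a ∈ wordSpan π τ, Continuous fun z => γ z a := by
    intro a ha
    have hhom : ∀ n : ℤ, ∀ a ∈ homogeneous α π γ n, Continuous fun z => γ z a := by
      intro n a ha
      have : (fun z => γ z a) = fun z => ((z ^ n : Circle) : ℂ) • a := funext ha.1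
      rw [this]
      exact ((continuous_induced_dom (f := ((↑) : Circle → ℂ))).comp
        (continuous_zpow (G := Circle) n)).smul continuous_const
    induction ha using Submodule.span_induction with
    | zero => simpa using continuous_const
    | add a b _ _ ha hb => simp only [map_add]; exact ha.add hb
    | smul c a _ ha => simp only [map_smul]; exact ha.const_smul c
    | mem a ha =>
      obtain ⟨n, ha | ha⟩ := ha
      · exact hhom n a (h.words_le_homogeneous n ha)
      · have := star_mem_homogeneous (h.words_le_homogeneous n ha)
        rw [star_star] at this
        exact hhom _ a this
  refine continuous_of_uniform_approx_of_continuous fun u hu => ?_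
  obtain ⟨ε, hε, hεu⟩ := Metric.mem_uniformity_dist.1 hu
  obtain ⟨b, hb, hab⟩ := Metric.mem_closure_iff.1 (h.dense_wordSpan a) ε hε
  refine ⟨fun z => γ z b, hspan b hb, fun z => hεu ?_⟩
  rw [dist_eq_norm, ← map_sub]
  rw [dist_eq_norm] at hab
  exact (NonUnitalStarAlgHom.norm_apply_le (γ z) _).trans_lt hab

theorem continuous_gauge_toCircle (a : D) :
    Continuous fun t : UnitAddCircle => γ t.toCircle a :=
  (h.continuous_gauge a).comp AddCircle.continuous_toCircle

theorem integrable_gauge (a : D) :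
    Integrable (fun t : UnitAddCircle => γ t.toCircle a) AddCircle.haarAddCircle :=
  (h.continuous_gauge_toCircle a).integrable_of_hasCompactSupport
    (HasCompactSupport.of_compactSpace _)

theorem expectation_add (a b : D) :
    expectation γ (a + b) = expectation γ a + expectation γ b := by
  simp only [expectation, map_add]
  exact integral_add (h.integrable_gauge a) (h.integrable_gauge b)

theorem expectation_sub (a b : D) :
    expectation γ (a - b) = expectation γ a - expectation γ b := by
  simp only [expectation, map_sub]
  exact integral_sub (h.integrable_gauge a) (h.integrable_gauge b)

theorem expectation_smul (c : ℂ) (a : D) : expectation γ (c • a) = c • expectation γ a := by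
  simp only [expectation, map_smul]
  exact integral_smul c _

theorem norm_expectation_le (a : D) : ‖expectation γ a‖ ≤ ‖a‖ := by
  have := norm_integral_le_of_norm_le_const (μ := AddCircle.haarAddCircle)
    (f := fun t : UnitAddCircle => γ t.toCircle a) (C := ‖a‖)
    (Filter.Eventually.of_forall fun t => NonUnitalStarAlgHom.norm_apply_le (γ t.toCircle) a)
  simpa [expectation] using this

theorem expectation_of_mem_homogeneous_zero {a : D} (ha : a ∈ homogeneous α π γ 0) :
    expectation γ a = a := by
  have h1 : ∀ z, γ z a = a := fun z => by rw [ha.1, zpow_zero, Circle.coe_one, one_smul]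
  simp [expectation, h1]

theorem expectation_of_mem_homogeneous {n : ℤ} (hn : n ≠ 0) {a : D}
    (ha : a ∈ homogeneous α π γ n) : expectation γ a = 0 := by
  have h1 : (fun t : UnitAddCircle => γ t.toCircle a) = fun t => fourier n t • a := by
    funext t
    rw [ha.1, fourier_apply, AddCircle.toCircle_zsmul]
  have h2 : ∫ t : UnitAddCircle, fourier n t ∂AddCircle.haarAddCircle = (0 : ℂ) :=
    integral_eq_zero_of_add_right_eq_neg (μ := AddCircle.haarAddCircle)
      (fun t => fourier_add_half_inv_index hn one_pos t)
  rw [expectation, h1, integral_smul_const, h2, zero_smul]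

/-- The expectation takes values in the functions: it kills the words of nonzero degree. -/
theorem expectation_mem_range (a : D) : expectation γ a ∈ Set.range π := by
  have hclosed : IsClosed (Set.range π) :=
    (NonUnitalStarAlgHom.isometry π h.pi_injective).isClosedEmbedding.isClosed_range
  have hcont : Continuous (expectation γ) := by
    refine LipschitzWith.continuous (K := 1) (LipschitzWith.of_dist_le_mul fun a b => ?_)
    rw [dist_eq_norm, dist_eq_norm, ← h.expectation_sub, NNReal.coe_one, one_mul]
    exact h.norm_expectation_le _
  refine (h.dense_wordSpan.induction (P := fun a => expectation γ a ∈ Set.range π) ?_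
    (hclosed.preimage hcont)) a
  intro a ha
  have hrange : ∀ a, a ∈ Set.range π ↔ a ∈ LinearMap.range (π : C(X, ℂ) →ₗ[ℂ] D) := fun a =>
    Iff.rfl
  rw [hrange]
  induction ha using Submodule.span_induction with
  | zero => simp [expectation]
  | add a b _ _ ha hb => rw [h.expectation_add]; exact add_mem ha hb
  | smul c a _ ha => rw [h.expectation_smul]; exact Submodule.smul_mem _ c ha
  | mem a ha =>
    obtain ⟨n, ha | ha⟩ := ha
    · have h1 := h.words_le_homogeneous n ha
      cases n with
      | zero =>
        rw [h.expectation_of_mem_homogeneous_zero h1]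
        exact ha
      | succ n =>
        rw [h.expectation_of_mem_homogeneous (by omega) h1]
        exact zero_mem _
    · have h1 := star_mem_homogeneous (h.words_le_homogeneous n ha)
      rw [star_star] at h1
      cases n with
      | zero =>
        rw [h.expectation_of_mem_homogeneous_zero h1]
        obtain ⟨f, hf⟩ := ha
        refine ⟨star f, ?_⟩
        change π (star f) = a
        rw [map_star]
        exact star_eq_iff_star_eq.1 hf.symm
      | succ n =>
        rw [h.expectation_of_mem_homogeneous (by omega) h1]
        exact zero_mem _

section Order

variable [PartialOrder D] [StarOrderedRing D]

theorem expectation_nonneg {a : D} (ha : 0 ≤ a) : 0 ≤ expectation γ a := by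
  have := integral_nonneg (μ := AddCircle.haarAddCircle)
    (f := fun t : UnitAddCircle => γ t.toCircle a) fun t => map_nonneg (γ t.toCircle) ha
  exact this

/-- The expectation is faithful: near the identity of the circle `γ_z a` is close to `a`, so that
`expectation γ a` dominates a positive multiple of `a - ε`. -/
theorem eq_zero_of_expectation_eq_zero {a : D} (ha : 0 ≤ a)
    (h0 : expectation γ a = 0) : a = 0 := by
  by_contra hne
  have hpos : 0 < ‖a‖ := norm_pos_iff.2 hne
  set ε := ‖a‖ / 2 with hε
  set μ := @AddCircle.haarAddCircle (1 : ℝ) _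
  set s : Set UnitAddCircle := {t | ‖γ t.toCircle a - a‖ < ε} with hs
  have hso : IsOpen s :=
    isOpen_lt ((h.continuous_gauge_toCircle a).sub continuous_const).norm continuous_const
  have hsne : s.Nonempty := ⟨0, by
    change ‖γ (AddCircle.toCircle 0) a - a‖ < ε
    rw [AddCircle.toCircle_zero, h.gauge_one, sub_self, norm_zero]
    positivity⟩
  have hμs : 0 < μ.real s :=
    ENNReal.toReal_pos (hso.measure_pos μ hsne).ne' (measure_ne_top μ s)
  set b : D := a - algebraMap ℝ D ε with hb
  have hnonneg : ∀ t : UnitAddCircle, 0 ≤ γ t.toCircle a - s.indicator (fun _ => b) t := by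
    intro t
    by_cases ht : t ∈ s
    · rw [Set.indicator_of_mem ht]
      have hsa : IsSelfAdjoint (a - γ t.toCircle a) :=
        (IsSelfAdjoint.of_nonneg ha).sub (IsSelfAdjoint.of_nonneg (map_nonneg (γ t.toCircle) ha))
      have h1 : a - γ t.toCircle a ≤ algebraMap ℝ D ε :=
        hsa.le_algebraMap_norm_self.trans (algebraMap_mono _ (by
          rw [norm_sub_rev]; exact le_of_lt ht))
      have h2 : γ t.toCircle a - b = algebraMap ℝ D ε - (a - γ t.toCircle a) := by
        rw [hb]; abel
      rw [h2]
      exact sub_nonneg.2 h1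
    · rw [Set.indicator_of_notMem ht, sub_zero]
      exact map_nonneg (γ t.toCircle) ha
  have hint : 0 ≤ ∫ t : UnitAddCircle, (γ t.toCircle a - s.indicator (fun _ => b) t) ∂μ :=
    integral_nonneg hnonneg
  rw [integral_sub (h.integrable_gauge a) ((integrable_const b).indicator hso.measurableSet),
    integral_indicator_const b hso.measurableSet] at hint
  have h1 : 0 ≤ expectation γ a - μ.real s • b := hint
  rw [h0, zero_sub, Left.nonneg_neg_iff] at h1
  have h2 : b ≤ 0 := by
    have h3 := smul_le_smul_of_nonneg_left h1 (inv_nonneg.2 hμs.le)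
    rwa [inv_smul_smul₀ hμs.ne', smul_zero] at h3
  have h3 : ‖a‖ ≤ ε := (CStarAlgebra.norm_le_iff_le_algebraMap a (by positivity) ha).2
    (sub_nonpos.1 h2)
  linarith

end Order

end Expectation

end IsCircleGraded

end CircleGraded

/-! ### Nonzero functions below positive elements, and simplicity -/

section CircleGraded

variable {X : Type u} [TopologicalSpace X]

/-- A real function on `X`, as a complex function. -/
noncomputable def complexify (f : C(X, ℝ)) : C(X, ℂ) := ⟨fun x => (f x : ℂ), by fun_prop⟩

@[simp] theorem complexify_apply (f : C(X, ℝ)) (x : X) : complexify f x = (f x : ℂ) := rfl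

theorem isSelfAdjoint_complexify (f : C(X, ℝ)) : IsSelfAdjoint (complexify f) := by
  ext x
  exact Complex.conj_ofReal (f x)

theorem complexify_mul (f g : C(X, ℝ)) : complexify (f * g) = complexify f * complexify g := by
  ext x
  simp

theorem complexify_sub (f g : C(X, ℝ)) : complexify (f - g) = complexify f - complexify g := by
  ext x
  simp

theorem complexify_one : complexify (1 : C(X, ℝ)) = 1 := by
  ext x
  simp

variable [CompactSpace X] [T2Space X] {α : X ≃ₜ X}

theorem norm_complexify_le {f : C(X, ℝ)} {C : ℝ} (hC : 0 ≤ C) (hf : ∀ x, |f x| ≤ C) :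
    ‖complexify f‖ ≤ C :=
  (ContinuousMap.norm_le _ hC).2 fun x => by simpa using hf x

/-- A bump function at `x` whose translates up to time `N` are orthogonal to it. -/
theorem exists_bump (hfree : ∀ n : ℤ, n ≠ 0 → ∀ x, (α ^ n) x ≠ x) {U : Set X} (hU : IsOpen U)
    {x : X} (hx : x ∈ U) (N : ℕ) : ∃ h : C(X, ℝ), h x = 1 ∧ (∀ y, h y ∈ Set.Icc (0 : ℝ) 1) ∧
      (∀ y, h y ≠ 0 → y ∈ U) ∧ ∀ n : ℤ, n ≠ 0 → |n| ≤ N →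
        complexify h * pullback α n (complexify h) = 0 := by
  have hx1 : MeetsOrbitsAtMostOnce α {x} := by
    intro n hn
    rw [Set.image_singleton, Set.singleton_inter_eq_empty]
    exact hfree n hn x
  obtain ⟨W, hW, hxW, hd⟩ := hx1.exists_isOpen isClosed_singleton N
  obtain ⟨h, h0, h1, h01⟩ := exists_continuous_zero_one_of_isClosed
    (s := (U ∩ W)ᶜ) (t := {x}) (hU.inter hW).isClosed_compl isClosed_singleton
    (Set.disjoint_singleton_right.2 fun h => h ⟨hx, hxW rfl⟩)
  have hsupp : ∀ y, h y ≠ 0 → y ∈ U ∩ W := fun y hy => by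
    by_contra hc
    exact hy (h0 hc)
  refine ⟨h, h1 rfl, h01, fun y hy => (hsupp y hy).1, fun n hn hnN => ?_⟩
  ext y
  rw [ContinuousMap.mul_apply, pullback_apply, complexify_apply, complexify_apply,
    ContinuousMap.zero_apply, mul_eq_zero]
  by_contra! hc
  exact hd n hn hnN y (hsupp y (by simpa using hc.1)).2 (hsupp _ (by simpa using hc.2)).2

namespace IsCircleGraded

variable {D : Type v} [CStarAlgebra D] {F : Type w} [AddCommGroup F] [Module ℂ F]
variable {π : C(X, ℂ) →⋆ₐ[ℂ] D} {τ : F →ₗ[ℂ] D} {γ : Circle → D →⋆ₐ[ℂ] D}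
variable (h : IsCircleGraded α π τ γ)
include h

/-- Compressing by a function that is orthogonal to its translates kills the terms of nonzero
degree. -/
theorem exists_compress_eq {a : D} (ha : a ∈ wordSpan π τ) : ∃ N : ℕ, ∀ f : C(X, ℂ),
    (∀ n : ℤ, n ≠ 0 → |n| ≤ N → f * pullback α n f = 0) →
      π f * a * π f = π f * expectation γ a * π f := by
  have hhom : ∀ n : ℤ, ∀ a ∈ homogeneous α π γ n, ∃ N : ℕ, ∀ f : C(X, ℂ),
      (∀ n : ℤ, n ≠ 0 → |n| ≤ N → f * pullback α n f = 0) →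
      π f * a * π f = π f * expectation γ a * π f := by
    intro n a ha
    by_cases hn : n = 0
    · subst hn
      exact ⟨0, fun f _ => by rw [h.expectation_of_mem_homogeneous_zero ha]⟩
    · refine ⟨n.natAbs, fun f hf => ?_⟩
      rw [h.expectation_of_mem_homogeneous hn ha, mul_zero, zero_mul, ha.2, mul_assoc, ← map_mul,
        mul_comm, hf n hn (by simp), map_zero, mul_zero]
  induction ha using Submodule.span_induction with
  | zero => exact ⟨0, fun f _ => by simp [expectation]⟩
  | add a b _ _ ha hb =>
    obtain ⟨N, hN⟩ := ha
    obtain ⟨M, hM⟩ := hb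
    refine ⟨N + M, fun f hf => ?_⟩
    rw [h.expectation_add, mul_add, add_mul, mul_add, add_mul,
      hN f fun n hn hnN => hf n hn (by push_cast; omega),
      hM f fun n hn hnN => hf n hn (by push_cast; omega)]
  | smul c a _ ha =>
    obtain ⟨N, hN⟩ := ha
    refine ⟨N, fun f hf => ?_⟩
    rw [h.expectation_smul, mul_smul_comm, smul_mul_assoc, mul_smul_comm, smul_mul_assoc, hN f hf]
  | mem a ha =>
    obtain ⟨n, ha | ha⟩ := ha
    · exact hhom n a (h.words_le_homogeneous n ha)
    · have := star_mem_homogeneous (h.words_le_homogeneous n ha)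
      rw [star_star] at this
      exact hhom _ a this

/-- Below every nonzero positive element there is, up to Cuntz subequivalence, a nonzero positive
function. It is a bump near a point where the expectation of `y` is large, supported in a set that
is disjoint from many of its translates; compressing `y` by such a bump leaves little but the
expectation. -/
theorem exists_function_subequivalent [PartialOrder D] [StarOrderedRing D]
    (hfree : ∀ n : ℤ, n ≠ 0 → ∀ x, (α ^ n) x ≠ x) {y : D} (hy : 0 ≤ y) (hy0 : y ≠ 0) :
    ∃ p : C(X, ℝ), p ≠ 0 ∧ ∃ r : ℕ → D, Filter.Tendsto
      (fun n => ‖r n * y * star (r n) - π (complexify (p * p))‖) Filter.atTop (𝓝 0) := by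
  obtain ⟨f, hf⟩ := h.expectation_mem_range y
  have hfne : f ≠ 0 := by
    rintro rfl
    rw [map_zero] at hf
    exact hy0 (h.eq_zero_of_expectation_eq_zero hy hf.symm)
  have hEy : 0 ≤ π f := hf ▸ h.expectation_nonneg hy
  have hfsa : ∀ x, ((f x).re : ℂ) = f x := by
    have h1 : star f = f := h.pi_injective (by
      rw [map_star]
      exact (IsSelfAdjoint.of_nonneg hEy).star_eq)
    exact fun x => Complex.conj_eq_iff_re.1 (DFunLike.congr_fun h1 x)
  have hnorm : ∀ g, ‖π g‖ = ‖g‖ := NonUnitalStarAlgHom.norm_map π h.pi_injective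
  -- `f` is nonnegative because `‖‖f‖ - f‖ ≤ ‖f‖`
  have hf0 : ∀ x, 0 ≤ (f x).re := by
    intro x
    have h1 : algebraMap ℝ D ‖f‖ - π f ≤ algebraMap ℝ D ‖f‖ := sub_le_self _ hEy
    have h2 : 0 ≤ algebraMap ℝ D ‖f‖ - π f :=
      sub_nonneg.2 (hnorm f ▸ (IsSelfAdjoint.of_nonneg hEy).le_algebraMap_norm_self)
    have h3 := (CStarAlgebra.norm_le_iff_le_algebraMap _ (norm_nonneg f) h2).2 h1
    have h4 : algebraMap ℝ D ‖f‖ - π f = π (algebraMap ℂ C(X, ℂ) (‖f‖ : ℂ) - f) := by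
      rw [map_sub, AlgHomClass.commutes, Algebra.algebraMap_eq_smul_one,
        Algebra.algebraMap_eq_smul_one]
      simp
    rw [h4, hnorm] at h3
    have h5 := (ContinuousMap.norm_coe_le_norm _ x).trans h3
    have h6 : (algebraMap ℂ C(X, ℂ) (‖f‖ : ℂ) - f) x = ((‖f‖ - (f x).re : ℝ) : ℂ) := by
      rw [ContinuousMap.sub_apply, Complex.ofReal_sub, hfsa]
      rfl
    rw [h6, Complex.norm_real, Real.norm_eq_abs] at h5
    linarith [(abs_le.1 h5).2]
  obtain ⟨x₀, hx₀⟩ := DFunLike.ne_iff.1 hfne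
  have hc : 0 < (f x₀).re := lt_of_le_of_ne (hf0 x₀) fun h0 => hx₀ (by
    rw [← hfsa, ← h0]; rfl)
  set δ := (f x₀).re / 4 with hδ
  have hδ0 : 0 < δ := by positivity
  obtain ⟨y', hy', hyy'⟩ := Metric.mem_closure_iff.1 (h.dense_wordSpan y) δ hδ0
  obtain ⟨N, hN⟩ := h.exists_compress_eq hy'
  have hUo : IsOpen {x | 3 * δ < (f x).re} :=
    isOpen_lt continuous_const (Complex.continuous_re.comp f.continuous)
  obtain ⟨k, hk1, hk01, hksupp, hkN⟩ := exists_bump hfree hUo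
    (x := x₀) (by change 3 * δ < (f x₀).re; rw [hδ]; linarith) N
  have hcomp := hN _ hkN
  set K := complexify k with hK
  have hKsa : IsSelfAdjoint (π K) := (isSelfAdjoint_complexify k).map π
  -- the difference between `y` and its expectation is small after compression
  set z := (y - y') + expectation γ (y' - y) with hz
  have hzn : ‖z‖ ≤ 2 * δ := by
    rw [dist_eq_norm] at hyy'
    have h1 := h.norm_expectation_le (y' - y)
    rw [norm_sub_rev y' y] at h1
    exact (norm_add_le _ _).trans (by linarith)
  have hKz : π K * y * π K = π K * π f * π K + π K * z * π K := by
    have h1 : π K * z * π K = π K * y * π K - π K * y' * π K +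
        (π K * expectation γ y' * π K - π K * expectation γ y * π K) := by
      rw [hz, h.expectation_sub]; noncomm_ring
    rw [h1, hcomp, hf]; abel
  have hyb : IsSelfAdjoint (π K * y * π K) := by
    have := (IsSelfAdjoint.of_nonneg hy).conjugate (π K)
    rwa [hKsa.star_eq] at this
  have hfb : IsSelfAdjoint (π K * π f * π K) := by
    have := (IsSelfAdjoint.of_nonneg hEy).conjugate (π K)
    rwa [hKsa.star_eq] at this
  set b := π K * y * π K with hb
  have hbound : π K * π f * π K - b ≤ algebraMap ℝ D (2 * δ) * (π K * π K) := by
    set w : D := (2⁻¹ : ℝ) • (-z + star (-z)) with hw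
    have hwsa : IsSelfAdjoint w :=
      IsSelfAdjoint.smul (IsSelfAdjoint.all _) (IsSelfAdjoint.add_star_self (-z))
    have hwn : ‖w‖ ≤ 2 * δ := by
      rw [hw, norm_smul, Real.norm_of_nonneg (by positivity)]
      have h1 : ‖-z + star (-z)‖ ≤ 2 * δ + 2 * δ :=
        (norm_add_le _ _).trans (by rw [norm_star, norm_neg]; linarith)
      linarith
    have h1 : π K * π f * π K - b = -(π K * z * π K) := by rw [hKz]; abel
    have h2 : π K * w * π K = π K * π f * π K - b := by
      have h3 : IsSelfAdjoint (-(π K * z * π K)) := h1 ▸ hfb.sub hyb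
      have h4 : π K * w * π K =
          (2⁻¹ : ℝ) • (-(π K * z * π K) + star (-(π K * z * π K))) := by
        rw [hw, mul_smul_comm, smul_mul_assoc]
        congr 1
        simp only [star_neg, star_mul, hKsa.star_eq]
        noncomm_ring
      rw [h4, h3.star_eq, h1, ← two_smul ℝ, smul_smul]
      norm_num
    rw [← h2]
    have h5 : w ≤ algebraMap ℝ D (2 * δ) :=
      hwsa.le_algebraMap_norm_self.trans (algebraMap_mono _ hwn)
    have h6 := star_left_conjugate_le_conjugate h5 (π K)
    rw [hKsa.star_eq] at h6
    refine h6.trans (le_of_eq ?_)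
    rw [mul_assoc, ← Algebra.left_comm]
  refine ⟨Real.sqrt δ • k, fun h0 => ?_, ?_⟩
  · have h1 := DFunLike.congr_fun h0 x₀
    simp [hk1, (Real.sqrt_pos.2 hδ0).ne'] at h1
  have hpsa : IsSelfAdjoint (π (complexify (Real.sqrt δ • k))) :=
    (isSelfAdjoint_complexify _).map π
  have hle : π (complexify (Real.sqrt δ • k)) * π (complexify (Real.sqrt δ • k)) ≤ b := by
    have h1 : (0 : C(X, ℂ)) ≤ K * f * K - ((3 * δ : ℝ) : ℂ) • (K * K) := by
      intro x
      have h2 : (K * f * K - ((3 * δ : ℝ) : ℂ) • (K * K)) x =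
          ((k x * k x * ((f x).re - 3 * δ) : ℝ) : ℂ) := by
        simp only [ContinuousMap.sub_apply, ContinuousMap.mul_apply, ContinuousMap.smul_apply, hK,
          complexify_apply]
        rw [← hfsa x, smul_eq_mul, Complex.ofReal_re]
        push_cast
        ring
      change (0 : ℂ) ≤ (K * f * K - ((3 * δ : ℝ) : ℂ) • (K * K)) x
      rw [h2, Complex.zero_le_real]
      by_cases hkx : k x = 0
      · simp [hkx]
      · have := hksupp x hkx
        exact mul_nonneg (mul_self_nonneg _) (sub_nonneg.2 (le_of_lt this))
    have h2 := map_nonneg π h1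
    rw [map_sub, map_smul, map_mul, map_mul, map_mul, sub_nonneg] at h2
    have h3 : π (complexify (Real.sqrt δ • k)) * π (complexify (Real.sqrt δ • k)) =
        ((3 * δ : ℝ) : ℂ) • (π K * π K) - algebraMap ℝ D (2 * δ) * (π K * π K) := by
      rw [← map_mul, ← map_mul, Algebra.algebraMap_eq_smul_one, smul_mul_assoc, one_mul]
      have h4 : complexify (Real.sqrt δ • k) * complexify (Real.sqrt δ • k) =
          (δ : ℂ) • (K * K) := by
        ext x
        simp only [ContinuousMap.mul_apply, ContinuousMap.smul_apply, complexify_apply, hK]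
        have h5 : ((Real.sqrt δ : ℝ) : ℂ) * ((Real.sqrt δ : ℝ) : ℂ) = (δ : ℂ) := by
          rw [← Complex.ofReal_mul, Real.mul_self_sqrt hδ0.le]
        simp only [smul_eq_mul, Complex.ofReal_mul]
        rw [← h5]; ring
      rw [h4, map_smul, ← Complex.coe_smul, ← sub_smul]
      congr 1
      push_cast
      ring
    rw [h3]
    have h4 := hbound
    rw [sub_le_comm] at h4
    exact (sub_le_sub_right h2 _).trans h4
  obtain ⟨r, hr⟩ := exists_tendsto_conjugate_of_mul_self_le hpsa hle
  refine ⟨fun n => r n * π K, ?_⟩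
  refine hr.congr fun n => ?_
  rw [complexify_mul, map_mul, hb, star_mul, hKsa.star_eq]
  simp only [mul_assoc]

/-- If `α` is minimal and acts freely and the bimodule is nowhere zero, then `D` is simple: a
nonzero closed ideal contains a nonzero function, and the common zero set of the functions in the
ideal is `α`-invariant. -/
theorem isSimpleCStarAlgebra [Nontrivial D] [PartialOrder D] [StarOrderedRing D]
    (hα : IsMinimalHomeomorph α) (hfree : ∀ n : ℤ, n ≠ 0 → ∀ x, (α ^ n) x ≠ x)
    (hfull : ∀ x, ∃ ξ q, star (τ ξ) * τ ξ = π q ∧ q x ≠ 0) : IsSimpleCStarAlgebra D := by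
  refine ⟨inferInstance, fun I hI => ?_⟩
  by_cases hbot : I = ⊥
  · exact Or.inl hbot
  right
  obtain ⟨a, ha, ha0⟩ : ∃ a ∈ I, a ≠ 0 := by
    by_contra! hcon
    exact hbot (TwoSidedIdeal.ext fun x =>
      ⟨fun hx => (TwoSidedIdeal.mem_bot D).2 (hcon x hx), fun hx => by
        rw [(TwoSidedIdeal.mem_bot D).1 hx]; exact I.zero_mem⟩)
  obtain ⟨p, hp, r, hr⟩ := h.exists_function_subequivalent hfree (star_mul_self_nonneg a)
    (fun h0 => ha0 ((CStarRing.star_mul_self_eq_zero_iff a).1 h0))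
  have hpI : π (complexify (p * p)) ∈ I := by
    refine hI.mem_of_tendsto (tendsto_iff_norm_sub_tendsto_zero.2 hr)
      (Filter.Eventually.of_forall fun n => ?_)
    exact I.mul_mem_right _ _ (I.mul_mem_left _ _ (I.mul_mem_left _ _ ha))
  set Z : Set X := {x | ∀ f : C(X, ℂ), π f ∈ I → f x = 0} with hZ
  have hZc : IsClosed Z := by
    have : Z = ⋂ f : C(X, ℂ), ⋂ _ : π f ∈ I, f ⁻¹' {0} := by
      ext x; simp [hZ]
    rw [this]
    exact isClosed_iInter fun f => isClosed_iInter fun _ =>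
      isClosed_singleton.preimage f.continuous
  have hZα : α '' Z ⊆ Z := by
    rintro _ ⟨x, hx, rfl⟩ f hf
    obtain ⟨ξ, q, hq, hqx⟩ := hfull x
    have h1 : star (τ ξ) * π f * τ ξ = π (q * pullback α 1 f) := by
      rw [mul_assoc, h.pi_mul_tau, ← mul_assoc, hq, map_mul]
    have h2 := hx (q * pullback α 1 f) (h1 ▸ I.mul_mem_right _ _ (I.mul_mem_left _ _ hf))
    rw [ContinuousMap.mul_apply, pullback_apply, α.zpow_one_apply] at h2
    exact (mul_eq_zero.1 h2).resolve_left hqx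
  have hZe : Z = ∅ := by
    refine (hα Z hZc hZα).resolve_right fun huniv => hp ?_
    ext x
    have h1 : x ∈ Z := huniv ▸ Set.mem_univ x
    have h2 := h1 _ hpI
    simpa using h2
  -- the functions in the ideal form a closed ideal of `C(X)` without common zero
  have hJ : ∃ J : Ideal C(X, ℂ), ∀ f, f ∈ J ↔ π f ∈ I :=
    ⟨{ carrier := {f | π f ∈ I}
       add_mem' := fun {f g} hf hg => by
         change π (f + g) ∈ I
         rw [map_add]; exact I.add_mem hf hg
       zero_mem' := by
         change π 0 ∈ I
         rw [map_zero]; exact I.zero_mem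
       smul_mem' := fun f g hg => by
         change π (f * g) ∈ I
         rw [map_mul]; exact I.mul_mem_left _ _ hg }, fun f => Iff.rfl⟩
  obtain ⟨J, hJ⟩ := hJ
  have hJclosed : IsClosed (J : Set C(X, ℂ)) := by
    have : (J : Set C(X, ℂ)) = π ⁻¹' (I : Set D) := Set.ext hJ
    rw [this]
    exact hI.preimage (NonUnitalStarAlgHom.isometry π h.pi_injective).continuous
  have hJtop : J = ⊤ := by
    have h1 := ContinuousMap.idealOfSet_ofIdeal_isClosed hJclosed
    have h2 : ContinuousMap.setOfIdeal J = Set.univ := by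
      refine Set.eq_univ_of_forall fun x => ?_
      by_contra hx
      have h3 : x ∈ Z := fun f hf => by
        have := ContinuousMap.notMem_setOfIdeal.1 hx
        exact this ((hJ f).2 hf)
      rw [hZe] at h3
      exact h3
    rw [← h1, h2]
    exact (Ideal.eq_top_iff_one _).2 fun x hx => absurd (Set.mem_univ x) hx
  have hone : (1 : D) ∈ I := by
    rw [← map_one π]
    exact (hJ 1).1 (hJtop ▸ Submodule.mem_top)
  refine TwoSidedIdeal.ext fun x => ⟨fun _ => trivial, fun _ => ?_⟩
  rw [← mul_one x]
  exact I.mul_mem_left _ _ hone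

end IsCircleGraded

end CircleGraded

/-! ### Functoriality and gauge action of Cuntz--Pimsner algebras -/

namespace CStarCorrespondence

variable {A : Type u} [CommCStarAlgebra A] [PartialOrder A] [StarOrderedRing A]
variable {E : Type v} [NormedAddCommGroup E] [NormedSpace ℂ E] [CompleteSpace E]
  [Module A E] [IsScalarTower ℂ A E] [CStarModule A E]
variable {E' : Type v} [NormedAddCommGroup E'] [NormedSpace ℂ E'] [CompleteSpace E']
  [Module A E'] [IsScalarTower ℂ A E'] [CStarModule A E']
variable {Φ : CStarCorrespondence A E} {Φ' : CStarCorrespondence A E'}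

/-- The projection of the product onto the target algebra of one covariant representation. -/
noncomputable def productEval (i : Φ.CovariantRepresentation) : Φ.Product →⋆ₙₐ[ℂ] i.B where
  toFun x := x i
  map_smul' _ _ := rfl
  map_zero' := rfl
  map_add' _ _ := rfl
  map_mul' _ _ := rfl
  map_star' _ := rfl

/-- A homomorphism into the product of all covariant representations is a family of homomorphisms
into their target algebras. -/
noncomputable def productMap (f : ∀ i : Φ'.CovariantRepresentation, Φ.Product →⋆ₙₐ[ℂ] i.B) :
    Φ.Product →⋆ₙₐ[ℂ] Φ'.Product where
  toFun x := ⟨fun i => f i x, memℓp_infty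
    ⟨‖x‖, by rintro _ ⟨i, rfl⟩; exact NonUnitalStarAlgHom.norm_apply_le (f i) x⟩⟩
  map_smul' z a := by ext i; exact map_smul (f i) z a
  map_zero' := by ext i; exact map_zero (f i)
  map_add' a b := by ext i; exact map_add (f i) a b
  map_mul' a b := by ext i; exact map_mul (f i) a b
  map_star' a := by ext i; exact map_star (f i) a

theorem map_mem_generated (k : Φ.Product →⋆ₙₐ[ℂ] Φ'.Product)
    (hpi : ∀ a, k (Φ.piProd a) = Φ'.piProd a) (htau : ∀ ξ, k (Φ.tauProd ξ) ∈ Φ'.generated)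
    {x : Φ.Product} (hx : x ∈ Φ.generated) : k x ∈ Φ'.generated := by
  have hk : Continuous k := by
    refine LipschitzWith.continuous (K := 1) (LipschitzWith.of_dist_le_mul fun a b => ?_)
    rw [dist_eq_norm, dist_eq_norm, ← map_sub, NNReal.coe_one, one_mul]
    exact NonUnitalStarAlgHom.norm_apply_le k _
  have hcl : IsClosed (Φ'.generated : Set Φ'.Product) :=
    NonUnitalStarSubalgebra.isClosed_topologicalClosure _
  have hle : NonUnitalStarAlgebra.adjoin ℂ (Set.range Φ.piProd ∪ Set.range Φ.tauProd) ≤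
      Φ'.generated.comap k := by
    refine NonUnitalStarAlgebra.adjoin_le ?_
    rintro _ (⟨a, rfl⟩ | ⟨ξ, rfl⟩)
    · change k _ ∈ Φ'.generated
      rw [hpi]
      exact CuntzPimsner.pi_mem Φ' a
    · exact htau ξ
  exact closure_minimal (t := k ⁻¹' (Φ'.generated : Set Φ'.Product)) (fun y hy => hle hy)
    (hcl.preimage hk) hx

namespace CuntzPimsner

/-- The homomorphism of Cuntz--Pimsner algebras given by a homomorphism of the products of all
covariant representations that is compatible with the generators. -/
noncomputable def map (k : Φ.Product →⋆ₙₐ[ℂ] Φ'.Product)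
    (hpi : ∀ a, k (Φ.piProd a) = Φ'.piProd a) (htau : ∀ ξ, k (Φ.tauProd ξ) ∈ Φ'.generated) :
    Φ.CuntzPimsner →⋆ₐ[ℂ] Φ'.CuntzPimsner where
  toFun x := ⟨k x.1, map_mem_generated k hpi htau x.2⟩
  map_one' := Subtype.ext (hpi 1)
  map_mul' x y := Subtype.ext (map_mul k x.1 y.1)
  map_zero' := Subtype.ext (map_zero k)
  map_add' x y := Subtype.ext (map_add k x.1 y.1)
  commutes' z := Subtype.ext <| by
    rw [Algebra.algebraMap_eq_smul_one, Algebra.algebraMap_eq_smul_one]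
    exact (map_smul k z _).trans (congrArg (z • ·) (hpi 1))
  map_star' x := Subtype.ext (map_star k x.1)

theorem dense_adjoin : Dense (StarAlgebra.adjoin ℂ (Set.range (pi Φ) ∪ Set.range (tau Φ)) :
    Set Φ.CuntzPimsner) := by
  have key : ∀ y (hy : y ∈ NonUnitalStarAlgebra.adjoin ℂ
      (Set.range Φ.piProd ∪ Set.range Φ.tauProd)),
      (show Φ.CuntzPimsner from ⟨y, NonUnitalStarSubalgebra.le_topologicalClosure _ hy⟩) ∈
        StarAlgebra.adjoin ℂ (Set.range (pi Φ) ∪ Set.range (tau Φ)) := by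
    intro y hy
    induction hy using NonUnitalStarAlgebra.adjoin_induction with
    | mem x hx =>
      refine StarAlgebra.subset_adjoin ℂ _ ?_
      rcases hx with ⟨a, rfl⟩ | ⟨ξ, rfl⟩
      · exact Or.inl ⟨a, rfl⟩
      · exact Or.inr ⟨ξ, rfl⟩
    | add x y _ _ hx hy => exact add_mem (M := Φ.CuntzPimsner) hx hy
    | zero => exact zero_mem (StarAlgebra.adjoin ℂ (Set.range (pi Φ) ∪ Set.range (tau Φ)))
    | mul x y _ _ hx hy => exact mul_mem (M := Φ.CuntzPimsner) hx hy
    | smul c x _ hx =>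
      exact (StarAlgebra.adjoin ℂ (Set.range (pi Φ) ∪ Set.range (tau Φ))).smul_mem hx c
    | star x _ hx => exact star_mem (R := Φ.CuntzPimsner) hx
  intro x
  refine Metric.mem_closure_iff.2 fun ε hε => ?_
  obtain ⟨y, hy, hxy⟩ := Metric.mem_closure_iff.1 (show x.1 ∈ closure _ from x.2) ε hε
  exact ⟨⟨y, NonUnitalStarSubalgebra.le_topologicalClosure _ hy⟩, key y hy, hxy⟩

theorem hom_ext {B : Type w} [CStarAlgebra B] {f g : Φ.CuntzPimsner →⋆ₐ[ℂ] B}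
    (hpi : ∀ a, f (pi Φ a) = g (pi Φ a)) (htau : ∀ ξ, f (tau Φ ξ) = g (tau Φ ξ)) : f = g := by
  have hcont : ∀ f : Φ.CuntzPimsner →⋆ₐ[ℂ] B, Continuous f := fun f =>
    LipschitzWith.continuous (K := 1) (LipschitzWith.of_dist_le_mul fun a b => by
      rw [dist_eq_norm, dist_eq_norm, ← map_sub, NNReal.coe_one, one_mul]
      exact NonUnitalStarAlgHom.norm_apply_le f _)
  have hle : StarAlgebra.adjoin ℂ (Set.range (pi Φ) ∪ Set.range (tau Φ)) ≤
      StarAlgHom.equalizer f g := by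
    refine StarAlgebra.adjoin_le ?_
    rintro _ (⟨a, rfl⟩ | ⟨ξ, rfl⟩)
    · exact hpi a
    · exact htau ξ
  exact DFunLike.coe_injective ((hcont f).ext_on dense_adjoin (hcont g) fun x hx => hle hx)

end CuntzPimsner

/-- The representation `(π, z τ)`. -/
noncomputable def Representation.gauge {B : Type w} [NonUnitalCStarAlgebra B] (z : Circle)
    (ρ : Φ.Representation B) : Φ.Representation B where
  pi := ρ.pi
  tau := (z : ℂ) • ρ.tau
  pi_inner ξ η := by
    rw [ρ.pi_inner, LinearMap.smul_apply, LinearMap.smul_apply, star_smul, smul_mul_smul_comm]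
    have : star (z : ℂ) * z = 1 := by
      rw [← starRingEnd_apply, ← Circle.coe_inv_eq_conj, ← Circle.coe_mul, inv_mul_cancel,
        Circle.coe_one]
    rw [this, one_smul]
  pi_mul_tau a ξ := by
    rw [LinearMap.smul_apply, LinearMap.smul_apply, mul_smul_comm, ρ.pi_mul_tau]

theorem Representation.IsCovariant.gauge {B : Type w} [NonUnitalCStarAlgebra B] (z : Circle)
    {ρ : Φ.Representation B} (hρ : ρ.IsCovariant) : (ρ.gauge z).IsCovariant := by
  obtain ⟨ψ, hψ, hcov⟩ := hρ
  refine ⟨ψ, fun ξ η => ?_, hcov⟩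
  rw [hψ]
  change _ = ((z : ℂ) • ρ.tau ξ) * star ((z : ℂ) • ρ.tau η)
  have : (z : ℂ) * star (z : ℂ) = 1 := by
    rw [← starRingEnd_apply, ← Circle.coe_inv_eq_conj, ← Circle.coe_mul, mul_inv_cancel,
      Circle.coe_one]
  rw [star_smul, smul_mul_smul_comm, this, one_smul]

/-- The gauge twist of a covariant representation. -/
noncomputable def CovariantRepresentation.gauge (z : Circle) (i : Φ.CovariantRepresentation) :
    Φ.CovariantRepresentation :=
  ⟨i.B, i.ρ.gauge z, i.covariant.gauge z⟩

/-- The gauge action on the Cuntz--Pimsner algebra. It exists because the set of covariant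
representations is invariant under gauge twists. -/
noncomputable def CuntzPimsner.gauge (z : Circle) : Φ.CuntzPimsner →⋆ₐ[ℂ] Φ.CuntzPimsner :=
  CuntzPimsner.map (productMap fun i => productEval (i.gauge z)) (fun _ => rfl) fun ξ => by
    have : productMap (fun i => productEval (i.gauge z)) (Φ.tauProd ξ) =
      (z : ℂ) • Φ.tauProd ξ := rfl
    rw [this]
    exact Φ.generated.smul_mem _ (CuntzPimsner.tau_mem Φ ξ)

theorem CuntzPimsner.gauge_pi (z : Circle) (a : A) :
    CuntzPimsner.gauge z (CuntzPimsner.pi Φ a) = CuntzPimsner.pi Φ a := rfl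

theorem CuntzPimsner.gauge_tau (z : Circle) (ξ : E) :
    CuntzPimsner.gauge z (CuntzPimsner.tau Φ ξ) = (z : ℂ) • CuntzPimsner.tau Φ ξ := rfl

theorem CuntzPimsner.gauge_one (a : Φ.CuntzPimsner) : CuntzPimsner.gauge 1 a = a := by
  have : (CuntzPimsner.gauge 1 : Φ.CuntzPimsner →⋆ₐ[ℂ] Φ.CuntzPimsner) =
      StarAlgHom.id ℂ Φ.CuntzPimsner :=
    CuntzPimsner.hom_ext (fun a => CuntzPimsner.gauge_pi 1 a) fun ξ => by
      rw [CuntzPimsner.gauge_tau, Circle.coe_one, one_smul]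
      rfl
  rw [this]
  rfl

theorem CuntzPimsner.star_tau_mul_tau (ξ η : E) :
    star (CuntzPimsner.tau Φ ξ) * CuntzPimsner.tau Φ η = CuntzPimsner.pi Φ (inner A ξ η) :=
  Subtype.ext <| lp.ext <| funext fun i => (i.ρ.pi_inner ξ η).symm

theorem CuntzPimsner.pi_mul_tau (a : A) (ξ : E) :
    CuntzPimsner.pi Φ a * CuntzPimsner.tau Φ ξ = CuntzPimsner.tau Φ (Φ.φ a ξ) :=
  Subtype.ext <| lp.ext <| funext fun i => i.ρ.pi_mul_tau a ξ

theorem CuntzPimsner.tau_mul_pi (ξ : E) (a : A) :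
    CuntzPimsner.tau Φ ξ * CuntzPimsner.pi Φ a = CuntzPimsner.tau Φ (a • ξ) :=
  Subtype.ext (CuntzPimsner.tauProd_mul_piProd Φ ξ a)

/-- If `φ` is injective, covariance identifies `τ ξ (τ η)⋆` with `π a` whenever the rank one
operator `θ_{ξ,η}` is `φ a`. -/
theorem Representation.IsCovariant.tau_mul_star_tau {B : Type w} [NonUnitalCStarAlgebra B]
    {ρ : Φ.Representation B} (hρ : ρ.IsCovariant) (hφ : Function.Injective Φ.φ) {ξ η : E} {a : A}
    (h : Φ.φ a = rankOne A ξ η) : ρ.tau ξ * star (ρ.tau η) = ρ.pi a := by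
  obtain ⟨ψ, hψ, hcov⟩ := hρ
  have ha : a ∈ Φ.katsuraIdeal := ⟨h ▸ rankOne_mem A ξ η, fun b hb => by
    rw [hφ (hb.trans (map_zero Φ.φ).symm), mul_zero]⟩
  rw [hcov a ha, ← hψ]
  congr 2
  exact h.symm

theorem CuntzPimsner.tau_mul_star_tau (hφ : Function.Injective Φ.φ) {ξ η : E} {a : A}
    (h : Φ.φ a = rankOne A ξ η) :
    CuntzPimsner.tau Φ ξ * star (CuntzPimsner.tau Φ η) = CuntzPimsner.pi Φ a :=
  Subtype.ext <| lp.ext <| funext fun i => i.covariant.tau_mul_star_tau hφ h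

/-- If `φ` is isometric and its range contains the rank one operators, then covariance need only
be checked on rank one operators. -/
theorem Representation.isCovariant_of_rankOne {B : Type w} [NonUnitalCStarAlgebra B]
    (ρ : Φ.Representation B) (hφ : Isometry Φ.φ)
    (h : ∀ ξ η : E, ∃ a, Φ.φ a = rankOne A ξ η ∧ ρ.tau ξ * star (ρ.tau η) = ρ.pi a) :
    ρ.IsCovariant := by
  set φ : A →ₗ[ℂ] (E →L[ℂ] E) := Φ.φ.toLinearMap with hφdef
  have hclosed : IsClosed (LinearMap.range φ : Set (E →L[ℂ] E)) :=
    hφ.isClosedEmbedding.isClosed_range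
  have hle : compactOperators A E ≤ LinearMap.range φ := by
    refine Submodule.topologicalClosure_minimal _ (Submodule.span_le.2 ?_) hclosed
    rintro _ ⟨ξ, η, rfl⟩
    obtain ⟨a, ha, -⟩ := h ξ η
    exact ⟨a, ha⟩
  set e := LinearEquiv.ofInjective φ hφ.injective
  set ψ : compactOperators A E →ₗ[ℂ] B :=
    (ρ.pi : A →ₗ[ℂ] B) ∘ₗ e.symm.toLinearMap ∘ₗ Submodule.inclusion hle with hψdef
  have hψ : ∀ a (T : compactOperators A E), Φ.φ a = T → ψ T = ρ.pi a := fun a T ha => by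
    have h1 : e.symm (Submodule.inclusion hle T) = a := by
      rw [LinearEquiv.symm_apply_eq]
      exact Subtype.ext ha.symm
    exact congrArg ρ.pi h1
  refine ⟨ψ.mkContinuous 1 fun T => ?_, fun ξ η => ?_, fun a ha => ?_⟩
  · obtain ⟨a, ha⟩ := hle T.2
    rw [hψ a T ha, one_mul]
    refine (NonUnitalStarAlgHom.norm_apply_le ρ.pi a).trans (le_of_eq ?_)
    rw [← (AddMonoidHomClass.isometry_iff_norm Φ.φ).1 hφ a]
    exact congrArg norm ha
  · obtain ⟨a, ha, hab⟩ := h ξ η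
    rw [hab, LinearMap.mkContinuous_apply]
    exact hψ a _ ha
  · rw [LinearMap.mkContinuous_apply]
    exact (hψ a _ rfl).symm

end CStarCorrespondence

/-- The Cuntz--Pimsner algebra of a correspondence over `C(X)` with left action `f ↦ f ∘ α`, all
of whose rank one operators are given by functions. -/
theorem CStarCorrespondence.isCircleGraded {X : Type u} [TopologicalSpace X] [CompactSpace X]
    {E : Type v} [NormedAddCommGroup E] [NormedSpace ℂ E] [CompleteSpace E]
    [Module C(X, ℂ) E] [IsScalarTower ℂ C(X, ℂ) E] [CStarModule C(X, ℂ) E]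
    {Φ : CStarCorrespondence C(X, ℂ) E} {α : X ≃ₜ X}
    (hφ : ∀ f ξ, Φ.φ f ξ = pullback α 1 f • ξ) (hinj : Function.Injective Φ.φ)
    (hrank : ∀ ξ η : E, ∃ f, Φ.φ f = rankOne C(X, ℂ) ξ η)
    (hpi : Function.Injective (CuntzPimsner.pi Φ)) :
    IsCircleGraded α (CuntzPimsner.pi Φ) (CuntzPimsner.tau Φ) CuntzPimsner.gauge where
  pi_injective := hpi
  pi_mul_tau f ξ := by
    rw [CuntzPimsner.pi_mul_tau, CuntzPimsner.tau_mul_pi, hφ]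
  tau_mul_pi_mem f ξ := ⟨f • ξ, (CuntzPimsner.tau_mul_pi ξ f).symm⟩
  star_tau_mul_tau_mem ξ η := ⟨_, (CuntzPimsner.star_tau_mul_tau ξ η).symm⟩
  tau_mul_star_tau_mem ξ η := by
    obtain ⟨f, hf⟩ := hrank ξ η
    exact ⟨f, (CuntzPimsner.tau_mul_star_tau hinj hf).symm⟩
  gauge_one := CuntzPimsner.gauge_one
  gauge_pi := CuntzPimsner.gauge_pi
  gauge_tau := CuntzPimsner.gauge_tau
  dense := CuntzPimsner.dense_adjoin

/-! ### Weighted shifts, and sections of line bundles -/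

section WeightedComposition

variable {I : Type u}

theorem memℓp_weightedComp {w : I → ℂ} {C : ℝ} (hw : ∀ i, ‖w i‖ ≤ C) (σ : I ≃ I)
    (v : lp (fun _ : I => ℂ) 2) : Memℓp (fun i => w i * v (σ i)) 2 ∧
      ∑' i, ‖w i * v (σ i)‖ ^ (2 : ℝ≥0∞).toReal ≤ (C * ‖v‖) ^ (2 : ℝ≥0∞).toReal := by
  have h2 : (0 : ℝ) < (2 : ℝ≥0∞).toReal := by simp
  have hv : Summable fun i => ‖v i‖ ^ (2 : ℝ≥0∞).toReal := (memℓp_gen_iff h2).1 v.2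
  have hvσ : Summable fun i => ‖v (σ i)‖ ^ (2 : ℝ≥0∞).toReal := σ.summable_iff.2 hv
  have hle : ∀ i, ‖w i * v (σ i)‖ ^ (2 : ℝ≥0∞).toReal ≤
      C ^ (2 : ℝ≥0∞).toReal * ‖v (σ i)‖ ^ (2 : ℝ≥0∞).toReal := by
    intro i
    have hC : 0 ≤ C := (norm_nonneg _).trans (hw i)
    rw [norm_mul, Real.mul_rpow (norm_nonneg _) (norm_nonneg _)]
    gcongr
    exact hw i
  have hsum := Summable.of_nonneg_of_le (fun i => by positivity) hle (hvσ.mul_left _)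
  refine ⟨(memℓp_gen_iff h2).2 hsum, ?_⟩
  rcases isEmpty_or_nonempty I with hI | ⟨⟨i⟩⟩
  · rw [tsum_empty]
    have : v = 0 := lp.ext (funext fun i => isEmptyElim i)
    simp [this]
  have hC : 0 ≤ C := (norm_nonneg _).trans (hw i)
  refine (hsum.tsum_le_tsum hle (hvσ.mul_left _)).trans (le_of_eq ?_)
  rw [tsum_mul_left, σ.tsum_eq (fun i => ‖v i‖ ^ (2 : ℝ≥0∞).toReal),
    ← lp.norm_rpow_eq_tsum h2, Real.mul_rpow hC (norm_nonneg _)]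

/-- The weighted composition operator `v ↦ (i ↦ w i * v (σ i))` on `ℓ²(I)`. -/
noncomputable def weightedComp (w : I → ℂ) (C : ℝ) (hw : ∀ i, ‖w i‖ ≤ C) (σ : I ≃ I) :
    lp (fun _ : I => ℂ) 2 →L[ℂ] lp (fun _ : I => ℂ) 2 :=
  LinearMap.mkContinuous
    { toFun := fun v => ⟨fun i => w i * v (σ i), (memℓp_weightedComp hw σ v).1⟩
      map_add' := fun v v' => by ext i; exact mul_add _ _ _
      map_smul' := fun z v => by ext i; exact mul_left_comm _ _ _ }
    |C| fun v => lp.norm_le_of_tsum_le (by simp) (by positivity)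
      (memℓp_weightedComp (fun i => (hw i).trans (le_abs_self C)) σ v).2

variable {w w' : I → ℂ} {C C' : ℝ} {hw : ∀ i, ‖w i‖ ≤ C} {hw' : ∀ i, ‖w' i‖ ≤ C'} {σ : I ≃ I}

theorem weightedComp_apply (v : lp (fun _ : I => ℂ) 2) (i : I) :
    weightedComp w C hw σ v i = w i * v (σ i) := rfl

theorem star_weightedComp (h : ∀ i, w' (σ i) = star (w i)) :
    star (weightedComp w C hw σ) = weightedComp w' C' hw' σ.symm := by
  rw [ContinuousLinearMap.star_eq_adjoint]
  refine ((ContinuousLinearMap.eq_adjoint_iff _ _).2 fun x y => ?_).symm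
  rw [lp.inner_eq_tsum, lp.inner_eq_tsum, ← σ.tsum_eq]
  refine tsum_congr fun i => ?_
  rw [weightedComp_apply, weightedComp_apply, σ.symm_apply_apply, h]
  simp only [RCLike.inner_apply, map_mul, starRingEnd_apply, star_star]
  ring

end WeightedComposition

theorem le_of_forall_pow_mul_le {a b c d : ℝ} (hb : 0 ≤ b) (hc : 0 < c)
    (h : ∀ n : ℕ, a ^ n * c ≤ b ^ n * d) : a ≤ b := by
  by_contra! hba
  have ha : 0 < a := hb.trans_lt hba
  have hd : 0 < d := by have := h 0; simp at this; linarith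
  obtain ⟨n, hn⟩ := exists_pow_lt_of_lt_one (div_pos hc hd) ((div_lt_one ha).2 hba)
  rw [div_pow, div_lt_div_iff₀ (pow_pos ha n) hd] at hn
  linarith [h n]

namespace Sections

variable {X : Type u} [TopologicalSpace X] {V : X → Type v}
  [∀ x, NormedAddCommGroup (V x)] [∀ x, InnerProductSpace ℂ (V x)]
  [TopologicalSpace (Bundle.TotalSpace ℂ V)] [FiberBundle ℂ V] [VectorBundle ℂ ℂ V]

variable (V) in
theorem exists_forall_eq_smul (x : X) : ∃ s : V x, s ≠ 0 ∧ ∀ v : V x, ∃ c : ℂ, v = c • s := by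
  set e := (trivializationAt ℂ V x).continuousLinearEquivAt ℂ x
    (FiberBundle.mem_baseSet_trivializationAt ℂ V x)
  refine ⟨e.symm 1, by simp, fun v => ⟨e v, ?_⟩⟩
  rw [← map_smul, smul_eq_mul, mul_one, e.symm_apply_apply]

theorem inner_smul_comm_fiber {x : X} (u v w : V x) :
    (inner ℂ v w : ℂ) • u = (inner ℂ v u : ℂ) • w := by
  obtain ⟨s, -, hs⟩ := exists_forall_eq_smul V x
  obtain ⟨a, rfl⟩ := hs u
  obtain ⟨b, rfl⟩ := hs v
  obtain ⟨c, rfl⟩ := hs w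
  simp only [inner_smul_left, inner_smul_right, smul_smul]
  congr 1
  ring

theorem inner_mul_inner_fiber {x : X} {e : V x} (he : ‖e‖ = 1) (u v : V x) :
    (inner ℂ u e : ℂ) * inner ℂ e v = inner ℂ u v := by
  rw [mul_comm, ← inner_smul_right, inner_smul_comm_fiber, inner_smul_right,
    inner_self_eq_norm_sq_to_K, he]
  simp

variable (V) in
theorem exists_norm_eq_one (x : X) : ∃ e : V x, ‖e‖ = 1 := by
  obtain ⟨s, hs, -⟩ := exists_forall_eq_smul V x
  refine ⟨((‖s‖⁻¹ : ℝ) : ℂ) • s, ?_⟩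
  rw [norm_smul, Complex.norm_real, norm_inv, norm_norm, inv_mul_cancel₀ (norm_ne_zero_iff.2 hs)]

/-- A bump function times a local frame is a continuous section. -/
theorem exists_section_of_trivialization
    (e : Bundle.Trivialization ℂ (Bundle.TotalSpace.proj : Bundle.TotalSpace ℂ V → X))
    (he : e.IsLinear ℂ) (b : C(X, ℝ)) {C : Set X} (hC : IsClosed C) (hCe : C ⊆ e.baseSet)
    (hb : ∀ x, b x ≠ 0 → x ∈ C) : ∃ ξ : Sections V, ∀ x, b x ≠ 0 → ξ x ≠ 0 := by
  set s : ∀ x, V x := fun x => (b x : ℂ) • e.symm x 1 with hs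
  have hsymm : ∀ x ∈ e.baseSet, s x = e.symm x (b x : ℂ) := by
    intro x hx
    have h1 := (e.symmₗ ℂ x).map_smul (b x : ℂ) (1 : ℂ)
    rw [e.symmₗ_apply hx, e.symmₗ_apply hx, smul_eq_mul, mul_one] at h1
    exact h1.symm
  have hcont : Continuous fun x => Bundle.TotalSpace.mk' ℂ x (s x) := by
    refine continuous_iff_continuousAt.2 fun x => ?_
    by_cases hx : x ∈ e.baseSet
    · have h1 : ContinuousAt (fun x => e.toOpenPartialHomeomorph.symm (x, (b x : ℂ))) x :=
        ContinuousAt.comp (f := fun x : X => (x, (b x : ℂ)))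
          (e.toOpenPartialHomeomorph.symm.continuousAt
            (by simpa [e.mem_target] using hx))
          (by fun_prop)
      refine h1.congr_of_eventuallyEq ?_
      filter_upwards [e.open_baseSet.mem_nhds hx] with y hy
      rw [hsymm y hy]
      exact e.mk_symm hy _
    · have h1 : ContinuousAt (fun x => Bundle.TotalSpace.mk' ℂ x ((0 : ∀ x, V x) x)) x :=
        (continuousSections V).zero_mem.continuousAt
      refine h1.congr_of_eventuallyEq ?_
      filter_upwards [hC.isOpen_compl.mem_nhds fun h => hx (hCe h)] with y hy
      have h2 : b y = 0 := by
        by_contra h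
        exact hy (hb y h)
      simp [hs, h2]
  refine ⟨⟨s, hcont⟩, fun x hx => ?_⟩
  change s x ≠ 0
  have hxe := hCe (hb x hx)
  intro h0
  have h1 := e.apply_mk_symm hxe (b x : ℂ)
  rw [← hsymm x hxe, h0] at h1
  have h2 := (e.linear ℂ hxe).map_zero
  rw [h1] at h2
  exact hx (by simpa using h2)

variable [IsHermitianBundle V]

theorem continuous_norm (ξ : Sections V) : Continuous fun x => ‖ξ x‖ := by
  have h : Continuous fun x => √‖(inner C(X, ℂ) ξ ξ) x‖ :=
    (inner C(X, ℂ) ξ ξ).continuous.norm.sqrt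
  refine h.congr fun x => ?_
  rw [inner_apply, inner_self_eq_norm_sq_to_K]
  simp

/-- Over a set on which the bundle is trivial there are sections that have unit length on a given
closed subset. -/
theorem exists_norm_eq_one_of_isTrivialOver [CompactSpace X] [T2Space X] {U K : Set X}
    (hU : IsTrivialOver V U) (hK : IsClosed K) (hKU : K ⊆ U) :
    ∃ ξ : Sections V, ∀ x ∈ K, ‖ξ x‖ = 1 := by
  obtain ⟨e, he, rfl⟩ := hU
  obtain ⟨O, hO, hKO, hOU⟩ := normal_exists_closure_subset hK e.open_baseSet hKU
  obtain ⟨b, hb0, hb1, -⟩ := exists_continuous_zero_one_of_isClosed hO.isClosed_compl hK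
    (Set.disjoint_left.2 fun x hx hxK => hx (hKO hxK))
  obtain ⟨ξ, hξ⟩ := exists_section_of_trivialization e he b isClosed_closure hOU fun x hx =>
    subset_closure (by by_contra h; exact hx (hb0 h))
  have hξK : ∀ x ∈ K, 0 < ‖ξ x‖ := fun x hx => norm_pos_iff.2 (hξ x (by rw [hb1 hx]; simp))
  obtain ⟨δ, hδ, hδK⟩ : ∃ δ > 0, ∀ x ∈ K, δ ≤ ‖ξ x‖ := by
    rcases K.eq_empty_or_nonempty with rfl | hne
    · exact ⟨1, one_pos, by simp⟩
    · obtain ⟨x, hx, hmin⟩ := hK.isCompact.exists_isMinOn hne ξ.continuous_norm.continuousOn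
      exact ⟨‖ξ x‖, hξK x hx, fun y hy => hmin hy⟩
  set q : C(X, ℝ) := ⟨fun x => (max ‖ξ x‖ δ)⁻¹, (ξ.continuous_norm.max continuous_const).inv₀
    fun x => (lt_max_of_lt_right hδ).ne'⟩ with hq
  refine ⟨complexify q • ξ, fun x hx => ?_⟩
  rw [smul_apply, norm_smul, complexify_apply, Complex.norm_real, hq, ContinuousMap.coe_mk,
    max_eq_left (hδK x hx), norm_inv, norm_norm, inv_mul_cancel₀ (hξK x hx).ne']

theorem exists_norm_apply_eq_one [CompactSpace X] [T2Space X] (x : X) :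
    ∃ ξ : Sections V, ‖ξ x‖ = 1 := by
  obtain ⟨ξ, hξ⟩ := exists_norm_eq_one_of_isTrivialOver (V := V) (K := {x})
    ⟨trivializationAt ℂ V x, inferInstance, rfl⟩ isClosed_singleton
    (Set.singleton_subset_iff.2 (FiberBundle.mem_baseSet_trivializationAt ℂ V x))
  exact ⟨ξ, hξ x rfl⟩

variable [CompactSpace X] {α : X ≃ₜ X}

theorem correspondence_φ_apply (f : C(X, ℂ)) (ξ : Sections V) :
    (correspondence V α).φ f ξ = pullback α 1 f • ξ := by
  ext x
  change f (α x) • ξ x = f ((α ^ (1 : ℤ)) x) • ξ x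
  rw [α.zpow_one_apply]

theorem inner_smul_comm (ξ η ζ : Sections V) :
    inner C(X, ℂ) η ζ • ξ = inner C(X, ℂ) η ξ • ζ :=
  ext fun x => inner_smul_comm_fiber (ξ x) (η x) (ζ x)

/-- As `V` has rank one, the rank one operators belong to the left action. -/
theorem φ_eq_rankOne (ξ η : Sections V) :
    (correspondence V α).φ (pullback α (-1) (inner C(X, ℂ) η ξ)) = rankOne C(X, ℂ) ξ η := by
  ext1 ζ
  rw [correspondence_φ_apply, pullback_pullback_neg]
  exact (inner_smul_comm ξ η ζ).symm

/-- A left action by functions on a space of sections that is nonzero at a dense set of points is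
isometric. -/
theorem isometry_φ {E : Type w} [NormedAddCommGroup E] [NormedSpace ℂ E] [CompleteSpace E]
    [Module C(X, ℂ) E] [IsScalarTower ℂ C(X, ℂ) E] [CStarModule C(X, ℂ) E]
    (Φ : CStarCorrespondence C(X, ℂ) E) (j : E → Sections V) (hj : ∀ ξ, ‖j ξ‖ = ‖ξ‖)
    (hφ : ∀ f ξ, j (Φ.φ f ξ) = pullback α 1 f • j ξ)
    (hd : Dense {x | ∃ ξ, j ξ (α.symm x) ≠ 0}) : Isometry Φ.φ := by
  refine AddMonoidHomClass.isometry_of_norm Φ.φ fun f => le_antisymm ?_ ?_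
  · refine ContinuousLinearMap.opNorm_le_bound _ (norm_nonneg _) fun ξ => ?_
    rw [← hj, ← hj ξ, hφ]
    refine (norm_smul_le_mul C(X, ℂ) _ _).trans ?_
    gcongr
    exact NonUnitalStarAlgHom.norm_apply_le (pullback α 1) f
  · refine (ContinuousMap.norm_le _ (norm_nonneg _)).2 fun x => ?_
    refine (hd.induction (P := fun x => ‖f x‖ ≤ ‖Φ.φ f‖) ?_
      (isClosed_le f.continuous.norm continuous_const)) x
    rintro x ⟨ξ, hξ⟩
    have hpow : ∀ n : ℕ, j ((Φ.φ f ^ n) ξ) (α.symm x) = f x ^ n • j ξ (α.symm x) := by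
      intro n
      induction n with
      | zero => rw [pow_zero, pow_zero, one_smul]; rfl
      | succ n ih =>
        rw [pow_succ', pow_succ', mul_smul, ← ih]
        change j (Φ.φ f ((Φ.φ f ^ n) ξ)) (α.symm x) = _
        rw [hφ, smul_apply, pullback_apply, α.zpow_one_apply, α.apply_symm_apply]
    -- `φ f` multiplies values at `α⁻¹ x` by `f x`; comparing norms of powers removes constants
    refine le_of_forall_pow_mul_le (d := ‖ξ‖) (norm_nonneg _) (norm_pos_iff.2 hξ) fun n => ?_
    rw [← norm_pow, ← norm_smul, ← hpow]
    refine (norm_apply_le _ _).trans ?_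
    rw [hj]
    refine ((Φ.φ f ^ n).le_opNorm ξ).trans ?_
    gcongr
    cases n with
    | zero =>
      rw [pow_zero, pow_zero]
      exact ContinuousLinearMap.norm_id_le
    | succ n => exact norm_pow_le' _ n.succ_pos

theorem isometry_correspondence_φ [T2Space X] : Isometry (correspondence V α).φ := by
  refine isometry_φ (correspondence V α) id (fun _ => rfl) correspondence_φ_apply ?_
  convert dense_univ
  refine Set.eq_univ_of_forall fun x => ?_
  obtain ⟨ξ, hξ⟩ := exists_norm_apply_eq_one (V := V) (α.symm x)
  exact ⟨ξ, fun h => by simp [show ξ (α.symm x) = 0 from h] at hξ⟩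

end Sections

/-! ### Orbit representations and the orbit-breaking inclusion -/

section

open CStarCorrespondence

namespace Sections

variable {X : Type u} [TopologicalSpace X] [CompactSpace X] {V : X → Type v}
  [∀ x, NormedAddCommGroup (V x)] [∀ x, InnerProductSpace ℂ (V x)]
  [TopologicalSpace (Bundle.TotalSpace ℂ V)] [FiberBundle ℂ V] [VectorBundle ℂ ℂ V]
  [IsHermitianBundle V]

/-- The shift `n ↦ n - 1` of the integers, in an arbitrary universe. -/
def shiftEquiv : ULift.{w} ℤ ≃ ULift.{w} ℤ where
  toFun n := ⟨n.down - 1⟩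
  invFun n := ⟨n.down + 1⟩
  left_inv n := by simp
  right_inv n := by simp

/-- The values of a section along an orbit, with respect to a choice of unit vectors. -/
noncomputable def orbitCoord (α : X ≃ₜ X) (x₀ : X) (ξ : Sections V) (n : ℤ) : ℂ :=
  inner ℂ (exists_norm_eq_one V ((α ^ n) x₀)).choose (ξ ((α ^ n) x₀))

theorem norm_orbitCoord_le (α : X ≃ₜ X) (x₀ : X) (ξ : Sections V) (n : ℤ) :
    ‖orbitCoord α x₀ ξ n‖ ≤ ‖ξ‖ := by
  refine (norm_inner_le_norm _ _).trans ?_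
  rw [(exists_norm_eq_one V ((α ^ n) x₀)).choose_spec, one_mul]
  exact norm_apply_le ξ _

theorem star_orbitCoord_mul (α : X ≃ₜ X) (x₀ : X) (ξ η : Sections V) (n : ℤ) :
    star (orbitCoord α x₀ ξ n) * orbitCoord α x₀ η n =
      inner C(X, ℂ) ξ η ((α ^ n) x₀) := by
  rw [inner_apply, ← inner_mul_inner_fiber (exists_norm_eq_one V ((α ^ n) x₀)).choose_spec]
  congr 1
  exact inner_conj_symm _ _

/-- The Hilbert space `ℓ²(ℤ)`, in an arbitrary universe. -/
abbrev OrbitSpace : Type w := lp (fun _ : ULift.{w} ℤ => ℂ) 2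

/-- The weighted shift on `ℓ²(ℤ)` given by the values of a section along an orbit. -/
noncomputable def orbitShift (α : X ≃ₜ X) (x₀ : X) (ξ : Sections V) :
    OrbitSpace.{w} →L[ℂ] OrbitSpace.{w} :=
  weightedComp (fun n => orbitCoord α x₀ ξ (n.down - 1)) ‖ξ‖
    (fun _ => norm_orbitCoord_le α x₀ ξ _) shiftEquiv

theorem orbitShift_apply (α : X ≃ₜ X) (x₀ : X) (ξ : Sections V) (v : OrbitSpace.{w})
    (n : ULift ℤ) :
    orbitShift α x₀ ξ v n = orbitCoord α x₀ ξ (n.down - 1) * v (shiftEquiv n) := rfl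

theorem star_orbitShift_apply (α : X ≃ₜ X) (x₀ : X) (ξ : Sections V) (v : OrbitSpace.{w})
    (n : ULift ℤ) : (star (orbitShift α x₀ ξ) : OrbitSpace.{w} →L[ℂ] OrbitSpace.{w}) v n =
      star (orbitCoord α x₀ ξ n.down) * v (shiftEquiv.symm n) := by
  have h : star (orbitShift α x₀ ξ : OrbitSpace.{w} →L[ℂ] OrbitSpace.{w}) =
      weightedComp (fun n => star (orbitCoord α x₀ ξ n.down)) ‖ξ‖
        (fun n => by rw [norm_star]; exact norm_orbitCoord_le α x₀ ξ _) shiftEquiv.symm :=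
    star_weightedComp fun n => rfl
  rw [h, weightedComp_apply]

/-- Multiplication by the values of a function along an orbit. -/
noncomputable def orbitMul (α : X ≃ₜ X) (x₀ : X) :
    C(X, ℂ) →⋆ₙₐ[ℂ] (OrbitSpace.{w} →L[ℂ] OrbitSpace.{w}) where
  toFun f := weightedComp (fun n => f ((α ^ n.down) x₀)) ‖f‖ (fun n => f.norm_coe_le_norm _)
    (Equiv.refl _)
  map_smul' z f := by ext v n; exact mul_assoc z _ _
  map_zero' := by ext v n; exact zero_mul _
  map_add' f g := by ext v n; exact add_mul _ _ _
  map_mul' f g := by ext v n; exact mul_assoc _ _ _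
  map_star' f := by
    exact (star_weightedComp (σ := Equiv.refl (ULift.{w} ℤ)) fun _ => rfl).symm

theorem orbitMul_apply (α : X ≃ₜ X) (x₀ : X) (f : C(X, ℂ)) (v : OrbitSpace.{w}) (n : ULift ℤ) :
    orbitMul α x₀ f v n = f ((α ^ n.down) x₀) * v n := rfl

/-- The representation of the correspondence on `ℓ²(ℤ)` over an orbit: functions act by their
values along the orbit, and sections as weighted shifts. -/
noncomputable def orbitRepresentation (α : X ≃ₜ X) (x₀ : X) :
    (correspondence V α).Representation (OrbitSpace.{w} →L[ℂ] OrbitSpace.{w}) where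
  pi := orbitMul α x₀
  tau :=
    { toFun := orbitShift α x₀
      map_add' := fun ξ η => by
        ext v n
        exact (congrArg (· * v (shiftEquiv n)) (inner_add_right _ _ _)).trans (add_mul _ _ _)
      map_smul' := fun z ξ => by
        ext v n
        exact (congrArg (· * v (shiftEquiv n)) (inner_smul_right _ _ z)).trans (mul_assoc z _ _) }
  pi_inner ξ η := by
    ext v n
    change orbitMul α x₀ (inner C(X, ℂ) ξ η) v n =
      (star (orbitShift α x₀ ξ) : OrbitSpace.{w} →L[ℂ] OrbitSpace.{w}) (orbitShift α x₀ η v) n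
    rw [star_orbitShift_apply, orbitShift_apply, orbitMul_apply, Equiv.apply_symm_apply,
      ← mul_assoc, ← star_orbitCoord_mul]
    change _ = _ * orbitCoord α x₀ η (n.down + 1 - 1) * _
    rw [add_sub_cancel_right]
  pi_mul_tau f ξ := by
    ext v n
    change orbitMul α x₀ f (orbitShift α x₀ ξ v) n =
      orbitShift α x₀ ((correspondence V α).φ f ξ) v n
    rw [orbitMul_apply, orbitShift_apply, orbitShift_apply, ← mul_assoc, correspondence_φ_apply]
    congr 1
    simp only [orbitCoord]
    rw [smul_apply, inner_smul_right, pullback_apply, ← α.zpow_add_apply, add_sub_cancel]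

theorem orbitRepresentation_tau_mul_star_tau (α : X ≃ₜ X) (x₀ : X) (ξ η : Sections V) :
    (orbitRepresentation.{u, v, w} (V := V) α x₀).tau ξ * star ((orbitRepresentation α x₀).tau η) =
      (orbitRepresentation (V := V) α x₀).pi (pullback α (-1) (inner C(X, ℂ) η ξ)) := by
  ext v n
  change orbitShift α x₀ ξ
    ((star (orbitShift α x₀ η) : OrbitSpace.{w} →L[ℂ] OrbitSpace.{w}) v) n = orbitMul α x₀ _ v n
  rw [orbitShift_apply, star_orbitShift_apply, orbitMul_apply, Equiv.symm_apply_apply,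
    pullback_apply, ← α.zpow_add_apply, ← mul_assoc, neg_add_eq_sub, ← star_orbitCoord_mul,
    mul_comm (star _)]
  rfl

theorem isCovariant_orbitRepresentation [T2Space X] (α : X ≃ₜ X) (x₀ : X) :
    (orbitRepresentation.{u, v, w} (V := V) α x₀).IsCovariant :=
  Representation.isCovariant_of_rankOne _ isometry_correspondence_φ fun ξ η =>
    ⟨_, φ_eq_rankOne ξ η, orbitRepresentation_tau_mul_star_tau α x₀ ξ η⟩

theorem pi_injective [T2Space X] [Nonempty X] {α : X ≃ₜ X} (hα : IsMinimalHomeomorph α) :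
    Function.Injective (CuntzPimsner.pi (correspondence V α)) := by
  refine (injective_iff_map_eq_zero _).2 fun f hf => ?_
  obtain ⟨x₀⟩ := ‹Nonempty X›
  set i : (correspondence V α).CovariantRepresentation :=
    ⟨_, orbitRepresentation α x₀, isCovariant_orbitRepresentation α x₀⟩
  have h1 : (orbitRepresentation (V := V) α x₀).pi f = 0 :=
    congrArg (productEval i) (congrArg Subtype.val hf)
  by_contra hne
  obtain ⟨x, hx⟩ := DFunLike.ne_iff.1 hne
  obtain ⟨n, -, hn⟩ := hα.exists_pow_mem (U := {x | f x ≠ 0})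
    (isOpen_ne_fun f.continuous continuous_const) ⟨x, hx⟩ x₀
  classical
  have h2 : orbitMul α x₀ f (lp.single 2 ⟨(n : ℤ)⟩ (1 : ℂ)) ⟨n⟩ = 0 := by
    change (orbitRepresentation (V := V) α x₀).pi f _ ⟨n⟩ = 0
    rw [h1]
    rfl
  rw [orbitMul_apply, lp.single_apply_self, mul_one] at h2
  exact hn h2

theorem isCircleGraded [T2Space X] [Nonempty X] {α : X ≃ₜ X} (hα : IsMinimalHomeomorph α) :
    IsCircleGraded α (CuntzPimsner.pi (correspondence V α)) (CuntzPimsner.tau (correspondence V α))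
      CuntzPimsner.gauge :=
  CStarCorrespondence.isCircleGraded correspondence_φ_apply isometry_correspondence_φ.injective
    (fun ξ η => ⟨_, φ_eq_rankOne ξ η⟩) (pi_injective hα)

end Sections

section OrbitBreaking

open Sections

variable {X : Type u} [TopologicalSpace X] [CompactSpace X] [T2Space X] {V : X → Type v}
  [∀ x, NormedAddCommGroup (V x)] [∀ x, InnerProductSpace ℂ (V x)]
  [TopologicalSpace (Bundle.TotalSpace ℂ V)] [FiberBundle ℂ V] [VectorBundle ℂ ℂ V]
  [IsHermitianBundle V] {α : X ≃ₜ X} {Y : Set X}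

theorem smul_mem_idealSubmodule {f : C(X, ℂ)} (hf : ∀ y ∈ Y, f y = 0) (ξ : Sections V) :
    pullback α 1 f • ξ ∈
      (correspondence V α).idealSubmodule (ContinuousMap.idealOfSet ℂ Yᶜ) := by
  have hfY : f ∈ ContinuousMap.idealOfSet ℂ Yᶜ :=
    ContinuousMap.mem_idealOfSet.2 fun x hx => hf x (by simpa using hx)
  rw [← correspondence_φ_apply]
  exact subset_closure (Submodule.subset_span ⟨f, hfY, ξ, rfl⟩)

theorem orbitBreaking_φ_apply (f : C(X, ℂ))
    (ξ : (correspondence V α).idealSubmodule (ContinuousMap.idealOfSet ℂ Yᶜ)) :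
    (orbitBreaking V α Y).φ f ξ = pullback α 1 f • ξ :=
  Subtype.ext (correspondence_φ_apply f ξ.1)

theorem isometry_orbitBreaking_φ (hYc : IsClosed Y) (hYd : Dense Yᶜ) :
    Isometry (orbitBreaking V α Y).φ := by
  refine isometry_φ (orbitBreaking V α Y) Subtype.val (fun _ => rfl)
    (fun f ξ => correspondence_φ_apply f ξ.1) (hYd.mono fun x hx => ?_)
  obtain ⟨f, hf0, hf1, -⟩ := exists_continuous_zero_one_of_isClosed hYc isClosed_singleton
    (Set.disjoint_singleton_right.2 hx)
  obtain ⟨ξ, hξ⟩ := exists_norm_apply_eq_one (V := V) (α.symm x)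
  refine ⟨⟨pullback α 1 (complexify f) • ξ,
    smul_mem_idealSubmodule (fun y hy => by simp [hf0 hy]) ξ⟩, ?_⟩
  change pullback α 1 (complexify f) (α.symm x) • ξ (α.symm x) ≠ 0
  rw [pullback_apply, α.zpow_one_apply, α.apply_symm_apply, complexify_apply, hf1 rfl]
  intro h
  simp [show ξ (α.symm x) = 0 by simpa using h] at hξ

theorem orbitBreaking_φ_eq_rankOne
    (ξ η : (correspondence V α).idealSubmodule (ContinuousMap.idealOfSet ℂ Yᶜ)) :
    (orbitBreaking V α Y).φ (pullback α (-1) (inner C(X, ℂ) (η : Sections V) (ξ : Sections V))) =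
      rankOne C(X, ℂ) ξ η := by
  ext1 ζ
  exact Subtype.ext (congrArg (fun T : Sections V →L[ℂ] Sections V => T ζ)
    (φ_eq_rankOne (α := α) (ξ : Sections V) η))

/-- The restriction of a representation of `Γ(V, α)` to the orbit-breaking subcorrespondence. -/
noncomputable def CStarCorrespondence.Representation.orbitBreaking {B : Type w}
    [NonUnitalCStarAlgebra B] (Y : Set X) (ρ : (correspondence V α).Representation B) :
    (_root_.orbitBreaking V α Y).Representation B where
  pi := ρ.pi
  tau :=
    { toFun := fun ξ => ρ.tau ξ
      map_add' := fun ξ η => map_add ρ.tau (ξ : Sections V) η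
      map_smul' := fun z ξ => map_smul ρ.tau z (ξ : Sections V) }
  pi_inner ξ η := ρ.pi_inner (ξ : Sections V) η
  pi_mul_tau a ξ := ρ.pi_mul_tau a (ξ : Sections V)

theorem CStarCorrespondence.Representation.IsCovariant.orbitBreaking {B : Type w}
    [NonUnitalCStarAlgebra B] (hYc : IsClosed Y) (hYd : Dense Yᶜ)
    {ρ : (correspondence V α).Representation B} (hρ : ρ.IsCovariant) :
    (ρ.orbitBreaking Y).IsCovariant :=
  Representation.isCovariant_of_rankOne _ (isometry_orbitBreaking_φ hYc hYd) fun ξ η =>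
    ⟨_, orbitBreaking_φ_eq_rankOne ξ η,
      hρ.tau_mul_star_tau isometry_correspondence_φ.injective (φ_eq_rankOne ξ.1 η.1)⟩

/-- The homomorphism `𝒪(C₀(X ∖ Y) Γ(V, α)) → 𝒪(Γ(V, α))` induced by the inclusion. It exists
because covariant representations of `Γ(V, α)` restrict to covariant representations. -/
noncomputable def orbitBreakingInclusion (V : X → Type v) [∀ x, NormedAddCommGroup (V x)]
    [∀ x, InnerProductSpace ℂ (V x)] [TopologicalSpace (Bundle.TotalSpace ℂ V)] [FiberBundle ℂ V]
    [VectorBundle ℂ ℂ V] [IsHermitianBundle V] (α : X ≃ₜ X)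
    (hYc : IsClosed Y) (hYd : Dense Yᶜ) :
    (orbitBreaking V α Y).CuntzPimsner →⋆ₐ[ℂ] (correspondence V α).CuntzPimsner :=
  CuntzPimsner.map (Φ := orbitBreaking V α Y) (Φ' := correspondence V α)
    (productMap fun i => productEval (Φ := orbitBreaking V α Y)
      ⟨i.B, i.ρ.orbitBreaking Y, i.covariant.orbitBreaking hYc hYd⟩)
    (fun _ => rfl) fun ξ => CuntzPimsner.tau_mem (correspondence V α) ξ

variable (hYc : IsClosed Y) (hYd : Dense Yᶜ)

theorem orbitBreakingInclusion_pi (f : C(X, ℂ)) :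
    orbitBreakingInclusion V α hYc hYd (CuntzPimsner.pi (orbitBreaking V α Y) f) =
      CuntzPimsner.pi (correspondence V α) f := rfl

theorem orbitBreakingInclusion_tau
    (ξ : (correspondence V α).idealSubmodule (ContinuousMap.idealOfSet ℂ Yᶜ)) :
    orbitBreakingInclusion V α hYc hYd (CuntzPimsner.tau (orbitBreaking V α Y) ξ) =
      CuntzPimsner.tau (correspondence V α) ξ := rfl

theorem orbitBreakingInclusion_gauge (z : Circle) (a : (orbitBreaking V α Y).CuntzPimsner) :
    orbitBreakingInclusion V α hYc hYd (CuntzPimsner.gauge z a) =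
      CuntzPimsner.gauge z (orbitBreakingInclusion V α hYc hYd a) := by
  have : (orbitBreakingInclusion V α hYc hYd).comp (CuntzPimsner.gauge z) =
      (CuntzPimsner.gauge z).comp (orbitBreakingInclusion V α hYc hYd) :=
    CuntzPimsner.hom_ext (fun f => rfl) fun ξ => rfl
  exact congrArg (fun f : (orbitBreaking V α Y).CuntzPimsner →⋆ₐ[ℂ]
    (correspondence V α).CuntzPimsner => f a) this

theorem orbitBreaking_pi_injective [Nonempty X] (hYc : IsClosed Y) (hYd : Dense Yᶜ)
    (hα : IsMinimalHomeomorph α) :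
    Function.Injective (CuntzPimsner.pi (orbitBreaking V α Y)) := by
  intro f g hfg
  refine pi_injective (V := V) hα ?_
  rw [← orbitBreakingInclusion_pi hYc hYd f, hfg, orbitBreakingInclusion_pi]

theorem isCircleGraded_orbitBreaking [Nonempty X] (hYc : IsClosed Y) (hYd : Dense Yᶜ)
    (hα : IsMinimalHomeomorph α) :
    IsCircleGraded α (CuntzPimsner.pi (orbitBreaking V α Y))
      (CuntzPimsner.tau (orbitBreaking V α Y)) CuntzPimsner.gauge :=
  CStarCorrespondence.isCircleGraded orbitBreaking_φ_apply
    (isometry_orbitBreaking_φ hYc hYd).injective (fun ξ η => ⟨_, orbitBreaking_φ_eq_rankOne ξ η⟩)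
    (orbitBreaking_pi_injective hYc hYd hα)

/-- The kernel of a gauge equivariant homomorphism that is injective on `C(X)` is trivial, because
the expectation of `a⋆ a` lies in the kernel along with `a`. -/
theorem orbitBreakingInclusion_injective [Nonempty X] (hα : IsMinimalHomeomorph α) :
    Function.Injective (orbitBreakingInclusion V α hYc hYd) := by
  let : PartialOrder (orbitBreaking V α Y).CuntzPimsner := CStarAlgebra.spectralOrder _
  have : StarOrderedRing (orbitBreaking V α Y).CuntzPimsner :=
    CStarAlgebra.spectralOrderedRing _
  set ι := orbitBreakingInclusion V α hYc hYd with hι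
  have hG := isCircleGraded_orbitBreaking (V := V) hYc hYd hα
  refine (injective_iff_map_eq_zero ι).2 fun a ha => ?_
  rw [← CStarRing.star_mul_self_eq_zero_iff]
  refine hG.eq_zero_of_expectation_eq_zero (star_mul_self_nonneg a) ?_
  obtain ⟨f, hf⟩ := hG.expectation_mem_range (star a * a)
  have hιc : Continuous ι := LipschitzWith.continuous (K := 1)
    (LipschitzWith.of_dist_le_mul fun a b => by
      rw [dist_eq_norm, dist_eq_norm, ← map_sub, NNReal.coe_one, one_mul]
      exact NonUnitalStarAlgHom.norm_apply_le ι _)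
  set ιL : (orbitBreaking V α Y).CuntzPimsner →L[ℂ] (correspondence V α).CuntzPimsner :=
    ⟨(ι : (orbitBreaking V α Y).CuntzPimsner →ₗ[ℂ] (correspondence V α).CuntzPimsner), hιc⟩
  have h1 : ι (IsCircleGraded.expectation CuntzPimsner.gauge (star a * a)) = 0 := by
    have h2 := ιL.integral_comp_comm (hG.integrable_gauge (star a * a))
    change _ = ι _ at h2
    rw [IsCircleGraded.expectation, ← h2]
    have h3 : ∀ t : UnitAddCircle, ιL (CuntzPimsner.gauge t.toCircle (star a * a)) = 0 := by
      intro t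
      change ι _ = 0
      rw [hι, orbitBreakingInclusion_gauge, ← hι, map_mul ι, ha, mul_zero, map_zero]
    simp_rw [h3, MeasureTheory.integral_zero]
  rw [← hf, hι, orbitBreakingInclusion_pi] at h1
  rw [← hf, pi_injective hα (h1.trans (map_zero _).symm), map_zero]

end OrbitBreaking

end

/-! ### Elements that are moved into a subalgebra by cutting down -/

section CutDown

variable {X : Type u} [TopologicalSpace X] [CompactSpace X] [T2Space X] {α : X ≃ₜ X}
variable {D : Type v} [CStarAlgebra D] {F : Type w} [AddCommGroup F] [Module ℂ F]
variable {π : C(X, ℂ) →⋆ₐ[ℂ] D} {τ : F →ₗ[ℂ] D} {γ : Circle → D →⋆ₐ[ℂ] D}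

theorem pullback_complexify (n : ℤ) (f : C(X, ℝ)) :
    pullback α n (complexify f) = complexify (f.comp ((α ^ n : X ≃ₜ X) : C(X, X))) := rfl

theorem isSelfAdjoint_map_complexify (f : C(X, ℝ)) : IsSelfAdjoint (π (complexify f)) :=
  (isSelfAdjoint_complexify f).map π

/-- The pointwise square root of a real function. -/
noncomputable def sqrtMap (f : C(X, ℝ)) : C(X, ℝ) := ⟨fun x => √(f x), by fun_prop⟩

theorem sqrtMap_mul_self {f : C(X, ℝ)} (hf : ∀ x, 0 ≤ f x) : sqrtMap f * sqrtMap f = f := by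
  ext x
  exact Real.mul_self_sqrt (hf x)

/-- A word of length `n` is moved into `B` by nonnegative functions that vanish on the first `n`
translates of `Y`, as such a function can be distributed over the letters of the word. -/
theorem IsCircleGraded.pi_mul_mem_of_mem_words (h : IsCircleGraded α π τ γ)
    {B : StarSubalgebra ℂ D} {Y : Set X} (hπ : ∀ f, π f ∈ B)
    (hτ : ∀ f : C(X, ℂ), (∀ y ∈ Y, f y = 0) → ∀ ξ, π f * τ ξ ∈ B) (n : ℕ) :
    ∀ a ∈ words π τ n, ∀ f : C(X, ℝ), (∀ x, 0 ≤ f x) →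
      (∀ i : ℤ, 0 ≤ i → i < n → ∀ y ∈ Y, f ((α ^ i) y) = 0) → π (complexify f) * a ∈ B := by
  induction n with
  | zero =>
    rintro _ ⟨f', rfl⟩ f - -
    exact mul_mem (hπ _) (hπ _)
  | succ n ih =>
    intro a ha
    refine words_succ_induction (p := fun a => ∀ f : C(X, ℝ), (∀ x, 0 ≤ f x) →
      (∀ i : ℤ, 0 ≤ i → i < (n + 1 : ℕ) → ∀ y ∈ Y, f ((α ^ i) y) = 0) →
      π (complexify f) * a ∈ B) ?_ ?_ ha
    · intro a b ha hb f hf hfY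
      rw [mul_add]
      exact add_mem (ha f hf hfY) (hb f hf hfY)
    · intro ξ a ha f hf hfY
      have h1 : π (complexify f) * (τ ξ * a) = (π (complexify (sqrtMap f)) * τ ξ) *
          (π (complexify ((sqrtMap f).comp ((α ^ (1 : ℤ) : X ≃ₜ X) : C(X, X)))) * a) := by
        nth_rw 1 [← sqrtMap_mul_self hf]
        rw [← pullback_complexify, mul_assoc _ (τ ξ), ← mul_assoc (τ ξ), ← h.pi_mul_tau,
          complexify_mul, map_mul]
        simp only [mul_assoc]
      rw [h1]
      refine mul_mem (hτ _ (fun y hy => ?_) ξ) (ih a ha _ (fun x => Real.sqrt_nonneg _) ?_)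
      · have := hfY 0 le_rfl (by positivity) y hy
        rw [α.zpow_zero_apply] at this
        simp [sqrtMap, this]
      · intro i hi hin y hy
        change √(f ((α ^ (1 : ℤ)) ((α ^ i) y))) = 0
        rw [← α.zpow_add_apply, hfY (1 + i) (by omega) (by push_cast; omega) y hy,
          Real.sqrt_zero]

/-- The elements that are moved into `B` by the nonnegative functions vanishing on sufficiently
many translates of `Y` include a dense subspace. -/
theorem IsCircleGraded.exists_forall_pi_mul_mem (h : IsCircleGraded α π τ γ)
    {B : StarSubalgebra ℂ D} {Y : Set X} (hπ : ∀ f, π f ∈ B)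
    (hτ : ∀ f : C(X, ℂ), (∀ y ∈ Y, f y = 0) → ∀ ξ, π f * τ ξ ∈ B) {a : D}
    (ha : a ∈ wordSpan π τ) : ∃ N : ℕ, ∀ f : C(X, ℝ), (∀ x, 0 ≤ f x) →
      (∀ i : ℤ, |i| ≤ N → ∀ y ∈ Y, f ((α ^ i) y) = 0) → π (complexify f) * a ∈ B := by
  induction ha using Submodule.span_induction with
  | zero => exact ⟨0, fun f _ _ => by rw [mul_zero]; exact zero_mem B⟩
  | add a b _ _ ha hb =>
    obtain ⟨N, hN⟩ := ha
    obtain ⟨M, hM⟩ := hb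
    refine ⟨N + M, fun f hf hfY => ?_⟩
    rw [mul_add]
    exact add_mem (hN f hf fun i hi => hfY i (by push_cast; omega))
      (hM f hf fun i hi => hfY i (by push_cast; omega))
  | smul c a _ ha =>
    obtain ⟨N, hN⟩ := ha
    refine ⟨N, fun f hf hfY => ?_⟩
    rw [mul_smul_comm]
    exact B.smul_mem (hN f hf hfY) c
  | mem a ha =>
    obtain ⟨n, ha | ha⟩ := ha
    · exact ⟨n, fun f hf hfY => h.pi_mul_mem_of_mem_words hπ hτ n a ha f hf fun i hi hin =>
        hfY i (by rw [abs_of_nonneg hi]; omega)⟩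
    · refine ⟨n, fun f hf hfY => ?_⟩
      have h1 := star_mem_homogeneous (h.words_le_homogeneous n ha)
      rw [star_star] at h1
      have h2 := h.pi_mul_mem_of_mem_words hπ hτ n _ ha
        (f.comp ((α ^ (-n : ℤ) : X ≃ₜ X) : C(X, X))) (fun x => hf _) (fun i hi hin y hy => by
          change f ((α ^ (-n : ℤ)) ((α ^ i) y)) = 0
          rw [← α.zpow_add_apply]
          exact hfY _ (by rw [abs_le]; omega) y hy)
      have h3 := star_mem h2
      rw [star_mul, star_star, (isSelfAdjoint_map_complexify _).star_eq,
        ← pullback_complexify] at h3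
      rwa [h1.2]

/-! ### Transport along orbits -/

/-- A sum of elements `t i` of degrees `d i` whose range projections are orthogonal conjugates a
function `f` to the sum of the functions `c i ^ 2 * (f ∘ α ^ d i)`. -/
theorem star_sum_mul_mul_sum {I : Type*} (s : Finset I) (t : I → D) (d : I → ℤ)
    (c e : I → C(X, ℝ))
    (hcomm : ∀ i ∈ s, ∀ f, π f * t i = t i * π (pullback α (d i) f))
    (hstar : ∀ i ∈ s, star (t i) * t i = π (complexify (c i * c i)))
    (hce : ∀ i ∈ s, complexify (c i) * pullback α (d i) (complexify (e i)) = complexify (c i))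
    (hee : ∀ i ∈ s, ∀ j ∈ s, i ≠ j → e i * e j = 0) (f : C(X, ℂ)) :
    star (∑ i ∈ s, t i) * π f * ∑ i ∈ s, t i =
      π (∑ i ∈ s, complexify (c i * c i) * pullback α (d i) f) := by
  have he : ∀ i ∈ s, π (complexify (e i)) * t i = t i := by
    intro i hi
    rw [hcomm i hi, ← sub_eq_zero, ← CStarRing.star_mul_self_eq_zero_iff]
    have h1 : t i * π (pullback α (d i) (complexify (e i))) - t i =
        t i * π (pullback α (d i) (complexify (e i)) - 1) := by
      rw [map_sub, mul_sub, map_one, mul_one]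
    rw [h1, star_mul, mul_assoc, ← mul_assoc (star (t i)), hstar i hi, ← map_mul, complexify_mul,
      mul_assoc, mul_sub, hce i hi, mul_one, sub_self, mul_zero, map_zero, mul_zero]
  have hcross : ∀ i ∈ s, ∀ j ∈ s, i ≠ j → star (t i) * π f * t j = 0 := by
    intro i hi j hj hij
    rw [← he i hi, ← he j hj, star_mul, (isSelfAdjoint_map_complexify _).star_eq]
    have h1 : star (t i) * π (complexify (e i)) * π f * (π (complexify (e j)) * t j) =
        star (t i) * π (complexify (e i * e j) * f) * t j := by
      rw [complexify_mul, mul_right_comm (complexify (e i)), map_mul, map_mul]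
      simp only [mul_assoc]
    have h0 : complexify (0 : C(X, ℝ)) = 0 := by ext x; simp
    rw [h1, hee i hi j hj hij, h0, zero_mul, map_zero, mul_zero, zero_mul]
  rw [star_sum, Finset.sum_mul, Finset.sum_mul_sum, map_sum]
  refine Finset.sum_congr rfl fun i hi => ?_
  rw [Finset.sum_eq_single_of_mem i hi fun j hj hji => hcross i hi j hj hji.symm, mul_assoc,
    hcomm i hi, ← mul_assoc, hstar i hi, map_mul]

/-- Left multiplication by a partial isometry over the place `α ^ m '' K` to which `t` moves
functions supported in `α ^ n '' K` does not change `t⋆ t`. -/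
theorem star_mul_self_step {m n : ℤ} {c : C(X, ℂ)} {q : C(X, ℂ)} {v t : D}
    (ht : ∀ f, π f * t = t * π (pullback α (m - n) f)) (htt : star t * t = π c)
    (hvv : star v * v = π q) {K : Set X} (hq : ∀ x ∈ K, q ((α ^ m) x) = 1)
    (hc : ∀ x, c x ≠ 0 → (α ^ (-n)) x ∈ K) : star (v * t) * (v * t) = π c := by
  rw [star_mul, mul_assoc, ← mul_assoc (star v), hvv, ht, ← mul_assoc, htt, ← map_mul]
  congr 1
  ext x
  rw [ContinuousMap.mul_apply, pullback_apply]
  by_cases hx : c x = 0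
  · rw [hx, zero_mul]
  · rw [sub_eq_add_neg, α.zpow_add_apply, hq _ (hc x hx), mul_one]

/-- Elements of `B` of degree one that are unitary over all translates `α ^ m '' K` of `K` with
`|m| ≤ R`, except for the step out of `α ^ (-1) '' K`. -/
def HasLocalUnitaries (α : X ≃ₜ X) (π : C(X, ℂ) →⋆ₐ[ℂ] D) (B : StarSubalgebra ℂ D) (K : Set X)
    (R : ℕ) : Prop :=
  ∀ m : ℤ, m ≠ -1 → |m| ≤ R → ∃ u ∈ B, (∀ f, π f * u = u * π (pullback α 1 f)) ∧
    ∃ q q' : C(X, ℂ), star u * u = π q ∧ u * star u = π q' ∧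
      ∀ x ∈ K, q ((α ^ m) x) = 1 ∧ q' ((α ^ (m + 1)) x) = 1

/-- An element of `B` that moves functions near `α ^ n '' K` forward along orbits; for `n ≥ 0` the
missing local unitary at `-1` is not needed. -/
theorem HasLocalUnitaries.exists_transport_up {B : StarSubalgebra ℂ D} (hπ : ∀ f, π f ∈ B)
    {K : Set X} {R : ℕ} (hu : HasLocalUnitaries α π B K R) {n : ℤ} (hn : 0 ≤ n) {c : C(X, ℝ)}
    (hc : ∀ x, c x ≠ 0 → (α ^ (-n)) x ∈ K) (l : ℕ) (hl : n + l ≤ R) :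
    ∃ t ∈ B, (∀ f, π f * t = t * π (pullback α (n + l - n) f)) ∧
      star t * t = π (complexify (c * c)) := by
  have hcc : ∀ x, complexify (c * c) x ≠ 0 → (α ^ (-n)) x ∈ K := fun x hx =>
    hc x fun h0 => hx (by simp [h0])
  induction l with
  | zero =>
    refine ⟨π (complexify c), hπ _, fun f => ?_, ?_⟩
    · simp [← map_mul, mul_comm]
    · rw [(isSelfAdjoint_map_complexify c).star_eq, ← map_mul, complexify_mul]
  | succ l ih =>
    obtain ⟨t, htB, ht, htt⟩ := ih (by push_cast at hl; omega)
    obtain ⟨u, huB, huc, q, _, hq, _, hK⟩ := hu (n + l) (by omega)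
      (by rw [abs_of_nonneg (by omega)]; push_cast at hl; omega)
    refine ⟨u * t, mul_mem huB htB, fun f => ?_,
      star_mul_self_step ht htt hq (fun x hx => (hK x hx).1) hcc⟩
    rw [← mul_assoc, huc, mul_assoc, ht, pullback_pullback, mul_assoc,
      show n + ((l + 1 : ℕ) : ℤ) - n = 1 + (n + l - n) by push_cast; ring]

/-- For `n < 0`, functions near `α ^ n '' K` are moved backward, by adjoints of local unitaries. -/
theorem HasLocalUnitaries.exists_transport_down {B : StarSubalgebra ℂ D} (hπ : ∀ f, π f ∈ B)
    {K : Set X} {R : ℕ} (hu : HasLocalUnitaries α π B K R) {n : ℤ} (hn : n < 0) {c : C(X, ℝ)}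
    (hc : ∀ x, c x ≠ 0 → (α ^ (-n)) x ∈ K) (l : ℕ) (hl : -R ≤ n - l) :
    ∃ t ∈ B, (∀ f, π f * t = t * π (pullback α (n - l - n) f)) ∧
      star t * t = π (complexify (c * c)) := by
  have hcc : ∀ x, complexify (c * c) x ≠ 0 → (α ^ (-n)) x ∈ K := fun x hx =>
    hc x fun h0 => hx (by simp [h0])
  induction l with
  | zero =>
    refine ⟨π (complexify c), hπ _, fun f => ?_, ?_⟩
    · simp [← map_mul, mul_comm]
    · rw [(isSelfAdjoint_map_complexify c).star_eq, ← map_mul, complexify_mul]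
  | succ l ih =>
    obtain ⟨t, htB, ht, htt⟩ := ih (by push_cast at hl; omega)
    obtain ⟨u, huB, huc, _, q, _, hq, hK⟩ := hu (n - l - 1) (by omega)
      (by rw [abs_of_nonpos (by omega)]; push_cast at hl; omega)
    refine ⟨star u * t, mul_mem (star_mem huB) htB, fun f => ?_,
      star_mul_self_step (q := q) ht htt (by rwa [star_star]) (fun x hx => ?_) hcc⟩
    · have h2 := congrArg star (huc (pullback α (-1) (star f)))
      rw [pullback_pullback, neg_add_cancel, pullback_zero, star_mul, star_mul, ← map_star,
        ← map_star, ← map_star, star_star] at h2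
      rw [← mul_assoc, ← h2, mul_assoc, ht, pullback_pullback, mul_assoc,
        show n - ((l + 1 : ℕ) : ℤ) - n = -1 + (n - l - n) by push_cast; ring]
    · have := (hK x hx).2
      rwa [sub_add_cancel] at this

end CutDown

/-! ### Comparison by transport along orbits -/

section CutDown

variable {X : Type u} [TopologicalSpace X] [CompactSpace X] [T2Space X] {α : X ≃ₜ X}
variable {D : Type v} [CStarAlgebra D] {F : Type w} [AddCommGroup F] [Module ℂ F]
variable {π : C(X, ℂ) →⋆ₐ[ℂ] D} {τ : F →ₗ[ℂ] D} {γ : Circle → D →⋆ₐ[ℂ] D}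

/-- The time before the block of `L` consecutive times that receives the `n`-th translate. These
blocks are disjoint, and they are reached from `n` without crossing the step from `-1` to `0`. -/
def blockStart (M L : ℕ) (n : ℤ) : ℤ := if 0 ≤ n then M + n * L else (n - 1) * L - M - 1

theorem blockStart_add_injective {M L : ℕ} {n n' : ℤ} {j j' : ℕ} (hj : j ∈ Finset.Icc 1 L)
    (hj' : j' ∈ Finset.Icc 1 L) (h : blockStart M L n + j = blockStart M L n' + j') :
    n = n' ∧ j = j' := by
  rw [Finset.mem_Icc] at hj hj'
  have hn : n = n' := by
    unfold blockStart at h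
    by_contra hne
    rcases lt_or_gt_of_ne hne with hlt | hlt
    · have h1 : (1 : ℤ) * L ≤ (n' - n) * L := by gcongr; omega
      split_ifs at h
      · linarith [(by omega : (j : ℤ) < j' + L)]
      · omega
      · have h2 : (0 : ℤ) ≤ n' * L := by positivity
        have h3 : (n - 1) * L ≤ (-2 : ℤ) * L := by gcongr; omega
        omega
      · linarith [(by omega : (j : ℤ) < j' + L)]
    · have h1 : (1 : ℤ) * L ≤ (n - n') * L := by gcongr; omega
      split_ifs at h
      · linarith [(by omega : (j' : ℤ) < j + L)]
      · have h2 : (0 : ℤ) ≤ n * L := by positivity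
        have h3 : (n' - 1) * L ≤ (-2 : ℤ) * L := by gcongr; omega
        omega
      · omega
      · linarith [(by omega : (j' : ℤ) < j + L)]
  subst hn
  exact ⟨rfl, by omega⟩

theorem blockStart_add_bounds {M L : ℕ} {n : ℤ} {j : ℕ} (hn : |n| ≤ M) (hj : j ∈ Finset.Icc 1 L) :
    |blockStart M L n + j| ≤ (M + (M + 1) * L : ℕ) ∧ (0 ≤ n → n ≤ blockStart M L n + j) ∧
      (n < 0 → blockStart M L n + j ≤ n) := by
  rw [Finset.mem_Icc] at hj
  rw [abs_le] at hn
  have hL : (0 : ℤ) ≤ L := by positivity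
  unfold blockStart
  push_cast
  split_ifs with h0
  · have h1 : n * L ≤ M * L := by gcongr; exact hn.2
    have h2 : 0 ≤ n * L := by positivity
    refine ⟨?_, fun _ => by linarith, fun h => by omega⟩
    rw [abs_le]
    constructor <;> nlinarith
  · have h1 : (-M : ℤ) * L ≤ n * L := by gcongr; exact hn.1
    have h2 : n * L ≤ (-1 : ℤ) * L := by gcongr; omega
    refine ⟨?_, fun h => by omega, fun _ => by nlinarith⟩
    rw [abs_le]
    constructor <;> nlinarith

/-- The translate `f ∘ α ^ (-n)`. -/
noncomputable def orbitTranslate (α : X ≃ₜ X) (n : ℤ) (f : C(X, ℝ)) : C(X, ℝ) :=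
  f.comp ((α ^ (-n) : X ≃ₜ X) : C(X, X))

/-- Each of the translates `g₀ ∘ α ^ (-n)` is spread over `L` translates, to times at which an
orbit meets the support of `p`; as all the pieces are moved to disjoint places, a single element of
`B` conjugates `p ^ 2` to a given combination of the translates. -/
theorem HasLocalUnitaries.exists_conjugate {B : StarSubalgebra ℂ D} (hπ : ∀ f, π f ∈ B)
    {K : Set X} {M L : ℕ} (hu : HasLocalUnitaries α π B K (M + (M + 1) * L))
    {b g₀ p : C(X, ℝ)} (hb : ∀ x ∈ K, b x = 1)
    (hbd : ∀ n : ℤ, n ≠ 0 → |n| ≤ (2 * (M + (M + 1) * L) : ℕ) → ∀ x, b x * b ((α ^ n) x) = 0)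
    (hg₀ : ∀ x, 0 ≤ g₀ x) (hg₀K : ∀ x, g₀ x ≠ 0 → x ∈ K) {lam : ℤ → ℝ} (hlam : ∀ n, 0 ≤ lam n)
    (hp : ∀ x, ∃ n ∈ Finset.Icc 1 L, p ((α ^ (n : ℤ)) x) ≠ 0) :
    ∃ z ∈ B, star z * π (complexify (p * p)) * z =
      π (complexify (∑ n ∈ Finset.Icc (-M : ℤ) M, lam n • orbitTranslate α n g₀)) := by
  have hS : ∀ (n : ℤ) (w : X),
      0 < ∑ j ∈ Finset.Icc 1 L, p ((α ^ (blockStart M L n + j)) w) ^ 2 := by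
    intro n w
    obtain ⟨j, hj, hpj⟩ := hp ((α ^ (blockStart M L n)) w)
    rw [← α.zpow_add_apply, add_comm] at hpj
    exact Finset.sum_pos' (fun _ _ => sq_nonneg _) ⟨j, hj, by positivity⟩
  -- dividing by the sum over a block makes the squares of the pieces add up to `lam n * g₀`
  set c : ℤ × ℕ → C(X, ℝ) := fun i => orbitTranslate α i.1
    ⟨fun w => √(lam i.1 * g₀ w / ∑ j ∈ Finset.Icc 1 L, p ((α ^ (blockStart M L i.1 + j)) w) ^ 2), by
      refine ((continuous_const.mul g₀.continuous).div ?_ fun w => (hS i.1 w).ne').sqrt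
      exact continuous_finsetSum _ fun j _ =>
        (p.continuous.comp (α ^ _ : X ≃ₜ X).continuous).pow 2⟩ with hc
  set s : Finset (ℤ × ℕ) := Finset.Icc (-M : ℤ) M ×ˢ Finset.Icc 1 L with hs
  set k : ℤ × ℕ → ℤ := fun i => blockStart M L i.1 + i.2 with hk
  have hcK : ∀ i, ∀ x, c i x ≠ 0 → (α ^ (-i.1)) x ∈ K := by
    intro i x hx
    refine hg₀K _ fun h0 => hx ?_
    change √(lam i.1 * g₀ ((α ^ (-i.1)) x) / _) = 0
    rw [h0, mul_zero, zero_div, Real.sqrt_zero]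
  have ht : ∀ i ∈ s, ∃ t ∈ B, (∀ f, π f * t = t * π (pullback α (k i - i.1) f)) ∧
      star t * t = π (complexify (c i * c i)) := by
    rintro ⟨n, j⟩ hi
    obtain ⟨hn, hj⟩ := Finset.mem_product.1 hi
    obtain ⟨h1, h2, h3⟩ := blockStart_add_bounds (abs_le.2 (Finset.mem_Icc.1 hn)) hj
    rw [abs_le] at h1
    rcases le_or_gt 0 n with h0 | h0
    · have h4 := h2 h0
      have h5 := hu.exists_transport_up hπ h0 (hcK (n, j)) (k (n, j) - n).toNat
        (by rw [Int.toNat_of_nonneg (by simpa [hk] using h4)]; simpa [hk] using h1.2)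
      rwa [Int.toNat_of_nonneg (by simpa [hk] using h4), add_sub_cancel] at h5
    · have h4 := h3 h0
      have h5 := hu.exists_transport_down hπ h0 (hcK (n, j)) (n - k (n, j)).toNat
        (by rw [Int.toNat_of_nonneg (by simpa [hk] using h4), sub_sub_cancel]; exact h1.1)
      rwa [Int.toNat_of_nonneg (by simpa [hk] using h4), sub_sub_cancel] at h5
  choose! t htB htc hts using ht
  refine ⟨∑ i ∈ s, t i, sum_mem htB, ?_⟩
  rw [star_sum_mul_mul_sum s t (fun i => k i - i.1) c (fun i => orbitTranslate α (k i) b) htc hts]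
  · congr 1
    ext x
    have hlhs : (∑ i ∈ s, complexify (c i * c i) * pullback α (k i - i.1)
        (complexify (p * p))) x =
        ((∑ i ∈ s, c i x ^ 2 * p ((α ^ (k i - i.1)) x) ^ 2 : ℝ) : ℂ) := by
      simp [ContinuousMap.sum_apply, pow_two]
    rw [hlhs, complexify_apply, ContinuousMap.sum_apply]
    congr 1
    rw [hs, Finset.sum_product]
    refine Finset.sum_congr rfl fun n hn => ?_
    set w := (α ^ (-n)) x with hw
    have h1 : ∀ j, c (n, j) x ^ 2 * p ((α ^ (k (n, j) - n)) x) ^ 2 = lam n * g₀ w /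
        (∑ j ∈ Finset.Icc 1 L, p ((α ^ (blockStart M L n + j)) w) ^ 2) *
          p ((α ^ (blockStart M L n + j)) w) ^ 2 := by
      intro j
      have h2 : c (n, j) x ^ 2 = lam n * g₀ w /
          (∑ j ∈ Finset.Icc 1 L, p ((α ^ (blockStart M L n + j)) w) ^ 2) :=
        Real.sq_sqrt (div_nonneg (mul_nonneg (hlam n) (hg₀ w)) (hS n w).le)
      rw [h2, sub_eq_add_neg, α.zpow_add_apply]
    rw [Finset.sum_congr rfl fun j _ => h1 j, ← Finset.mul_sum, div_mul_cancel₀ _ (hS n w).ne']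
    rfl
  · intro i _
    ext x
    change (c i x : ℂ) * (b ((α ^ (-k i)) ((α ^ (k i - i.1)) x)) : ℂ) = (c i x : ℂ)
    rw [← α.zpow_add_apply]
    by_cases hx : c i x = 0
    · simp [hx]
    · rw [show -k i + (k i - i.1) = -i.1 by ring, hb _ (hcK i x hx)]
      simp
  · rintro ⟨n, j⟩ hi ⟨n', j'⟩ hi' hne
    obtain ⟨hn, hj⟩ := Finset.mem_product.1 hi
    obtain ⟨hn', hj'⟩ := Finset.mem_product.1 hi'
    have h1 := (blockStart_add_bounds (abs_le.2 (Finset.mem_Icc.1 hn)) hj).1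
    have h1' := (blockStart_add_bounds (abs_le.2 (Finset.mem_Icc.1 hn')) hj').1
    have hkk : k (n, j) - k (n', j') ≠ 0 := fun h => hne <| by
      obtain ⟨rfl, rfl⟩ := blockStart_add_injective hj hj' (sub_eq_zero.1 h)
      rfl
    ext x
    have h2 := hbd (k (n, j) - k (n', j')) hkk (by
      refine (abs_sub _ _).trans ?_
      push_cast at h1 h1' ⊢
      linarith) ((α ^ (-k (n, j))) x)
    rw [← α.zpow_add_apply, show k (n, j) - k (n', j') + -k (n, j) = -k (n', j') by ring] at h2
    exact h2

end CutDown

/-! ### Cut-down functions -/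

section CutDown

variable {X : Type u} [TopologicalSpace X] [CompactSpace X] [T2Space X] {α : X ≃ₜ X}
variable {D : Type v} [CStarAlgebra D] {F : Type w} [AddCommGroup F] [Module ℂ F]
variable {π : C(X, ℂ) →⋆ₐ[ℂ] D} {τ : F →ₗ[ℂ] D} {γ : Circle → D →⋆ₐ[ℂ] D}

/-- The weight that is `1` for `|n| ≤ N`, vanishes for `|n| ≥ N + q + 1`, and has slope
`1 / (q + 1)` in between. -/
noncomputable def cutWeight (N q : ℕ) (n : ℤ) : ℝ :=
  max 0 (min 1 ((N + q + 1 - |(n : ℝ)|) / (q + 1)))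

theorem cutWeight_nonneg (N q : ℕ) (n : ℤ) : 0 ≤ cutWeight N q n := le_max_left _ _

theorem cutWeight_le_one (N q : ℕ) (n : ℤ) : cutWeight N q n ≤ 1 :=
  max_le zero_le_one (min_le_left _ _)

theorem cutWeight_eq_one {N q : ℕ} {n : ℤ} (hn : |n| ≤ N) : cutWeight N q n = 1 := by
  have h1 : |(n : ℝ)| ≤ N := by exact_mod_cast hn
  have h2 : 1 ≤ (N + q + 1 - |(n : ℝ)|) / (q + 1) := by
    rw [le_div_iff₀ (by positivity)]
    linarith
  rw [cutWeight, min_eq_left h2, max_eq_right zero_le_one]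

theorem cutWeight_eq_zero {N q : ℕ} {n : ℤ} (hn : ((N + q + 1 : ℕ) : ℤ) ≤ |n|) :
    cutWeight N q n = 0 := by
  have h1 : (N + q + 1 : ℝ) ≤ |(n : ℝ)| := by exact_mod_cast hn
  have h2 : (N + q + 1 - |(n : ℝ)|) / (q + 1) ≤ 0 :=
    div_nonpos_of_nonpos_of_nonneg (by linarith) (by positivity)
  exact max_eq_left ((min_le_right _ _).trans h2)

theorem abs_cutWeight_sub_le (N q : ℕ) (n : ℤ) :
    |cutWeight N q (n + 1) - cutWeight N q n| ≤ 1 / (q + 1) := by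
  have h1 : |max (0 : ℝ) (min 1 ((N + q + 1 - |((n + 1 : ℤ) : ℝ)|) / (q + 1))) -
      max 0 (min 1 ((N + q + 1 - |(n : ℝ)|) / (q + 1)))| ≤
      |(N + q + 1 - |((n + 1 : ℤ) : ℝ)|) / (q + 1) - (N + q + 1 - |(n : ℝ)|) / (q + 1)| := by
    simp only [max_comm (0 : ℝ), min_comm (1 : ℝ)]
    refine (abs_max_sub_max_le_abs _ _ _).trans ?_
    exact (abs_min_sub_min_le_max _ _ _ _).trans (by simp)
  refine h1.trans ?_
  rw [← sub_div, abs_div, abs_of_pos (by positivity : (0 : ℝ) < q + 1)]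
  gcongr
  rw [sub_sub_sub_cancel_left, abs_sub_comm]
  refine (abs_abs_sub_abs_le _ _).trans ?_
  push_cast
  simp

/-- The sum of the translates `g₀ ∘ α ^ (-n)` with the weights `cutWeight N q n`. -/
noncomputable def cutSum (α : X ≃ₜ X) (N q : ℕ) (g₀ : C(X, ℝ)) : C(X, ℝ) :=
  ∑ n ∈ Finset.Icc (-(N + q + 1 : ℕ) : ℤ) (N + q + 1 : ℕ), cutWeight N q n • orbitTranslate α n g₀

section CutSum

variable {N q : ℕ} {g₀ : C(X, ℝ)}

theorem cutSum_apply (x : X) : cutSum α N q g₀ x =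
    ∑ n ∈ Finset.Icc (-(N + q + 1 : ℕ) : ℤ) (N + q + 1 : ℕ),
      cutWeight N q n * g₀ ((α ^ (-n)) x) := by
  rw [cutSum, ContinuousMap.sum_apply]
  rfl

variable (hd : ∀ n : ℤ, n ≠ 0 → |n| ≤ (2 * (N + q + 2) : ℕ) → ∀ x, g₀ x * g₀ ((α ^ n) x) = 0)
include hd

/-- At most one of the translates is nonzero at a given point. -/
theorem cutSum_apply_zpow {x : X} (hx : g₀ x ≠ 0) {n : ℤ} (hn : |n| ≤ (N + q + 2 : ℕ)) :
    cutSum α N q g₀ ((α ^ n) x) = cutWeight N q n * g₀ x := by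
  rw [cutSum_apply]
  have h1 : ∀ m ∈ Finset.Icc (-(N + q + 1 : ℕ) : ℤ) (N + q + 1 : ℕ), m ≠ n →
      cutWeight N q m * g₀ ((α ^ (-m)) ((α ^ n) x)) = 0 := by
    intro m hm hmn
    rw [← α.zpow_add_apply]
    have h2 : |m| ≤ (N + q + 1 : ℕ) := abs_le.2 (Finset.mem_Icc.1 hm)
    have h3 := hd (-m + n) (by omega) (by rw [abs_le] at *; push_cast at *; omega) x
    rw [(mul_eq_zero.1 h3).resolve_left hx, mul_zero]
  by_cases hmem : n ∈ Finset.Icc (-(N + q + 1 : ℕ) : ℤ) (N + q + 1 : ℕ)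
  · rw [Finset.sum_eq_single_of_mem n hmem h1, α.zpow_neg_apply_zpow]
  · rw [Finset.sum_eq_zero fun m hm => h1 m hm (fun h => hmem (h ▸ hm)), cutWeight_eq_zero,
      zero_mul]
    by_contra! h
    exact hmem (Finset.mem_Icc.2 (abs_le.1 h.le))

/-- Every point lies on a translate of the support or, together with its image, on none. -/
theorem cutSum_cases (x : X) : (∃ (w : X) (n : ℤ), x = (α ^ n) w ∧ g₀ w ≠ 0 ∧
    cutSum α N q g₀ x = cutWeight N q n * g₀ w ∧
      cutSum α N q g₀ (α x) = cutWeight N q (n + 1) * g₀ w) ∨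
    (cutSum α N q g₀ x = 0 ∧ cutSum α N q g₀ (α x) = 0) := by
  by_cases h : ∃ n : ℤ, |n| ≤ (N + q + 2 : ℕ) ∧ |n + 1| ≤ (N + q + 2 : ℕ) ∧
    g₀ ((α ^ (-n)) x) ≠ 0
  · obtain ⟨n, hn, hn1, hx⟩ := h
    have h1 := cutSum_apply_zpow hd hx hn
    have h2 := cutSum_apply_zpow hd hx hn1
    rw [← α.zpow_add_apply, add_right_comm, add_neg_cancel, zero_add, α.zpow_one_apply] at h2
    rw [α.zpow_apply_zpow_neg] at h1
    exact Or.inl ⟨_, n, (α.zpow_apply_zpow_neg n x).symm, hx, h1, h2⟩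
  · push Not at h
    refine Or.inr ⟨?_, ?_⟩
    · rw [cutSum_apply]
      refine Finset.sum_eq_zero fun n hn => ?_
      rw [Finset.mem_Icc] at hn
      rw [h n (by rw [abs_le]; push_cast at *; omega) (by rw [abs_le]; push_cast at *; omega),
        mul_zero]
    · rw [cutSum_apply]
      refine Finset.sum_eq_zero fun n hn => ?_
      rw [Finset.mem_Icc] at hn
      have h1 := h (n - 1) (by rw [abs_le]; push_cast at *; omega)
        (by rw [abs_le]; push_cast at *; omega)
      rw [neg_sub, sub_eq_neg_add, α.zpow_add_apply, α.zpow_one_apply] at h1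
      rw [h1, mul_zero]

theorem cutSum_le_one (h1 : ∀ x, g₀ x ≤ 1) (h0 : ∀ x, 0 ≤ g₀ x) (x : X) :
    cutSum α N q g₀ x ≤ 1 := by
  obtain ⟨w, n, -, -, h, -⟩ | h := cutSum_cases hd x
  · rw [h]
    exact mul_le_one₀ (cutWeight_le_one N q n) (h0 w) (h1 w)
  · rw [h.1]
    exact zero_le_one

theorem abs_cutSum_sub_le (h1 : ∀ x, g₀ x ≤ 1) (h0 : ∀ x, 0 ≤ g₀ x) (x : X) :
    |cutSum α N q g₀ (α x) - cutSum α N q g₀ x| ≤ 1 / (q + 1) := by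
  obtain ⟨w, n, -, -, h, h'⟩ | h := cutSum_cases hd x
  · rw [h, h', ← sub_mul, abs_mul, abs_of_nonneg (h0 w)]
    exact (mul_le_of_le_one_right (abs_nonneg _) (h1 w)).trans (abs_cutWeight_sub_le N q n)
  · rw [h.1, h.2, sub_zero, abs_zero]
    positivity

end CutSum

theorem cutSum_nonneg {N q : ℕ} {g₀ : C(X, ℝ)} (h0 : ∀ x, 0 ≤ g₀ x) (x : X) :
    0 ≤ cutSum α N q g₀ x := by
  rw [cutSum_apply]
  exact Finset.sum_nonneg fun n _ => mul_nonneg (cutWeight_nonneg N q n) (h0 _)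

/-- The cut-down functions: they are `1` on the translates of `Y` up to time `N`, almost invariant
under `α`, and conjugates of every square `p ^ 2` whose support meets all orbits within time `L`. -/
theorem exists_cutdown_function {B : StarSubalgebra ℂ D} (hπ : ∀ f, π f ∈ B)
    {Y : Set X} (hYne : Y.Nonempty) (hYc : IsClosed Y) (hY : MeetsOrbitsAtMostOnce α Y)
    (hB : ∀ R : ℕ, ∃ W : Set X, IsOpen W ∧ Y ⊆ W ∧
      ∀ K ⊆ W, IsClosed K → HasLocalUnitaries α π B K R) (L N q : ℕ) :
    ∃ g : C(X, ℝ), (∀ x, 0 ≤ g x) ∧ (∀ x, g x ≤ 1) ∧ (∃ x, g x = 0) ∧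
      (∀ i : ℤ, |i| ≤ N → ∀ y ∈ Y, g ((α ^ i) y) = 1) ∧
      (∀ x, |g (α x) - g x| ≤ 1 / (q + 1)) ∧
      ∀ p : C(X, ℝ), (∀ x, ∃ n ∈ Finset.Icc 1 L, p ((α ^ (n : ℤ)) x) ≠ 0) →
        ∃ z ∈ B, star z * π (complexify (p * p)) * z = π (complexify g) := by
  set M := N + q + 1 with hM
  set R := M + (M + 1) * L with hR
  obtain ⟨W₁, hW₁, hYW₁, hd⟩ := hY.exists_isOpen hYc (2 * (R + M + 1))
  obtain ⟨W₂, hW₂, hYW₂, hu⟩ := hB R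
  obtain ⟨O, hO, hYO, hOW⟩ := normal_exists_closure_subset hYc (hW₁.inter hW₂)
    (Set.subset_inter hYW₁ hYW₂)
  obtain ⟨g₀, hg0, hg1, hg01⟩ := exists_continuous_zero_one_of_isClosed hO.isClosed_compl hYc
    (Set.disjoint_left.2 fun x hx hxY => hx (hYO hxY))
  obtain ⟨b, hb0, hb1, -⟩ := exists_continuous_zero_one_of_isClosed hW₁.isClosed_compl
    (isClosed_closure (s := O)) (Set.disjoint_left.2 fun x hx hxO => hx (hOW hxO).1)
  have hg₀K : ∀ x, g₀ x ≠ 0 → x ∈ closure O := fun x hx =>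
    subset_closure (by by_contra h; exact hx (hg0 h))
  have hdf : ∀ f : C(X, ℝ), (∀ x, f x ≠ 0 → x ∈ W₁) → ∀ n : ℤ, n ≠ 0 →
      |n| ≤ (2 * (R + M + 1) : ℕ) → ∀ x, f x * f ((α ^ n) x) = 0 := by
    intro f hf n hn hnR x
    by_contra hx
    exact hd n hn hnR x (hf x (left_ne_zero_of_mul hx)) (hf _ (right_ne_zero_of_mul hx))
  have hdg : ∀ n : ℤ, n ≠ 0 → |n| ≤ (2 * (N + q + 2) : ℕ) → ∀ x, g₀ x * g₀ ((α ^ n) x) = 0 :=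
    fun n hn hnR => hdf g₀ (fun x hx => (hOW (hg₀K x hx)).1) n hn
      (hnR.trans (by rw [hM]; push_cast; have : (0 : ℤ) ≤ R := by positivity
                     linarith))
  have h0 : ∀ x, 0 ≤ g₀ x := fun x => (hg01 x).1
  have h1 : ∀ x, g₀ x ≤ 1 := fun x => (hg01 x).2
  have hYg : ∀ y ∈ Y, g₀ y = 1 := fun y hy => hg1 hy
  refine ⟨cutSum α N q g₀, cutSum_nonneg h0, cutSum_le_one hdg h1 h0, ?_, fun i hi y hy => ?_,
    abs_cutSum_sub_le hdg h1 h0, fun p hp => ?_⟩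
  · -- the first translate of `Y` beyond the range of the weights
    obtain ⟨y, hy⟩ := hYne
    refine ⟨(α ^ ((N + q + 2 : ℕ) : ℤ)) y, ?_⟩
    rw [cutSum_apply_zpow hdg (by rw [hYg y hy]; exact one_ne_zero) (Nat.abs_cast _).le,
      cutWeight_eq_zero,
      zero_mul]
    rw [Nat.abs_cast]
    push_cast
    linarith
  · rw [cutSum_apply_zpow hdg (by rw [hYg y hy]; exact one_ne_zero)
      (hi.trans (by push_cast; linarith)), cutWeight_eq_one hi, hYg y hy, one_mul]
  · refine (hu (closure O) (fun x hx => (hOW hx).2) isClosed_closure).exists_conjugate hπ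
      (b := b) (fun x hx => hb1 hx)
      (fun n hn hnR => hdf b (fun x hx => by by_contra h; exact hx (hb0 h)) n hn
        (hnR.trans (by push_cast; have : (0 : ℤ) ≤ M := by positivity
                       linarith)))
      h0 hg₀K (cutWeight_nonneg N q) hp

/-- Functions that are asymptotically `α`-invariant are asymptotically central. -/
theorem IsCircleGraded.isAsymptoticallyCentral (h : IsCircleGraded α π τ γ) {g : ℕ → C(X, ℝ)}
    (hg0 : ∀ q x, 0 ≤ g q x) (hg1 : ∀ q x, g q x ≤ 1)
    (hg : ∀ q x, |g q (α x) - g q x| ≤ 1 / (q + 1)) :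
    IsAsymptoticallyCentral Filter.atTop fun q => π (complexify (g q)) := by
  have hnorm : ∀ q, ‖π (complexify (g q))‖ ≤ 1 := fun q =>
    (NonUnitalStarAlgHom.norm_apply_le π _).trans (norm_complexify_le zero_le_one fun x => by
      rw [abs_of_nonneg (hg0 q x)]; exact hg1 q x)
  have hadj : ∀ a ∈ StarAlgebra.adjoin ℂ (Set.range π ∪ Set.range τ),
      Filter.Tendsto (fun q => ‖π (complexify (g q)) * a - a * π (complexify (g q))‖)
        Filter.atTop (𝓝 0) := by
    intro a ha
    induction ha using StarAlgebra.adjoin_induction with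
    | mem a ha =>
      obtain ⟨f, rfl⟩ | ⟨ξ, rfl⟩ := ha
      · simp [← map_mul, mul_comm f]
      · refine squeeze_zero (fun _ => norm_nonneg _) (fun q => ?_)
          ((mul_zero ‖τ ξ‖) ▸ tendsto_one_div_add_atTop_nhds_zero_nat.const_mul ‖τ ξ‖)
        rw [h.pi_mul_tau, ← mul_sub, ← map_sub, pullback_complexify, ← complexify_sub]
        refine (norm_mul_le _ _).trans ?_
        gcongr
        refine (NonUnitalStarAlgHom.norm_apply_le π _).trans
          (norm_complexify_le (by positivity) fun x => ?_)
        change |g q ((α ^ (1 : ℤ)) x) - g q x| ≤ _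
        rw [α.zpow_one_apply]
        exact hg q x
    | algebraMap c => simp [Algebra.commutes c]
    | add a b _ _ ha hb =>
      refine squeeze_zero (fun _ => norm_nonneg _) (fun q => ?_) ((add_zero (0 : ℝ)) ▸ ha.add hb)
      refine le_trans (le_of_eq ?_) (norm_add_le _ _)
      congr 1
      noncomm_ring
    | mul a b _ _ ha hb =>
      refine squeeze_zero (fun _ => norm_nonneg _) (fun q => ?_)
        ((by simp : 0 * ‖b‖ + ‖a‖ * 0 = 0) ▸ (ha.mul_const ‖b‖).add (hb.const_mul ‖a‖))
      refine le_trans (le_of_eq ?_)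
        ((norm_add_le _ _).trans (add_le_add (norm_mul_le _ b) (norm_mul_le a _)))
      congr 1
      noncomm_ring
    | star a _ ha =>
      refine ha.congr fun q => ?_
      rw [← norm_star, star_sub, star_mul, star_mul, (isSelfAdjoint_map_complexify _).star_eq,
        norm_sub_rev]
  intro a
  refine Metric.tendsto_atTop.2 fun ε hε => ?_
  obtain ⟨a', ha', haa'⟩ := h.dense.exists_dist_lt a (by positivity : 0 < ε / 4)
  obtain ⟨n₀, hn₀⟩ := Metric.tendsto_atTop.1 (hadj a' ha') (ε / 2) (by positivity)
  refine ⟨n₀, fun q hq => ?_⟩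
  have h1 := hn₀ q hq
  rw [dist_eq_norm] at haa'
  rw [dist_zero_right, norm_norm] at h1 ⊢
  set e := π (complexify (g q))
  calc ‖e * a - a * e‖ = ‖(e * a' - a' * e) + (e * (a - a') - (a - a') * e)‖ := by
        congr 1; noncomm_ring
    _ ≤ ‖e * a' - a' * e‖ + (‖e‖ * ‖a - a'‖ + ‖a - a'‖ * ‖e‖) :=
        (norm_add_le _ _).trans (add_le_add le_rfl ((norm_sub_le _ _).trans
          (add_le_add (norm_mul_le _ _) (norm_mul_le _ _))))
    _ ≤ ‖e * a' - a' * e‖ + (1 * ‖a - a'‖ + ‖a - a'‖ * 1) := by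
        gcongr <;> exact hnorm q
    _ < ε := by linarith

end CutDown

/-! ### Central largeness -/

section LargeSubalgebra

open Sections CStarCorrespondence

/-- The point evaluations are linearly independent functionals. -/
theorem not_finiteDimensional_continuousMap {X : Type u} [TopologicalSpace X] [CompactSpace X]
    [T2Space X] [Infinite X] : ¬ FiniteDimensional ℂ C(X, ℂ) := by
  intro hfin
  have h1 : LinearIndependent ℂ fun x : X =>
      (ContinuousMap.evalAlgHom ℂ ℂ x).toLinearMap := by
    let res : Module.Dual ℂ C(X, ℂ) →ₗ[ℂ] (C(X, ℂ) → ℂ) :=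
      { toFun := fun f => f, map_add' := fun _ _ => rfl, map_smul' := fun _ _ => rfl }
    refine LinearIndependent.of_comp res ?_
    refine (linearIndependent_monoidHom C(X, ℂ) ℂ).comp
      (fun x : X => ((ContinuousMap.evalAlgHom ℂ ℂ x : C(X, ℂ) →ₐ[ℂ] ℂ) : C(X, ℂ) →* ℂ))
      fun x y hxy => ?_
    by_contra hne
    obtain ⟨f, hf0, hf1, -⟩ := exists_continuous_zero_one_of_isClosed (isClosed_singleton (x := x))
      (isClosed_singleton (x := y)) (Set.disjoint_singleton.2 hne)
    have h2 : complexify f x = complexify f y := DFunLike.congr_fun hxy (complexify f)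
    rw [complexify_apply, complexify_apply, hf0 rfl, hf1 rfl] at h2
    simp at h2
  have := h1.finite
  exact not_finite X

theorem CuntzSubequivalentIn.of_conjugate {A : Type u} [CStarAlgebra A] {B : StarSubalgebra ℂ A}
    {z y f : A} {r : ℕ → A} (hz : z ∈ B) (hr : ∀ n, r n ∈ B)
    (h : Filter.Tendsto (fun n => ‖r n * y * star (r n) - f‖) Filter.atTop (𝓝 0)) :
    CuntzSubequivalentIn B (star z * f * z) y := by
  refine ⟨fun n => star z * r n, fun n => mul_mem (star_mem hz) (hr n), ?_⟩
  refine squeeze_zero (fun _ => norm_nonneg _) (fun n => ?_)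
    ((by simp : ‖star z‖ * 0 * ‖z‖ = 0) ▸ (h.const_mul ‖star z‖).mul_const ‖z‖)
  have h1 : star z * r n * y * star (star z * r n) - star z * f * z =
      star z * (r n * y * star (r n) - f) * z := by
    rw [star_mul, star_star]
    noncomm_ring
  rw [h1]
  refine (norm_mul_le _ _).trans ?_
  gcongr
  exact norm_mul_le _ _

variable {X : Type u} [TopologicalSpace X] [CompactSpace X] [T2Space X] {V : X → Type v}
  [∀ x, NormedAddCommGroup (V x)] [∀ x, InnerProductSpace ℂ (V x)]
  [TopologicalSpace (Bundle.TotalSpace ℂ V)] [FiberBundle ℂ V] [VectorBundle ℂ ℂ V]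
  [IsHermitianBundle V] {α : X ≃ₜ X} {Y : Set X}

/-- A section that has unit length over `α ^ m '' K`, multiplied by a function that vanishes on `Y`
and is `1` on `α ^ (m + 1) '' K`, is a local unitary; the function exists unless `m = -1`. -/
theorem hasLocalUnitaries_orbitBreaking (hYc : IsClosed Y) (hYd : Dense Yᶜ) {K : Set X} {R : ℕ}
    (hK : IsClosed K)
    (hKY : ∀ n : ℤ, n ≠ 0 → |n| ≤ (R + 1 : ℕ) → Disjoint Y ((α ^ n : X ≃ₜ X) '' K))
    (hKV : ∀ n : ℤ, |n| ≤ R → ∃ ξ : Sections V, ∀ x ∈ K, ‖ξ ((α ^ n) x)‖ = 1) :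
    HasLocalUnitaries α (CuntzPimsner.pi (correspondence V α))
      (orbitBreakingInclusion V α hYc hYd).range K R := by
  intro m hm hmR
  obtain ⟨ξ, hξ⟩ := hKV m hmR
  obtain ⟨f, hf0, hf1, -⟩ := exists_continuous_zero_one_of_isClosed hYc
    ((α ^ (m + 1) : X ≃ₜ X).isClosed_image.2 hK)
    (hKY (m + 1) (by omega) (by rw [abs_le] at *; push_cast; omega))
  set η : Sections V := pullback α 1 (complexify f) • ξ with hη
  have hnorm : ∀ x ∈ K, inner C(X, ℂ) η η ((α ^ m) x) = 1 := by
    intro x hx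
    have h1 : f ((α ^ (1 : ℤ)) ((α ^ m) x)) = 1 := by
      rw [← α.zpow_add_apply, add_comm]
      exact hf1 ⟨x, hx, rfl⟩
    rw [inner_apply, inner_self_eq_norm_sq_to_K, hη, Sections.smul_apply, norm_smul, pullback_apply,
      complexify_apply, h1, hξ x hx]
    simp
  have hmem : η ∈ (correspondence V α).idealSubmodule (ContinuousMap.idealOfSet ℂ Yᶜ) :=
    smul_mem_idealSubmodule (fun y hy => by simp [hf0 hy]) ξ
  refine ⟨CuntzPimsner.tau _ η, ⟨CuntzPimsner.tau (orbitBreaking V α Y) ⟨η, hmem⟩, rfl⟩,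
    fun f => ?_, inner C(X, ℂ) η η, pullback α (-1) (inner C(X, ℂ) η η),
    CuntzPimsner.star_tau_mul_tau η η,
    CuntzPimsner.tau_mul_star_tau isometry_correspondence_φ.injective (φ_eq_rankOne η η),
    fun x hx => ⟨hnorm x hx, ?_⟩⟩
  · rw [CuntzPimsner.pi_mul_tau, CuntzPimsner.tau_mul_pi, correspondence_φ_apply]
  · rw [pullback_apply, ← α.zpow_add_apply, neg_add_eq_sub, add_sub_cancel_right]
    exact hnorm x hx

theorem isCentrallyLarge_orbitBreaking [Infinite X] (hα : IsMinimalHomeomorph α)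
    (hYne : Y.Nonempty) (hYc : IsClosed Y) (hYd : Dense Yᶜ) (hY : MeetsOrbitsAtMostOnce α Y)
    (hYtriv : ∀ N : ℕ, ∃ W : Set X, IsOpen W ∧ Y ⊆ W ∧
      ∀ n : ℤ, -(N : ℤ) ≤ n → n ≤ N → IsTrivialOver V ((α ^ n : X ≃ₜ X) '' W)) :
    IsCentrallyLarge (orbitBreakingInclusion V α hYc hYd).range := by
  set A := (correspondence V α).CuntzPimsner
  let : PartialOrder A := CStarAlgebra.spectralOrder A
  have : StarOrderedRing A := CStarAlgebra.spectralOrderedRing A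
  let : PartialOrder (orbitBreaking V α Y).CuntzPimsner := CStarAlgebra.spectralOrder _
  have : StarOrderedRing (orbitBreaking V α Y).CuntzPimsner :=
    CStarAlgebra.spectralOrderedRing _
  set ι := orbitBreakingInclusion V α hYc hYd with hι
  set π := CuntzPimsner.pi (correspondence V α)
  have hιinj : Function.Injective ι := orbitBreakingInclusion_injective hYc hYd hα
  have hG := isCircleGraded (V := V) hα
  have hGY := isCircleGraded_orbitBreaking (V := V) hYc hYd hα
  have hfree : ∀ n : ℤ, n ≠ 0 → ∀ x, (α ^ n) x ≠ x := fun n hn x => hα.zpow_apply_ne hn x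
  have hnt : Nontrivial A := hG.pi_injective.nontrivial
  have hsimple : IsSimpleCStarAlgebra A := by
    refine hG.isSimpleCStarAlgebra hα hfree fun x => ?_
    obtain ⟨ξ, hξ⟩ := exists_norm_apply_eq_one (V := V) x
    refine ⟨ξ, _, CuntzPimsner.star_tau_mul_tau ξ ξ, ?_⟩
    rw [inner_apply, inner_self_eq_norm_sq_to_K, hξ]
    simp
  have hπ : ∀ f, π f ∈ ι.range := fun f => ⟨CuntzPimsner.pi (orbitBreaking V α Y) f, rfl⟩
  have hτ : ∀ f : C(X, ℂ), (∀ y ∈ Y, f y = 0) → ∀ ξ,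
      π f * CuntzPimsner.tau (correspondence V α) ξ ∈ ι.range := by
    intro f hf ξ
    rw [CuntzPimsner.pi_mul_tau, correspondence_φ_apply]
    exact ⟨CuntzPimsner.tau (orbitBreaking V α Y) ⟨_, smul_mem_idealSubmodule hf ξ⟩, rfl⟩
  have hpos : ∀ f : C(X, ℝ), (∀ x, 0 ≤ f x) → IsPositiveIn ι.range (π (complexify f)) :=
    fun f hf => ⟨π (complexify (sqrtMap f)), hπ _, by
      rw [(isSelfAdjoint_map_complexify _).star_eq, ← map_mul, ← complexify_mul,
        sqrtMap_mul_self hf]⟩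
  refine ⟨?_, fun hfin => ?_, hsimple, ?_⟩
  · change IsClosed (Set.range ι)
    exact (NonUnitalStarAlgHom.isometry ι hιinj).isClosedEmbedding.isClosed_range
  · exact not_finiteDimensional_continuousMap (X := X)
      (Module.Finite.of_injective (π : C(X, ℂ) →ₗ[ℂ] A) hG.pi_injective)
  intro m _ a ε hε x hx hx1 y hy hy0
  have hB : ∀ R : ℕ, ∃ W : Set X, IsOpen W ∧ Y ⊆ W ∧ ∀ K ⊆ W, IsClosed K →
      HasLocalUnitaries α π ι.range K R := by
    intro R
    obtain ⟨W₁, hW₁, hYW₁, hd⟩ := hY.exists_isOpen hYc (R + 1)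
    obtain ⟨W₂, hW₂, hYW₂, htriv⟩ := hYtriv R
    refine ⟨W₁ ∩ W₂, hW₁.inter hW₂, Set.subset_inter hYW₁ hYW₂, fun K hKW hK =>
      hasLocalUnitaries_orbitBreaking hYc hYd hK (fun n hn hnR => ?_) fun n hn => ?_⟩
    · refine Set.disjoint_left.2 ?_
      rintro _ hy ⟨x, hx, rfl⟩
      exact hd n hn hnR x (hKW hx).1 (hYW₁ hy)
    · rw [abs_le] at hn
      obtain ⟨ξ, hξ⟩ := exists_norm_eq_one_of_isTrivialOver (htriv n hn.1 hn.2)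
        ((α ^ n : X ≃ₜ X).isClosed_image.2 hK) (Set.image_mono fun x hx => (hKW hx).2)
      exact ⟨ξ, fun x hx => hξ _ ⟨x, hx, rfl⟩⟩
  -- Nonzero functions below `x` and `y`.
  obtain ⟨x₀, -, hx₀⟩ := hx
  have hx0 : x ≠ 0 := by
    rintro rfl
    simp at hx1
  have hxpos : 0 ≤ x := hx₀ ▸ star_mul_self_nonneg x₀
  obtain ⟨p₁, hp₁, r₁, hr₁⟩ := hG.exists_function_subequivalent hfree hxpos hx0
  obtain ⟨p₂, hp₂, r₂, hr₂B, hr₂⟩ : ∃ p : C(X, ℝ), p ≠ 0 ∧ ∃ r : ℕ → A, (∀ n, r n ∈ ι.range) ∧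
      Filter.Tendsto (fun n => ‖r n * y * star (r n) - π (complexify (p * p))‖)
        Filter.atTop (𝓝 0) := by
    obtain ⟨_, ⟨b, rfl⟩, hb⟩ := hy
    have hyb : y = ι (star b * b) := by rw [hb, map_mul, map_star]; rfl
    obtain ⟨p, hp, r, hr⟩ := hGY.exists_function_subequivalent hfree
      (star_mul_self_nonneg b) (fun h => hy0 (by rw [hyb, h, map_zero]))
    refine ⟨p, hp, fun n => ι (r n), fun n => ⟨r n, rfl⟩,
      squeeze_zero (fun _ => norm_nonneg _) (fun n => ?_) hr⟩
    rw [hyb, ← map_star ι (r n), ← map_mul, ← map_mul, ← orbitBreakingInclusion_pi hYc hYd, ← hι,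
      ← map_sub]
    exact NonUnitalStarAlgHom.norm_apply_le ι _
  have hvisit : ∀ p : C(X, ℝ), p ≠ 0 → ∃ L : ℕ, ∀ x, ∃ n ∈ Finset.Icc 1 L,
      p ((α ^ (n : ℤ)) x) ≠ 0 := by
    intro p hp
    obtain ⟨w, hw⟩ := DFunLike.ne_iff.1 hp
    exact hα.exists_uniform_pow_mem (U := {x | p x ≠ 0})
      (isOpen_ne_fun p.continuous continuous_const) ⟨w, hw⟩
  obtain ⟨L₁, hL₁⟩ := hvisit p₁ hp₁
  obtain ⟨L₂, hL₂⟩ := hvisit p₂ hp₂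
  have hmono : ∀ (p : C(X, ℝ)) (L : ℕ), L ≤ L₁ + L₂ →
      (∀ x, ∃ n ∈ Finset.Icc 1 L, p ((α ^ (n : ℤ)) x) ≠ 0) →
      ∀ x, ∃ n ∈ Finset.Icc 1 (L₁ + L₂), p ((α ^ (n : ℤ)) x) ≠ 0 := by
    intro p L hL h x
    obtain ⟨n, hn, hpn⟩ := h x
    exact ⟨n, Finset.Icc_subset_Icc_right hL hn, hpn⟩
  -- Approximants that are moved into the subalgebra by cutting down near `Y`.
  have hc : ∀ j, ∃ c : A, ‖c - a j‖ < ε ∧ ∃ N : ℕ, ∀ f : C(X, ℝ), (∀ x, 0 ≤ f x) →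
      (∀ i : ℤ, |i| ≤ N → ∀ y ∈ Y, f ((α ^ i) y) = 0) → π (complexify f) * c ∈ ι.range := by
    intro j
    obtain ⟨c, hc, hca⟩ := hG.dense_wordSpan.exists_dist_lt (a j) hε
    exact ⟨c, by rwa [← dist_eq_norm, dist_comm], hG.exists_forall_pi_mul_mem hπ hτ hc⟩
  choose c hca N hN using hc
  choose g hg0 hg1 hgz hgY hgα hgp using
    exists_cutdown_function hπ hYne hYc hY hB (L₁ + L₂) (Finset.univ.sup N)
  have hcentral := hG.isAsymptoticallyCentral hg0 hg1 hgα
  have hsubπ : ∀ q, π (complexify (1 - g q)) = 1 - π (complexify (g q)) := fun q => by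
    rw [complexify_sub, complexify_one, map_sub, map_one]
  -- The complements `1 - g` are asymptotically central of norm one, hence do not shrink `x`.
  have hcompress := hsimple.eventually_lt_norm_compress
    (e := fun q => 1 - π (complexify (g q))) (l := Filter.atTop)
    (fun a => (hcentral a).congr fun q => by
      rw [sub_mul, mul_sub, one_mul, mul_one, sub_sub_sub_cancel_left]
      exact norm_sub_rev _ _)
    (fun q => by rw [← hsubπ]; exact isSelfAdjoint_map_complexify _)
    (fun q => by
      rw [← hsubπ, NonUnitalStarAlgHom.norm_map π hG.pi_injective]
      refine le_antisymm (norm_complexify_le zero_le_one fun w => ?_) ?_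
      · change |1 - g q w| ≤ 1
        rw [abs_le]
        constructor <;> linarith [hg0 q w, hg1 q w]
      · obtain ⟨w, hw⟩ := hgz q
        refine le_trans (le_of_eq ?_) ((complexify (1 - g q)).norm_coe_le_norm w)
        rw [complexify_apply, ContinuousMap.sub_apply, hw]
        simp)
    hxpos hx1 hε
  obtain ⟨q, hq1, hq2⟩ := (hcompress.and (Filter.eventually_all.2 fun j =>
    (hcentral (a j)).eventually (gt_mem_nhds hε))).exists
  obtain ⟨z₁, -, hz₁⟩ := hgp q p₁ (hmono p₁ L₁ (Nat.le_add_right _ _) hL₁)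
  obtain ⟨z₂, hz₂B, hz₂⟩ := hgp q p₂ (hmono p₂ L₂ (Nat.le_add_left _ _) hL₂)
  refine ⟨c, π (complexify (g q)), hπ _, ⟨hpos _ (hg0 q), ?_⟩, hca, fun j => ?_, ⟨?_, ?_⟩, hq1, hq2⟩
  · rw [← hsubπ]
    exact hpos _ fun w => sub_nonneg.2 (hg1 q w)
  · rw [← hsubπ]
    refine hN j _ (fun w => sub_nonneg.2 (hg1 q w)) fun i hi w hw => ?_
    change 1 - g q ((α ^ i) w) = 0
    rw [hgY q i (hi.trans (by exact_mod_cast Finset.le_sup (Finset.mem_univ j))) w hw, sub_self]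
  · rw [← hz₂]
    exact .of_conjugate hz₂B hr₂B hr₂
  · rw [← hz₁]
    exact .of_conjugate (B := ⊤) trivial (fun _ => trivial) hr₁

end LargeSubalgebra

theorem mainTheorem6 {X : Type*} [MetricSpace X] [CompactSpace X] [Infinite X]
    (V : X → Type*) [∀ x, NormedAddCommGroup (V x)] [∀ x, InnerProductSpace ℂ (V x)]
    [TopologicalSpace (Bundle.TotalSpace ℂ V)] [FiberBundle ℂ V] [VectorBundle ℂ ℂ V]
    [IsHermitianBundle V]
    (α : X ≃ₜ X) (hα : IsMinimalHomeomorph α)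
    (Y : Set X) (hYne : Y.Nonempty) (hYclosed : IsClosed Y) (hYorbit : MeetsOrbitsAtMostOnce α Y)
    (hYtriv : ∀ N : ℕ, ∃ W : Set X, IsOpen W ∧ Y ⊆ W ∧
      ∀ n : ℤ, -(N : ℤ) ≤ n → n ≤ N → IsTrivialOver V ((α ^ n : X ≃ₜ X) '' W)) :
    ∃ ι : (orbitBreaking V α Y).CuntzPimsner →⋆ₐ[ℂ] (Sections.correspondence V α).CuntzPimsner,
      Function.Injective ι ∧
      (∀ f : C(X, ℂ), ι (CStarCorrespondence.CuntzPimsner.pi (orbitBreaking V α Y) f) =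
        CStarCorrespondence.CuntzPimsner.pi (Sections.correspondence V α) f) ∧
      (∀ ξ : (Sections.correspondence V α).idealSubmodule (ContinuousMap.idealOfSet ℂ Yᶜ),
        ι (CStarCorrespondence.CuntzPimsner.tau (orbitBreaking V α Y) ξ) =
          CStarCorrespondence.CuntzPimsner.tau (Sections.correspondence V α) ξ) ∧
      IsCentrallyLarge ι.range :=
  have hYd := hYorbit.dense_compl hα
  ⟨orbitBreakingInclusion V α hYclosed hYd, orbitBreakingInclusion_injective hYclosed hYd hα,
    orbitBreakingInclusion_pi hYclosed hYd, orbitBreakingInclusion_tau hYclosed hYd,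
    isCentrallyLarge_orbitBreaking hα hYne hYclosed hYd hYorbit hYtriv⟩
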